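/- **Setup.** Let $\mathbb F$ be an algebraically closed field of characteristic $0$, let $\mathfrak g$ be a finite-dimensional simple Lie algebra over $\mathbb F$ with a non-degenerate symmetric invariant bilinear form $(\cdot|\cdot)$, and let $\{f,2x,e\}\subset\mathfrak g$ be an $\mathfrak{sl}_2$-triple ($[e,f]=2x$, $[x,e]=e$, $[x,f]=-f$) such that $f$ is a minimal nilpotent element, i.e. a non-zero root vector of the lowest root of $\mathfrak g$ with respect to some Cartan subalgebra and some choice of simple roots. Write $\mathfrak g_j$ for the eigenspace of $\operatorname{ad}x$ with eigenvalue $j\in\frac12\mathbb Z$, $\mathfrak g_{\ge k}=\bigoplus_{j\ge k}\mathfrak g_j$, $\mathfrak g_{\le k}=\bigoplus_{j\le k}\mathfrak g_j$, and $\mathfrak g_0^f=\{a\in\mathfrak g_0: [f,a]=0\}$. Let $d$ be the largest $j$ with $\mathfrak g_j\neq 0$, and fix $s\in\mathfrak g_d$ and $z\in\mathbb F$. Let $\mathcal V(\mathfrak g)=S(\mathbb F[\partial]\mathfrak g)$ be the algebra of differential polynomials over $\mathfrak g$, with the $\lambda$-bracket given on $a,b\in\mathfrak g$ by $$\{a_\lambda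 b\}_z=[a,b]+(a|b)\lambda+z(s|[a,b])$$ and extended to $\mathcal V(\mathfrak g)$ by the Master Formula: if $\{q_i\}$ is a basis of $\mathfrak g$ consisting of eigenvectors of $\operatorname{ad}x$, then $$\{g_\lambda h\}_z=\sum_{i,j,m,n}\frac{\partial h}{\partial q_j^{(n)}}(\partial+\lambda)^n\,\{q_{i\,\partial+\lambda}\,q_j\}_z{}_{\to}\,(-\lambda-\partial)^m\frac{\partial g}{\partial q_i^{(m)}},$$ where $\{q_{i\,\partial+\lambda}\,q_j\}_z{}_{\to}$ is the operator obtained from $\{q_{i\,\lambda}\,q_j\}_z$ by replacing $\lambda$ by $\partial+\lambda$ acting on everything to its right. Let $\rho:\mathcal V(\mathfrak g)\to\mathcal V(\mathfrak g_{\le\frac12})=S(\mathbb F[\partial]\mathfrak g_{\le\frac12})$ be the differential algebra homomorphism with $\rho(a)=\pi_{\le\frac12}(a)+(f|a)$ for $a\in\mathfrak g$, where $\pi_{\le\frac12}$ is the projection onto $\mathfrak g_{\le\frac12}$ with kernel $\mathfrak g_{\ge1}$. The classical $\mathcal W$-algebra is $$\mathcal W=\{P\in\mathcal V(\mathfrak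 g_{\le\frac12}) : \rho\{a_\lambda P\}_z=0\ \text{ for all } a\in\mathfrak g_{\ge\frac12}\},$$ with the $\lambda$-bracket $\{g_\lambda h\}_{z,\rho}=\rho\{g_\lambda h\}_z$. Give $a^{(n)}$, for $a\in\mathfrak g_j$ and $n\ge0$, the conformal weight $1-j+n$, extend this additively to products, and let $\mathcal W\{\Delta\}$ be the set of elements of $\mathcal W$ that are homogeneous of conformal weight $\Delta$. Let $\{a_j\},\{a^j\}$ be bases of $\mathfrak g_0$ dual with respect to $(\cdot|\cdot)$, $(a_i|a^j)=\delta_{ij}$, and let $\{v_k\},\{v^k\}$ be bases of $\mathfrak g_{\frac12}$ with $(f|[v_h,v^k])=\delta_{hk}$. Put $$L=f+\partial x+\tfrac12\sum_j a_ja^j+\sum_k v^k[f,v_k]+\tfrac12\sum_k v^k\partial v_k ,$$ $$\varphi(a)=a+\tfrac12\sum_k[a,v_k]v^k\qquad(a\in\mathfrak g_0^f),$$ $$\psi(u)=u+\tfrac13\sum_{h,k}[[u,v_h],v_k]v^hv^k+\sum_k[u,v_k]v^k+\partial[e,u]\qquad(u\in\mathfrak g_{-\frac12}).$$ **Theorem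 4.1.** 1. $\varphi$ is a bijection of $\mathfrak g_0^f$ onto $\mathcal W\{1\}$, and $\psi$ is a bijection of $\mathfrak g_{-\frac12}$ onto $\mathcal W\{\frac32\}$. 2. $L\in\mathcal W\{2\}$, and $L$ is a Virasoro element: $\{L_\lambda L\}_{z,\rho}=(\partial+2\lambda)L+c\lambda^3+\alpha\lambda$ for some $c,\alpha\in\mathbb F$. For $z=0$ it is an energy-momentum element of $\mathcal W$: in addition, $\mathcal W$ has a basis consisting of elements $w$ with $\{L_\lambda w\}_{0,\rho}=(\partial+\Delta_w\lambda)w+O(\lambda^2)$ for some $\Delta_w\in\mathbb F$. 3. $\mathcal W$ is the algebra of differential polynomials generated by $L$, $\varphi(\mathfrak g_0^f)$ and $\psi(\mathfrak g_{-\frac12})$: for any bases $\{c_i\}$ of $\mathfrak g_0^f$ and $\{u_j\}$ of $\mathfrak g_{-\frac12}$, the elements $\partial^nL$, $\partial^n\varphi(c_i)$, $\partial^n\psi(u_j)$ $(n\ge0)$ are algebraically independent over $\mathbb F$ and generate $\mathcal W$ as an $\mathbb F$-algebra. -/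

import Mathlib

open Polynomial

noncomputable section

namespace ClassicalW

/-! ### Differential polynomials and lambda-brackets -/

section DifferentialPolynomials

variable (F : Type*) [Field F] (ι : Type*)

/-- The algebra of differential polynomials `F[u_i^{(n)} | i ∈ ι, n ≥ 0]`; the variable
`u_i^{(n)}` is `MvPolynomial.X (i, n)`. -/
abbrev DiffPoly : Type _ := MvPolynomial (ι × ℕ) F

variable {F ι}

/-- The derivation `∂` of the algebra of differential polynomials, `∂ u_i^{(n)} = u_i^{(n+1)}`. -/
def del : Derivation F (DiffPoly F ι) (DiffPoly F ι) :=
  MvPolynomial.mkDerivation F fun p => MvPolynomial.X (p.1, p.2 + 1)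

/-- The operator `∂ + λ` on polynomials in `λ` with coefficients in differential polynomials
(the polynomial variable `X` is `λ`, and `∂` acts on the coefficients). -/
def lamDel : Module.End F (DiffPoly F ι)[X] :=
  Polynomial.lsum (fun n =>
      ((Polynomial.monomial (R := DiffPoly F ι) n).restrictScalars F ∘ₗ del.toLinearMap))
    + LinearMap.mulLeft F (X : (DiffPoly F ι)[X])

/-- For `P = ∑ P_k λ^k`, the result `∑ P_k (∂ + λ)^k p` of applying `P(∂ + λ)` to `p`. -/
def applyOp (P p : (DiffPoly F ι)[X]) : (DiffPoly F ι)[X] :=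
  P.sum fun k c => C c * (lamDel ^ k) p

/-- The Master Formula: the bracket
`{g_λ h} = ∑ (∂h/∂u_j^{(n)}) (∂+λ)^n H_{ji}(∂+λ) (-λ-∂)^m (∂g/∂u_i^{(m)})`
attached to the values `H_{ji}(λ) = {u_i _λ u_j}` on generators, here called `br i j`.
(The partial derivatives vanish outside the variables that occur in `g` and `h`.) -/
def masterBracket (br : ι → ι → (DiffPoly F ι)[X]) (g h : DiffPoly F ι) : (DiffPoly F ι)[X] :=
  ∑ v ∈ h.vars, ∑ w ∈ g.vars,
    C (MvPolynomial.pderiv v h) *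
      (lamDel ^ v.2) (applyOp (br w.1 v.1) (((-lamDel) ^ w.2) (C (MvPolynomial.pderiv w g))))

/-- The differential subspace `W` is the algebra of differential polynomials in the family `w`:
the elements `∂^n w_k` are algebraically independent and generate `W` as an algebra. -/
def IsDiffPolyAlgebraOn {κ : Type*} (W : Set (DiffPoly F ι)) (w : κ → DiffPoly F ι) : Prop :=
  AlgebraicIndependent F (fun p : κ × ℕ => (del^[p.2]) (w p.1)) ∧
    (Algebra.adjoin F (Set.range fun p : κ × ℕ => (del^[p.2]) (w p.1)) : Set (DiffPoly F ι)) = W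

/-- `L` is a Virasoro element: `{L_λ L} = (∂ + 2λ) L + c λ³ + α λ` with `c, α ∈ F`. -/
def IsVirasoro (br : DiffPoly F ι → DiffPoly F ι → (DiffPoly F ι)[X]) (L : DiffPoly F ι) : Prop :=
  ∃ c α : F, br L L =
    C (del L) + 2 * X * C L + C (MvPolynomial.C c) * X ^ 3 + C (MvPolynomial.C α) * X

/-- `a` is an eigenvector for `L` of conformal weight `Δ`:
`{L_λ a} = (∂ + Δ λ) a + O(λ²)`. -/
def IsEigenvector (br : DiffPoly F ι → DiffPoly F ι → (DiffPoly F ι)[X]) (L : DiffPoly F ι)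
    (Δ : F) (a : DiffPoly F ι) : Prop :=
  (br L a).coeff 0 = del a ∧ (br L a).coeff 1 = Δ • a

/-- `L` is an energy-momentum element of `W`: a Virasoro element in `W` such that `W` has a basis
(as a vector space) consisting of eigenvectors of `L`. -/
def IsEnergyMomentum (W : Set (DiffPoly F ι))
    (br : DiffPoly F ι → DiffPoly F ι → (DiffPoly F ι)[X]) (L : DiffPoly F ι) : Prop :=
  L ∈ W ∧ IsVirasoro br L ∧
    ∃ S : Set (DiffPoly F ι), LinearIndepOn F id S ∧
      (Submodule.span F S : Set (DiffPoly F ι)) = W ∧ ∀ a ∈ S, ∃ Δ : F, IsEigenvector br L Δ a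

end DifferentialPolynomials

/-! ### Minimal nilpotent elements and the grading -/

section LieAlgebra

variable {F : Type*} [Field F] {g : Type*} [LieRing g] [LieAlgebra F g]

/-- `f` is a minimal nilpotent element of the simple Lie algebra `g`: a lowest root vector, i.e. a
non-zero vector in the root space of the lowest root `α` for some Cartan subalgebra and some base
of its root system (`α` is lowest if `β - α` is, for every root `β`, a sum of simple roots with
non-negative integer coefficients). -/
def IsMinimalNilpotent [CharZero F] [IsAlgClosed F] [FiniteDimensional F g]
    [LieAlgebra.IsSimple F g] (f : g) : Prop :=
  ∃ (H : LieSubalgebra F g) (_ : H.IsCartanSubalgebra)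
    (b : (LieAlgebra.IsKilling.rootSystem H).Base) (α : H.root),
    (∀ β : H.root,
      (LieAlgebra.IsKilling.rootSystem H).root β - (LieAlgebra.IsKilling.rootSystem H).root α ∈
        AddSubmonoid.closure ((LieAlgebra.IsKilling.rootSystem H).root '' b.support)) ∧
    f ∈ LieAlgebra.rootSpace H α.1 ∧ f ≠ 0

/-- The eigenspace `g_j` of `ad x` with eigenvalue `j`. -/
def gr (x : g) (j : ℚ) : Submodule F g :=
  Module.End.eigenspace (LieAlgebra.ad F g x) (j : F)

/-- `g_{≥ k}`, the sum of the eigenspaces `g_j` with `j ≥ k`. -/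
def grGe (x : g) (k : ℚ) : Submodule F g :=
  ⨆ j : {j : ℚ // k ≤ j}, gr x j.1

/-- `g_0^f`, the centralizer of `f` in `g_0`. -/
def grZeroCentralizer (x f : g) : Submodule F g :=
  gr x 0 ⊓ LinearMap.ker (LieAlgebra.ad F g f : g →ₗ[F] g)

end LieAlgebra

/-! ### The classical W-algebra

`q` is a basis of `g` consisting of eigenvectors of `ad x`, with `q i` of degree `deg i`; `V(g)` is
the algebra of differential polynomials in the `q i`, and `V(g_{≤1/2})` is its subalgebra generated
by the variables `q i ^{(n)}` with `deg i ≤ 1/2`. -/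

section WAlgebra

variable {F : Type*} [Field F] {g : Type*} [LieRing g] [LieAlgebra F g] {ι : Type*}

/-- The inclusion `g → V(g)`, sending `q i` to the variable `q i ^{(0)}`. -/
def incl (q : Module.Basis ι F g) : g →ₗ[F] DiffPoly F ι :=
  q.constr F fun i => MvPolynomial.X (i, 0)

/-- The lambda-bracket on `V(g)` with `{a_λ b}_z = [a,b] + (a|b) λ + z (s|[a,b])` for `a, b ∈ g`. -/
def affineBracket (B : LinearMap.BilinForm F g) (q : Module.Basis ι F g) (s : g) (z : F) :
    DiffPoly F ι → DiffPoly F ι → (DiffPoly F ι)[X] :=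
  masterBracket fun i j =>
    C (incl q ⁅q i, q j⁆ + MvPolynomial.C (z * B s ⁅q i, q j⁆))
      + C (MvPolynomial.C (B (q i) (q j))) * X

/-- The differential algebra homomorphism `ρ : V(g) → V(g_{≤1/2})`,
`ρ(a) = π_{≤1/2}(a) + (f|a)` for `a ∈ g`. -/
def rho (B : LinearMap.BilinForm F g) (q : Module.Basis ι F g) (deg : ι → ℚ) (f : g) :
    DiffPoly F ι →ₐ[F] DiffPoly F ι :=
  MvPolynomial.aeval fun p : ι × ℕ =>
    (del^[p.2]) ((if deg p.1 ≤ 1 / 2 then MvPolynomial.X (p.1, 0) else 0)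
      + MvPolynomial.C (B f (q p.1)))

/-- The bracket `{g_λ h}_{z,ρ} = ρ{g_λ h}_z`, with `ρ` applied to the coefficients. -/
def rhoBracket (B : LinearMap.BilinForm F g) (q : Module.Basis ι F g) (deg : ι → ℚ) (f s : g)
    (z : F) (a b : DiffPoly F ι) : (DiffPoly F ι)[X] :=
  (affineBracket B q s z a b).map (rho B q deg f).toRingHom

/-- The classical W-algebra: all `P ∈ V(g_{≤1/2})` with `ρ{a_λ P}_z = 0` for all
`a ∈ g_{≥1/2}`. -/
def W (B : LinearMap.BilinForm F g) (q : Module.Basis ι F g) (deg : ι → ℚ) (f x s : g) (z : F) :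
    Set (DiffPoly F ι) :=
  {P | P ∈ MvPolynomial.supported F {p : ι × ℕ | deg p.1 ≤ 1 / 2} ∧
    ∀ a ∈ (grGe x (1 / 2) : Submodule F g), rhoBracket B q deg f s z (incl q a) P = 0}

/-- `W{Δ}`, the elements of `W` of conformal weight `Δ`, where `a^{(n)}` has conformal weight
`1 - j + n` for `a ∈ g_j`. -/
def Wgr (B : LinearMap.BilinForm F g) (q : Module.Basis ι F g) (deg : ι → ℚ) (f x s : g) (z : F)
    (Δ : ℚ) : Set (DiffPoly F ι) :=
  W B q deg f x s z ∩
    (MvPolynomial.weightedHomogeneousSubmodule F (fun p : ι × ℕ => 1 - deg p.1 + (p.2 : ℚ)) Δ :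
      Set (DiffPoly F ι))

variable {J₀ J : Type*} [Fintype J₀] [Fintype J]

/-- `L = f + x' + ½ ∑ a_j a^j + ∑ v^k [f, v_k] + ½ ∑ v^k ∂v_k`. -/
def virL (q : Module.Basis ι F g) (f x : g) (a a' : J₀ → g) (v v' : J → g) : DiffPoly F ι :=
  incl q f + del (incl q x) + (1 / 2 : F) • ∑ j, incl q (a j) * incl q (a' j)
    + ∑ k, incl q (v' k) * incl q ⁅f, v k⁆
    + (1 / 2 : F) • ∑ k, incl q (v' k) * del (incl q (v k))

/-- `φ(a) = a + ½ ∑ [a, v_k] v^k`. -/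
def phi (q : Module.Basis ι F g) (v v' : J → g) (a : g) : DiffPoly F ι :=
  incl q a + (1 / 2 : F) • ∑ k, incl q ⁅a, v k⁆ * incl q (v' k)

/-- `ψ(u) = u + ⅓ ∑ [[u, v_h], v_k] v^h v^k + ∑ [u, v_k] v^k + ∂[e, u]`. -/
def psi (q : Module.Basis ι F g) (e : g) (v v' : J → g) (u : g) : DiffPoly F ι :=
  incl q u
    + (1 / 3 : F) • ∑ h, ∑ k, incl q ⁅⁅u, v h⁆, v k⁆ * incl q (v' h) * incl q (v' k)
    + ∑ k, incl q ⁅u, v k⁆ * incl q (v' k)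
    + del (incl q ⁅e, u⁆)

end WAlgebra

end ClassicalW

end

open Polynomial

noncomputable section

set_option linter.unusedSectionVars false

namespace ClassicalW

/-! ### Minimal nilpotent elements are extremal -/

/-! The lowest root vector f is extremal: (ad f)² maps g into the line F f. With sl₂-theory and the
duality between g_j and g_{-j}, this forces g = F f ⊕ g_{-1/2} ⊕ g_0 ⊕ g_{1/2} ⊕ F e
(`minimalGrading_of_isSl2Triple`). Everything else uses only this five-term grading.

On V(g_{≤1/2}) the map P ↦ ρ{y_λ P} is a derivation intertwining ∂ with ∂ + λ, and W is the common
kernel of these derivations for y = e and y ∈ g_{1/2} (`mem_W_iff`). That L, φ(a) and ψ(u) lie in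
this kernel is a computation with dual families (`adDer_half_virL`, `adDer_half_phi`,
`adDer_half_psi` and their counterparts for e).

Conversely, L, φ(c_i), ψ(u_j) have linear leading terms f, c_i, u_j, with corrections built from
pieces of lower level. So together with x and the v_k they freely generate V(g_{≤1/2}) as a
differential algebra (`algebraicIndependent_generator`, `adjoin_generator`). The derivation of e
kills the derivatives of all these generators except the x^{(n)}, which it sends to a non-zero
multiple of λ^n. Comparing powers of λ, an element of W cannot involve x^{(n)}; the derivations of
the v^k then exclude the v_k^{(n)} in the same way (`adjoin_eq_W`). This gives the generation of W.
The generators have weights 2, 1 and 3/2, so below weight 2 no products occur, and the descriptions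
of W{1} and W{3/2} follow (`mem_of_mem_Wgr`).

For the Virasoro property, the bracket of L with an element of W is the same as that of T = ½ ∑ p_i
p^i + ∂x, with p_i, p^i dual families of all of g, because the terms in which they differ involve
the action of e or g_{1/2}, which is zero on W (`rhoBracket_virL`). Invariance of the Casimir
element makes T act on y ∈ g_j by (∂ + (1-j)λ)y up to explicit corrections (`sugawaraDer_incl`).
Evaluating on L gives {L_λ L}; for z = 0 the monomials in the derivatives of the generators form a
basis of eigenvectors (`exists_eigenbasis`). -/

theorem eq_zero_of_mem_closure_of_neg_mem_closure {F M : Type*} [Field F] [CharZero F]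
    [AddCommGroup M] [Module F M] {ι : Type*} {r : ι → M} {s : Set ι} (hr : LinearIndepOn F r s)
    {y : M} (h₁ : y ∈ AddSubmonoid.closure (r '' s)) (h₂ : -y ∈ AddSubmonoid.closure (r '' s)) :
    y = 0 := by
  -- A height functional: a sum of the r i is either zero or has positive integral height, so y and
  -- -y cannot both be non-zero sums.
  obtain ⟨l, hl⟩ : ∃ l : M →ₗ[F] F, ∀ i ∈ s, l (r i) = 1 := by
    let b := Module.Basis.extend hr.id_image
    refine ⟨b.constr F fun _ => 1, fun i hi => ?_⟩
    have hmem : r i ∈ hr.id_image.extend (Set.subset_univ _) :=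
      hr.id_image.subset_extend _ ⟨i, hi, rfl⟩
    have : r i = b ⟨r i, hmem⟩ := by simp [b]
    rw [this, Module.Basis.constr_basis]
  have key : ∀ w ∈ AddSubmonoid.closure (r '' s), w = 0 ∨ ∃ n : ℕ, l w = n + 1 := by
    intro w hw
    induction hw using AddSubmonoid.closure_induction with
    | mem w hw =>
      obtain ⟨i, hi, rfl⟩ := hw
      exact Or.inr ⟨0, by simp [hl i hi]⟩
    | zero => exact Or.inl rfl
    | add w₁ w₂ _ _ h₁ h₂ =>
      rcases h₁ with rfl | ⟨n, hn⟩
      · simpa using h₂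
      rcases h₂ with rfl | ⟨m, hm⟩
      · exact Or.inr ⟨n, by simpa using hn⟩
      · exact Or.inr ⟨n + m + 1, by rw [map_add, hn, hm]; push_cast; ring⟩
  rcases key y h₁ with h | ⟨n, hn⟩
  · exact h
  rcases key (-y) h₂ with h | ⟨m, hm⟩
  · simpa using h
  · rw [map_neg, hn] at hm
    have hnm : ((n + m + 2 : ℕ) : F) = 0 := by
      push_cast
      linear_combination -hm
    exact absurd hnm (Nat.cast_ne_zero.mpr (by omega))

section Extremal

variable {F : Type*} [Field F] [CharZero F] [IsAlgClosed F]
  {g : Type*} [LieRing g] [LieAlgebra F g] [FiniteDimensional F g] [LieAlgebra.IsSimple F g]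

open LieAlgebra LieModule in
/-- A minimal nilpotent element `f` is extremal: `(ad f)²` maps `g` to the line through `f`. -/
theorem IsMinimalNilpotent.exists_lie_lie_eq_smul {f : g} (hf : IsMinimalNilpotent (F := F) f)
    (y : g) : ∃ c : F, ⁅f, ⁅f, y⁆⁆ = c • f := by
  obtain ⟨H, hH, b, α, hα, hfα, hf0⟩ := hf
  suffices h : y ∈ (F ∙ f).comap ((ad F g f) ∘ₗ (ad F g f) : g →ₗ[F] g) by
    obtain ⟨c, hc⟩ := Submodule.mem_span_singleton.mp (Submodule.mem_comap.mp h)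
    exact ⟨c, hc.symm⟩
  have hα0 : (α : Weight F H g).IsNonZero := LieSubalgebra.isNonZero_coe_root α
  have hroot : ∀ β : Weight F H g, β.IsNonZero →
      β.toLinear - (α : Weight F H g).toLinear ∈
        AddSubmonoid.closure ((IsKilling.rootSystem H).root '' b.support) := fun β hβ =>
    hα ⟨β, by simpa [LieSubalgebra.root] using hβ⟩
  have hpt := @eq_zero_of_mem_closure_of_neg_mem_closure F _ _ _ _ _ _ _ _ b.linearIndepOn_root
  -- If 2α were a weight, comparing α with 2α and with -α would put both α and -2α in the positive
  -- cone, which is pointed.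
  have h2 : ∀ γ : Weight F H g, γ.toLinear ≠ (2 : ℕ) • (α : Weight F H g).toLinear := by
    intro γ hγ
    have hα1 : (α : Weight F H g).toLinear ≠ 0 := by simp
    have hγ0 : γ.IsNonZero := by
      intro h0
      have : γ.toLinear = 0 := by simpa using h0
      rw [this] at hγ
      exact hα1 (by simpa using hγ.symm)
    have e1 := hroot γ hγ0
    have e2 := hroot (-α) hα0.neg
    rw [hγ] at e1
    refine hα1 ?_
    have := hpt (y := (2 : ℕ) • (α : Weight F H g).toLinear)
      (by have := add_mem e1 e1; convert this using 1; module)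
      (by rw [Weight.toLinear_neg] at e2; convert e2 using 1; module)
    simp at this
  have htop := iSup_genWeightSpace_eq_top' F H g
  have : ((⨆ χ : Weight F H g, rootSpace H χ : LieSubmodule F H g) : Submodule F g) ≤
      (F ∙ f).comap ((ad F g f) ∘ₗ (ad F g f) : g →ₗ[F] g) := by
    rw [LieSubmodule.iSup_toSubmodule]
    refine iSup_le fun β w hw => ?_
    have hw' : w ∈ rootSpace H β := hw
    have hm : ⁅f, ⁅f, w⁆⁆ ∈ rootSpace H ((α : Weight F H g) + ((α : Weight F H g) + β) : H → F) :=
      lie_mem_genWeightSpace_of_mem_genWeightSpace hfα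
        (lie_mem_genWeightSpace_of_mem_genWeightSpace hfα hw')
    change ⁅f, ⁅f, w⁆⁆ ∈ F ∙ f
    by_cases h0 : ⁅f, ⁅f, w⁆⁆ = 0
    · rw [h0]; exact zero_mem _
    -- A non-zero value has weight γ = 2α + β. Comparing the lowest root α with γ and with -β puts α
    -- + β and its negative in the cone, so γ = α, and the root space of α is the line through f.
    have hne : rootSpace H ((α : Weight F H g) + ((α : Weight F H g) + β) : H → F) ≠ ⊥ := by
      intro hbot
      rw [hbot] at hm
      exact h0 (by simpa using hm)
    let γ : Weight F H g := ⟨_, hne⟩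
    have hγ : γ.toLinear = (2 : ℕ) • (α : Weight F H g).toLinear + β.toLinear := by
      ext h
      simp [γ, two_mul, add_assoc]
    have hβ0 : β.IsNonZero := by
      intro hz
      have : β.toLinear = 0 := by simpa using hz
      exact h2 γ (by rw [hγ, this, add_zero])
    have hγ0 : γ.IsNonZero := by
      intro hz
      have : γ.toLinear = 0 := by simpa using hz
      refine h2 (-β) ?_
      rw [Weight.toLinear_neg]
      rw [this] at hγ
      exact neg_eq_of_add_eq_zero_left hγ.symm
    have hsum : (α : Weight F H g).toLinear + β.toLinear = 0 := by
      refine hpt ?_ ?_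
      · have := hroot γ hγ0
        rw [hγ] at this
        convert this using 1
        module
      · have := hroot (-β) hβ0.neg
        rw [Weight.toLinear_neg] at this
        convert this using 1
        module
    have hγα : ((α : Weight F H g) + ((α : Weight F H g) + β) : H → F) = (α : Weight F H g) := by
      ext h
      have := LinearMap.congr_fun hsum h
      simp only [LinearMap.add_apply, Weight.toLinear_apply, LinearMap.zero_apply] at this
      simp [this]
    rw [hγα] at hm
    obtain ⟨c, hc⟩ := (finrank_eq_one_iff_of_nonzero' (⟨f, hfα⟩ : rootSpace H α.1)
      (by simpa [Subtype.ext_iff] using hf0)).mp (IsKilling.finrank_rootSpace_eq_one α.1 hα0)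
      ⟨_, hm⟩
    exact Submodule.mem_span_singleton.mpr ⟨c, congrArg Subtype.val hc⟩
  rw [htop] at this
  exact this (by simp)

end Extremal

/-! ### The grading attached to an extremal `sl₂`-triple -/

section Grading

variable {F : Type*} [Field F] {g : Type*} [LieRing g] [LieAlgebra F g]

theorem mem_gr {x : g} {j : ℚ} {y : g} : y ∈ (gr x j : Submodule F g) ↔ ⁅x, y⁆ = (j : F) • y := by
  rw [gr, Module.End.mem_eigenspace_iff, LieAlgebra.ad_apply]

theorem mem_grZeroCentralizer {x f y : g} :
    y ∈ (grZeroCentralizer x f : Submodule F g) ↔ ⁅x, y⁆ = 0 ∧ ⁅f, y⁆ = 0 := by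
  simp [grZeroCentralizer, mem_gr]

variable [CharZero F]

theorem lie_mem_gr {x : g} {i j k : ℚ} {y w : g} (hy : y ∈ (gr x i : Submodule F g))
    (hw : w ∈ (gr x j : Submodule F g)) (hk : k = i + j) :
    ⁅y, w⁆ ∈ (gr x k : Submodule F g) := by
  rw [mem_gr] at *
  rw [leibniz_lie, hy, hw, hk, smul_lie, lie_smul, Rat.cast_add, add_smul]

/-- The properties of the triple `e, x, f` and the form `B` used for the classical W-algebra: the
grading by `ad x` is `g = F f ⊕ g_{-1/2} ⊕ g_0 ⊕ g_{1/2} ⊕ F e`. -/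
structure MinimalGrading (B : LinearMap.BilinForm F g) (e x f : g) : Prop where
  symm : ∀ y w, B y w = B w y
  inv : ∀ y w t, B ⁅y, w⁆ t = B y ⁅w, t⁆
  nondeg : ∀ y, (∀ w, B y w = 0) → y = 0
  lie_ef : ⁅e, f⁆ = (2 : F) • x
  lie_xe : ⁅x, e⁆ = e
  lie_xf : ⁅x, f⁆ = -f
  f_ne : f ≠ 0
  degree : ∀ j : ℚ, (gr x j : Submodule F g) ≠ ⊥ → j = -1 ∨ j = -1 / 2 ∨ j = 0 ∨ j = 1 / 2 ∨ j = 1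
  one : ∀ y ∈ (gr x 1 : Submodule F g), ∃ c : F, y = c • e
  neg_one : ∀ y ∈ (gr x (-1) : Submodule F g), ∃ c : F, y = c • f
  iSup_gr : ⨆ j : ℚ, (gr x j : Submodule F g) = ⊤

/-- Invariance under ad x gives (i + j)(y|w) = 0. -/
theorem form_eq_zero_of_mem_gr {B : LinearMap.BilinForm F g}
    (hinv : ∀ y w t, B ⁅y, w⁆ t = B y ⁅w, t⁆) {x : g} {i j : ℚ} {y w : g}
    (hy : y ∈ (gr x i : Submodule F g)) (hw : w ∈ (gr x j : Submodule F g)) (hij : i + j ≠ 0) :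
    B y w = 0 := by
  rw [mem_gr] at hy hw
  have h := hinv y x w
  rw [← lie_skew, hy, hw] at h
  simp only [map_neg, map_smul, LinearMap.neg_apply, LinearMap.smul_apply, smul_eq_mul] at h
  have h2 : ((i + j : ℚ) : F) * B y w = 0 := by
    push_cast
    linear_combination -h
  exact (mul_eq_zero.mp h2).resolve_left (by exact_mod_cast hij)

/-- A non-zero y killed by f would be primitive for the reversed triple, whose Cartan element is
-2x, so -2j would be a natural number. -/
theorem gr_eq_bot_of_lie_f_eq_zero [FiniteDimensional F g] {e x f : g}
    (ht : IsSl2Triple ((2 : F) • x) e f) {j : ℚ} (hj : 0 < j) {y : g}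
    (hy : y ∈ (gr x j : Submodule F g)) (hfy : ⁅f, y⁆ = 0) : y = 0 := by
  by_contra h0
  have P : ht.symm.HasPrimitiveVectorWith y (((-2 * j : ℚ)) : F) :=
    ⟨h0, by rw [neg_lie, smul_lie, mem_gr.mp hy, smul_smul, ← neg_smul]; push_cast; ring_nf, hfy⟩
  obtain ⟨n, hn⟩ := P.exists_nat
  have : (-2 * j : ℚ) = n := by exact_mod_cast hn
  have h2 : (0 : ℚ) ≤ n := n.cast_nonneg
  linarith

theorem exists_nat_of_lie_e_eq_zero [FiniteDimensional F g] {e x f : g}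
    (ht : IsSl2Triple ((2 : F) • x) e f) {j : ℚ} {y : g}
    (hy : y ∈ (gr x j : Submodule F g)) (hey : ⁅e, y⁆ = 0) (h0 : y ≠ 0) : ∃ n : ℕ, 2 * j = n := by
  have P : ht.HasPrimitiveVectorWith y (((2 * j : ℚ)) : F) :=
    ⟨h0, by rw [smul_lie, mem_gr.mp hy, smul_smul]; push_cast; ring_nf, hey⟩
  obtain ⟨n, hn⟩ := P.exists_nat
  exact ⟨n, by exact_mod_cast hn⟩

/-- For y of degree j > 1, (ad f)² y has degree j - 2 ≠ -1 and yet is a multiple of f, so it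
vanishes; as ad f is injective in positive degrees, y = 0. Duality then removes the degrees below
-1. -/
theorem minimalGrading_of_isSl2Triple [FiniteDimensional F g] {B : LinearMap.BilinForm F g}
    (hBnd : B.Nondegenerate) (hBsymm : B.IsSymm) (hBinv : B.lieInvariant g) {e x f : g}
    (ht : IsSl2Triple ((2 : F) • x) e f) (hext : ∀ y, ∃ c : F, ⁅f, ⁅f, y⁆⁆ = c • f)
    {ι : Type*} (q : Module.Basis ι F g) (deg : ι → ℚ)
    (hq : ∀ i, q i ∈ (gr x (deg i) : Submodule F g)) : MinimalGrading B e x f := by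
  have hinv : ∀ y w t, B ⁅y, w⁆ t = B y ⁅w, t⁆ := fun y w t => by
    rw [← lie_skew, map_neg, LinearMap.neg_apply, hBinv, neg_neg]
  have hxe : ⁅x, e⁆ = e := by
    have := ht.lie_h_e_smul F
    rw [smul_lie] at this
    exact (smul_right_injective g (two_ne_zero : (2 : F) ≠ 0)) this
  have hxf : ⁅x, f⁆ = -f := by
    have := ht.lie_lie_smul_f F
    rw [smul_lie, ← smul_neg] at this
    exact (smul_right_injective g (two_ne_zero : (2 : F) ≠ 0)) this
  have hef := ht.lie_e_f
  have hem : e ∈ (gr x 1 : Submodule F g) := by rw [mem_gr, hxe]; simp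
  have hfm : f ∈ (gr x (-1) : Submodule F g) := by rw [mem_gr, hxf]; simp
  have htop : ⨆ j : ℚ, (gr x j : Submodule F g) = ⊤ := by
    rw [eq_top_iff, ← q.span_eq, Submodule.span_le]
    rintro _ ⟨i, rfl⟩
    exact Submodule.mem_iSup_of_mem (deg i) (hq i)
  have hnd : ∀ y, (∀ w, B y w = 0) → y = 0 := hBnd.1
  -- duality
  have hdual : ∀ (j : ℚ) (y : g), y ∈ (gr x j : Submodule F g) →
      (∀ w ∈ (gr x (-j) : Submodule F g), B y w = 0) → y = 0 := by
    intro j y hy h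
    refine hnd y fun w => ?_
    have hw : w ∈ ⨆ j : ℚ, (gr x j : Submodule F g) := htop ▸ Submodule.mem_top
    induction hw using Submodule.iSup_induction' with
    | mem k w hw =>
      by_cases hk : j + k = 0
      · obtain rfl : k = -j := by linarith
        exact h w hw
      · exact form_eq_zero_of_mem_gr hinv hy hw hk
    | zero => simp
    | add w₁ w₂ _ _ h₁ h₂ => rw [map_add, h₁, h₂, add_zero]
  have hinj : ∀ j : ℚ, 0 < j → ∀ y ∈ (gr x j : Submodule F g), ⁅f, y⁆ = 0 → y = 0 :=
    fun j hj y hy h => gr_eq_bot_of_lie_f_eq_zero ht hj hy h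
  have hlow : ∀ (j : ℚ) (y : g), y ∈ (gr x j : Submodule F g) → ⁅f, y⁆ ∈ (gr x (j - 1) : Submodule F g) :=
    fun j y hy => lie_mem_gr hfm hy (by ring)
  have heigen : ∀ (j k : ℚ) (y : g), y ∈ (gr x j : Submodule F g) → y ∈ (gr x k : Submodule F g) →
      j ≠ k → y = 0 := by
    intro j k y h₁ h₂ hjk
    rw [mem_gr] at h₁ h₂
    rw [h₁] at h₂
    have : ((j - k : ℚ) : F) • y = 0 := by
      rw [Rat.cast_sub, sub_smul, h₂, sub_self]
    exact (smul_eq_zero.mp this).resolve_left (by exact_mod_cast sub_ne_zero.mpr hjk)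
  have hbig : ∀ j : ℚ, 1 < j → ∀ y ∈ (gr x j : Submodule F g), y = 0 := by
    intro j hj y hy
    obtain ⟨c, hc⟩ := hext y
    refine hinj j (by linarith) y hy (hinj (j - 1) (by linarith) _ (hlow _ _ hy) ?_)
    refine heigen (j - 1 - 1) (-1) _ (hlow _ _ (hlow _ _ hy)) ?_ (by linarith)
    rw [hc]
    exact Submodule.smul_mem _ _ hfm
  have hsmall : ∀ j : ℚ, j < -1 → ∀ y ∈ (gr x j : Submodule F g), y = 0 := by
    intro j hj y hy
    refine hdual j y hy fun w hw => ?_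
    rw [hbig (-j) (by linarith) w hw, map_zero]
  -- If (ad f)² y = 0, then [f, y] is a lowest weight vector of weight 0 and is therefore killed by
  -- e; but [e, [f, y]] = 2y.
  have hsq : ∀ y ∈ (gr x 1 : Submodule F g), ⁅f, ⁅f, y⁆⁆ = 0 → y = 0 := by
    intro y hy h
    by_contra hy0
    have hfy : ⁅f, y⁆ ≠ 0 := fun h' => hy0 (hinj 1 one_pos y hy h')
    have P : ht.symm.HasPrimitiveVectorWith ⁅f, y⁆ (0 : F) :=
      ⟨hfy, by rw [neg_lie, smul_lie, mem_gr.mp (hlow _ _ hy)]; simp, h⟩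
    have h3 := P.pow_toEnd_f_eq_zero_of_eq_nat (n := 0) (by simp)
    have h4 : ⁅e, ⁅f, y⁆⁆ = 0 := by simpa using h3
    rw [leibniz_lie, hef, hbig 2 (by norm_num) ⁅e, y⁆ (lie_mem_gr hem hy (by norm_num)), lie_zero,
      add_zero, smul_lie, mem_gr.mp hy] at h4
    simp [hy0] at h4
  have hffe : ⁅f, ⁅f, e⁆⁆ = (-2 : F) • f := by
    rw [← lie_skew f e, hef, lie_neg, lie_smul, ← lie_skew, hxf, neg_neg, neg_smul]
  have hone : ∀ y ∈ (gr x 1 : Submodule F g), ∃ c : F, y = c • e := by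
    intro y hy
    obtain ⟨c, hc⟩ := hext y
    -- The coefficient is dictated by (ad f)² e = -2f.
    refine ⟨-c / 2, sub_eq_zero.mp (hsq _ (sub_mem hy (Submodule.smul_mem _ _ hem)) ?_)⟩
    rw [lie_sub, lie_sub, lie_smul, lie_smul, hc, hffe, smul_smul, ← sub_smul]
    ring_nf
    simp
  have hBef : B f e ≠ 0 := by
    intro h
    refine ht.f_ne_zero (hdual (-1) f hfm fun w hw => ?_)
    obtain ⟨c, rfl⟩ := hone w (by simpa using hw)
    rw [map_smul, h, smul_zero]
  refine ⟨hBsymm.eq, hinv, hnd, hef, hxe, hxf, ht.f_ne_zero, ?_, hone, ?_, htop⟩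
  · intro j hj
    obtain ⟨y, hy, hy0⟩ := Submodule.exists_mem_ne_zero_of_ne_bot hj
    have h1 : j ≤ 1 := not_lt.mp fun h => hy0 (hbig j h y hy)
    have h2 : -1 ≤ j := not_lt.mp fun h => hy0 (hsmall j h y hy)
    have hup : ∀ (j : ℚ) (y : g), y ∈ (gr x j : Submodule F g) → ⁅e, y⁆ ∈ (gr x (j + 1) : Submodule F g) :=
      fun j y hy => lie_mem_gr hem hy (by ring)
    -- Three applications of e carry y beyond degree 1. The last non-zero vector in this string has
    -- highest weight, so twice its degree is a natural number.
    have : ∃ n : ℤ, 2 * j = n := by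
      by_cases c1 : ⁅e, y⁆ = 0
      · obtain ⟨n, hn⟩ := exists_nat_of_lie_e_eq_zero ht hy c1 hy0
        exact ⟨n, by exact_mod_cast hn⟩
      by_cases c2 : ⁅e, ⁅e, y⁆⁆ = 0
      · obtain ⟨n, hn⟩ := exists_nat_of_lie_e_eq_zero ht (hup _ _ hy) c2 c1
        exact ⟨n - 2, by push_cast; linarith⟩
      have c3 : ⁅e, ⁅e, ⁅e, y⁆⁆⁆ = 0 :=
        hbig _ (by linarith) _ (hup _ _ (hup _ _ (hup _ _ hy)))
      obtain ⟨n, hn⟩ := exists_nat_of_lie_e_eq_zero ht (hup _ _ (hup _ _ hy)) c3 c2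
      exact ⟨n - 4, by push_cast; linarith⟩
    obtain ⟨n, hn⟩ := this
    have n1 : n ≤ 2 := by exact_mod_cast (by linarith : (n : ℚ) ≤ 2)
    have n2 : -2 ≤ n := by exact_mod_cast (by linarith : (-2 : ℚ) ≤ n)
    have hj' : j = n / 2 := by linarith
    interval_cases n <;> norm_num at hj' <;> norm_num [hj']
  · intro y hy
    refine ⟨B y e / B f e, sub_eq_zero.mp (hdual (-1) _ (sub_mem hy (Submodule.smul_mem _ _ hfm)) ?_)⟩
    intro w hw
    obtain ⟨c, rfl⟩ := hone w (by simpa using hw)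
    simp only [map_sub, map_smul, LinearMap.sub_apply, LinearMap.smul_apply, smul_eq_mul]
    field_simp
    ring

end Grading

/-! ### Dual families for a bilinear form -/

section DualFamilies

variable {F : Type*} [Field F] {g : Type*} [LieRing g] [LieAlgebra F g]

/-- `p`, `p'` are dual families for the bilinear form `β` on the subspace `U`. -/
structure IsDualOn (β : g → g → F) (U : Submodule F g) {I : Type*} [Fintype I] (p p' : I → g) :
    Prop where
  mem : ∀ i, p i ∈ U
  mem' : ∀ i, p' i ∈ U
  left : ∀ y ∈ U, ∑ i, β y (p' i) • p i = y
  right : ∀ y ∈ U, ∑ i, β (p i) y • p' i = y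

variable {β : g → g → F} {U : Submodule F g} {I : Type*} [Fintype I] {p p' : I → g}

theorem IsDualOn.sum_left (h : IsDualOn β U p p') {M : Type*} [AddCommMonoid M] [Module F M]
    (l : g →ₗ[F] M) {y : g} (hy : y ∈ U) : ∑ i, β y (p' i) • l (p i) = l y := by
  conv_rhs => rw [← h.left y hy]
  simp [map_sum]

theorem IsDualOn.sum_right (h : IsDualOn β U p p') {M : Type*} [AddCommMonoid M] [Module F M]
    (l : g →ₗ[F] M) {y : g} (hy : y ∈ U) : ∑ i, β (p i) y • l (p' i) = l y := by
  conv_rhs => rw [← h.right y hy]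
  simp [map_sum]

/-- Both sums are expanded in the p k alone, with the Gram matrix of p' as coefficients; transposing
that matrix costs ε. The cases needed are ε = 1 for the invariant form and ε = -1 for the symplectic
form. -/
theorem IsDualOn.sum_swap (h : IsDualOn β U p p') {ε : F}
    (hβ : ∀ y w, β y w = ε * β w y) {M : Type*} [AddCommGroup M] [Module F M]
    (m : g →ₗ[F] g →ₗ[F] M) : ∑ i, m (p' i) (p i) = ε • ∑ i, m (p i) (p' i) := by
  have h1 : ∀ i, m (p' i) (p i) = ∑ k, β (p' i) (p' k) • m (p k) (p i) := fun i => by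
    have := h.sum_left (m.flip (p i)) (h.mem' i)
    simpa only [LinearMap.flip_apply] using this.symm
  have h2 : ∀ k, m (p k) (p' k) = ∑ i, β (p' k) (p' i) • m (p k) (p i) := fun i => by
    rw [← h.sum_left (m (p i)) (h.mem' i)]
  simp_rw [h1, h2]
  rw [Finset.sum_comm, Finset.smul_sum]
  refine Finset.sum_congr rfl fun k _ => ?_
  rw [Finset.smul_sum]
  exact Finset.sum_congr rfl fun i _ => by rw [hβ, mul_smul]

/-- Only b is assumed to be a basis; non-degeneracy on U supplies the expansion in the b' i. -/
theorem isDualOn_of_basis [DecidableEq I] (β : LinearMap.BilinForm F g)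
    (hβ : ∀ w ∈ U, (∀ y ∈ U, β y w = 0) → w = 0) (b : Module.Basis I F U) (b' : I → U)
    (hb : ∀ i j, β (b i : g) (b' j : g) = if i = j then 1 else 0) :
    IsDualOn (fun y w => β y w) U (fun i => (b i : g)) (fun i => (b' i : g)) := by
  have hl : ∀ y ∈ U, ∑ i, β y (b' i) • (b i : g) = y := by
    intro y hy
    have h1 := b.sum_repr ⟨y, hy⟩
    have h2 : ∑ i, b.repr ⟨y, hy⟩ i • (b i : g) = y := by
      have h3 := congrArg U.subtype h1
      rw [map_sum] at h3
      exact h3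
    conv_rhs => rw [← h2]
    refine Finset.sum_congr rfl fun i _ => ?_
    congr 1
    conv_lhs => rw [← h2]
    simp [map_sum, hb, LinearMap.sum_apply]
  refine ⟨fun i => (b i).2, fun i => (b' i).2, hl, fun w hw => ?_⟩
  refine (sub_eq_zero.mp (hβ _ (sub_mem hw (Submodule.sum_mem _ fun i _ =>
    Submodule.smul_mem _ _ (b' i).2)) fun y hy => ?_)).symm
  have h3 : β y w = ∑ i, β y (b' i) * β (b i) w := by
    conv_lhs => rw [← hl y hy]
    simp [map_sum, LinearMap.sum_apply]
  simp [map_sum, h3, mul_comm]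

end DualFamilies

/-! ### Consequences of the five-term grading -/

namespace MinimalGrading

variable {F : Type*} [Field F] {g : Type*} [LieRing g] [LieAlgebra F g] [CharZero F]
  {B : LinearMap.BilinForm F g} {e x f : g} (G : MinimalGrading B e x f)
include G

theorem e_mem : e ∈ (gr x 1 : Submodule F g) := by rw [mem_gr, G.lie_xe]; simp

theorem f_mem : f ∈ (gr x (-1) : Submodule F g) := by rw [mem_gr, G.lie_xf]; simp

omit G in
theorem x_mem : x ∈ (gr x 0 : Submodule F g) := by rw [mem_gr]; simp

theorem lie_fe : ⁅f, e⁆ = -((2 : F) • x) := by rw [← lie_skew, G.lie_ef]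

theorem lie_fx : ⁅f, x⁆ = f := by rw [← lie_skew, G.lie_xf, neg_neg]

theorem eq_zero {j : ℚ} {y : g} (hy : y ∈ (gr x j : Submodule F g))
    (hj : 1 < j ∨ j < -1) : y = 0 := by
  by_contra h0
  have := G.degree j fun hbot => h0 (by simpa [hbot] using hy)
  rcases hj with hj | hj <;> rcases this with rfl | rfl | rfl | rfl | rfl <;> norm_num at hj

theorem form_eq_zero {i j : ℚ} {y w : g} (hy : y ∈ (gr x i : Submodule F g))
    (hw : w ∈ (gr x j : Submodule F g)) (hij : i + j ≠ 0) : B y w = 0 :=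
  form_eq_zero_of_mem_gr G.inv hy hw hij

theorem eq_zero_of_form {j : ℚ} {y : g} (hy : y ∈ (gr x j : Submodule F g))
    (h : ∀ w ∈ (gr x (-j) : Submodule F g), B w y = 0) : y = 0 := by
  refine G.nondeg y fun w => ?_
  have hw : w ∈ ⨆ j : ℚ, (gr x j : Submodule F g) := G.iSup_gr ▸ Submodule.mem_top
  induction hw using Submodule.iSup_induction' with
  | mem k w hw =>
    by_cases hk : j + k = 0
    · obtain rfl : k = -j := by linarith
      rw [G.symm]
      exact h w hw
    · exact G.form_eq_zero hy hw hk
  | zero => simp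
  | add w₁ w₂ _ _ h₁ h₂ => rw [map_add, h₁, h₂, add_zero]

theorem form_ef : B e f = 2 * B x x := by
  have := G.inv x e f
  rwa [G.lie_xe, G.lie_ef, map_smul, smul_eq_mul] at this

theorem form_ef_ne : B e f ≠ 0 := by
  intro h
  refine G.f_ne (G.eq_zero_of_form G.f_mem fun w hw => ?_)
  obtain ⟨c, rfl⟩ := G.one w (by simpa using hw)
  rw [map_smul, LinearMap.smul_apply, h, smul_zero]

/-- Between degrees -1/2 and 1/2, ad e and ad f are mutually inverse: [f, u] would have degree -3/2,
so [f, [e, u]] = -2[x, u] = u. -/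
theorem lie_f_lie_e {u : g} (hu : u ∈ (gr x (-1 / 2) : Submodule F g)) : ⁅f, ⁅e, u⁆⁆ = u := by
  rw [leibniz_lie, G.lie_fe, G.eq_zero (lie_mem_gr G.f_mem hu rfl) (by norm_num), lie_zero,
    add_zero, neg_lie, smul_lie, mem_gr.mp hu, smul_smul]
  norm_num

theorem lie_e_lie_f {w : g} (hw : w ∈ (gr x (1 / 2) : Submodule F g)) : ⁅e, ⁅f, w⁆⁆ = w := by
  rw [leibniz_lie, G.lie_ef, G.eq_zero (lie_mem_gr G.e_mem hw rfl) (by norm_num), lie_zero,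
    add_zero, smul_lie, mem_gr.mp hw, smul_smul]
  norm_num

theorem lie_f_mem {w : g} (hw : w ∈ (gr x (1 / 2) : Submodule F g)) :
    ⁅f, w⁆ ∈ (gr x (-1 / 2) : Submodule F g) := lie_mem_gr G.f_mem hw (by norm_num)

theorem lie_e_mem {u : g} (hu : u ∈ (gr x (-1 / 2) : Submodule F g)) :
    ⁅e, u⁆ ∈ (gr x (1 / 2) : Submodule F g) := lie_mem_gr G.e_mem hu (by norm_num)

theorem eq_smul_e {y : g} (hy : y ∈ (gr x 1 : Submodule F g)) : y = (B f y / B e f) • e := by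
  obtain ⟨c, rfl⟩ := G.one y hy
  have := G.form_ef_ne
  rw [map_smul, smul_eq_mul, G.symm f e, mul_div_cancel_right₀ _ this]

theorem eq_smul_f {y : g} (hy : y ∈ (gr x (-1) : Submodule F g)) : y = (B e y / B e f) • f := by
  obtain ⟨c, rfl⟩ := G.neg_one y hy
  have := G.form_ef_ne
  rw [map_smul, smul_eq_mul, mul_div_cancel_right₀ _ this]

theorem form_x_eq_zero {b : g} (hfb : ⁅f, b⁆ = 0) : B x b = 0 := by
  have := G.inv e f b
  rw [G.lie_ef, hfb, map_zero, map_smul, LinearMap.smul_apply, smul_eq_mul] at this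
  simpa using this

/-- [f, b] lies in F f and [f, x] = f, so a multiple of x corrects b; thus g_0 = F x + g_0^f. -/
theorem exists_sub_smul_x_mem {b : g} (hb : b ∈ (gr x 0 : Submodule F g)) :
    ∃ c : F, b - c • x ∈ (grZeroCentralizer x f : Submodule F g) := by
  obtain ⟨c, hc⟩ := G.neg_one _ (lie_mem_gr G.f_mem hb (by norm_num))
  refine ⟨c, mem_grZeroCentralizer.mpr ⟨?_, ?_⟩⟩
  · simp [mem_gr.mp hb]
  · rw [lie_sub, hc, lie_smul, G.lie_fx, sub_self]

/-- The symplectic form `ω(v, w) = (f|[v, w])` on `g_{1/2}`. -/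
def symplectic {F : Type*} [Field F] {g : Type*} [LieRing g] [LieAlgebra F g]
    (B : LinearMap.BilinForm F g) (f : g) : LinearMap.BilinForm F g :=
  LinearMap.mk₂ F (fun v w => B f ⁅v, w⁆) (by simp) (by simp) (by simp) (by simp)

omit G in
theorem symplectic_apply (v w : g) : symplectic B f v w = B f ⁅v, w⁆ := rfl

/-- By invariance ω(y, w) is, up to sign, (y|[f, w]). Hence [f, w] is orthogonal to g_{1/2} and
vanishes, and ad e recovers w from it. -/
theorem symplectic_eq_zero {w : g} (hw : w ∈ (gr x (1 / 2) : Submodule F g))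
    (h : ∀ y ∈ (gr x (1 / 2) : Submodule F g), symplectic B f y w = 0) : w = 0 := by
  have h1 : ⁅f, w⁆ = 0 := by
    refine G.eq_zero_of_form (G.lie_f_mem hw) fun y hy => ?_
    have := h y (by convert hy using 2; norm_num)
    rw [symplectic_apply, ← lie_skew, map_neg, ← G.inv, neg_eq_zero, G.symm] at this
    exact this
  rw [← G.lie_e_lie_f hw, h1, lie_zero]

omit G in
theorem symplectic_skew (y w : g) : symplectic B f y w = (-1) * symplectic B f w y := by
  rw [symplectic_apply, symplectic_apply, ← lie_skew, map_neg, neg_one_mul]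

variable {J₀ J : Type*} [Fintype J₀] [Fintype J]

/-- The first entries of the Casimir element of `g` built from dual bases of `g_0` and `g_{1/2}`. -/
def casimirLeft (e f : g) (a : J₀ → g) (v v' : J → g) : J₀ ⊕ (J ⊕ J) ⊕ (Unit ⊕ Unit) → g :=
  Sum.elim a (Sum.elim (Sum.elim (fun k => ⁅f, v k⁆) v') (Sum.elim (fun _ => e) (fun _ => f)))

/-- The second entries of the Casimir element of `g`. -/
def casimirRight (B : LinearMap.BilinForm F g) (e f : g) (a' : J₀ → g) (v v' : J → g) :
    J₀ ⊕ (J ⊕ J) ⊕ (Unit ⊕ Unit) → g :=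
  Sum.elim a' (Sum.elim (Sum.elim v' (fun k => ⁅f, v k⁆))
    (Sum.elim (fun _ => (B e f)⁻¹ • f) (fun _ => (B e f)⁻¹ • e)))

/-- The pieces pair by opposite degree: ([f, v_h]|v^k) = (f|[v_h, v^k]), so the families [f, v_k]
and v^k are dual across degrees ∓1/2, and e, f are dual after division by (e|f). -/
theorem isDualOn_top {a a' : J₀ → g} {v v' : J → g}
    (ha : IsDualOn (fun y w => B y w) (gr x 0) a a')
    (hv : IsDualOn (fun y w => symplectic B f y w) (gr x (1 / 2)) v v') :
    IsDualOn (fun y w => B y w) ⊤ (casimirLeft e f a v v') (casimirRight B e f a' v v') := by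
  have hl : ∀ y, ∑ i, B y (casimirRight B e f a' v v' i) • casimirLeft e f a v v' i = y := by
    intro y
    have hy : y ∈ ⨆ j : ℚ, (gr x j : Submodule F g) := G.iSup_gr ▸ Submodule.mem_top
    induction hy using Submodule.iSup_induction' with
    | zero => simp
    | add w₁ w₂ _ _ h₁ h₂ =>
      simp only [map_add, LinearMap.add_apply, add_smul, Finset.sum_add_distrib]
      rw [h₁, h₂]
    | mem j y hy =>
      by_cases h0 : y = 0
      · simp [h0]
      have hj := G.degree j fun hbot => h0 (by simpa [hbot] using hy)
      have z0 : j ≠ 0 → ∀ i, B y (a' i) = 0 := fun h i =>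
        G.form_eq_zero hy (ha.mem' i) (by simpa using h)
      have z1 : j ≠ -1 / 2 → ∀ i, B y (v' i) = 0 := fun h i =>
        G.form_eq_zero hy (hv.mem' i) (fun h' => h (by linarith))
      have z2 : j ≠ 1 / 2 → ∀ i, B y ⁅f, v i⁆ = 0 := fun h i =>
        G.form_eq_zero hy (G.lie_f_mem (hv.mem i)) (fun h' => h (by linarith))
      have z3 : j ≠ 1 → B y f = 0 := fun h =>
        G.form_eq_zero hy G.f_mem (fun h' => h (by linarith))
      have z4 : j ≠ -1 → B y e = 0 := fun h =>
        G.form_eq_zero hy G.e_mem (fun h' => h (by linarith))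
      simp only [casimirLeft, casimirRight, Fintype.sum_sum_type, Sum.elim_inl, Sum.elim_inr,
        Finset.univ_unique, Finset.sum_singleton, map_smul, smul_eq_mul]
      rcases hj with rfl | rfl | rfl | rfl | rfl
      · rw [z3 (by norm_num)]
        simp only [z0 (by norm_num), z1 (by norm_num), z2 (by norm_num), zero_smul, mul_zero,
          Finset.sum_const_zero, zero_add]
        conv_rhs => rw [G.eq_smul_f hy]
        rw [G.symm y e, div_eq_inv_mul]
      · rw [z3 (by norm_num), z4 (by norm_num)]
        simp only [z0 (by norm_num), z2 (by norm_num), zero_smul, mul_zero,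
          Finset.sum_const_zero, zero_add, add_zero]
        conv_rhs => rw [← G.lie_f_lie_e hy, ← hv.left _ (G.lie_e_mem hy), lie_sum]
        refine Finset.sum_congr rfl fun k _ => ?_
        rw [lie_smul, symplectic_apply, ← G.inv, G.lie_f_lie_e hy]
      · rw [z3 (by norm_num), z4 (by norm_num)]
        simp only [z1 (by norm_num), z2 (by norm_num), zero_smul, mul_zero,
          Finset.sum_const_zero, add_zero]
        exact ha.left y hy
      · rw [z3 (by norm_num), z4 (by norm_num)]
        simp only [z0 (by norm_num), z1 (by norm_num), zero_smul, mul_zero,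
          Finset.sum_const_zero, zero_add, add_zero]
        conv_rhs => rw [← hv.right _ hy]
        refine Finset.sum_congr rfl fun k _ => ?_
        rw [symplectic_apply, G.symm y, G.inv]
      · rw [z4 (by norm_num)]
        simp only [z0 (by norm_num), z1 (by norm_num), z2 (by norm_num), zero_smul, mul_zero,
          Finset.sum_const_zero, zero_add, add_zero]
        conv_rhs => rw [G.eq_smul_e hy]
        rw [G.symm y f, div_eq_inv_mul]
  refine ⟨fun _ => Submodule.mem_top, fun _ => Submodule.mem_top, fun y _ => hl y, fun w _ => ?_⟩
  refine sub_eq_zero.mp (G.nondeg _ fun y => ?_)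
  have h3 : B w y = ∑ i, B y (casimirRight B e f a' v v' i) * B (casimirLeft e f a v v' i) w := by
    rw [G.symm w y]
    conv_lhs => rw [← hl y]
    simp [map_sum, LinearMap.sum_apply]
  simp only [map_sub, map_sum, LinearMap.sub_apply, LinearMap.sum_apply, map_smul,
    LinearMap.smul_apply, smul_eq_mul, h3]
  rw [sub_eq_zero]
  refine Finset.sum_congr rfl fun i _ => ?_
  rw [G.symm y, mul_comm]

end MinimalGrading

/-! ### The operator `∂ + λ` and the Master Formula -/

section Operators

variable {F : Type*} [Field F] {ι : Type*}

theorem coeff_lamDel_zero (P : (DiffPoly F ι)[X]) : (lamDel P).coeff 0 = del (P.coeff 0) := by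
  induction P using Polynomial.induction_on' with
  | add p q hp hq => simp only [map_add, coeff_add, hp, hq]
  | monomial n c =>
    simp only [lamDel, LinearMap.add_apply, Polynomial.lsum_apply, coeff_add]
    rw [Polynomial.sum_monomial_index _ _ (by simp)]
    simp [Polynomial.coeff_monomial, apply_ite (del (F := F) (ι := ι))]

theorem coeff_lamDel_succ (P : (DiffPoly F ι)[X]) (n : ℕ) :
    (lamDel P).coeff (n + 1) = del (P.coeff (n + 1)) + P.coeff n := by
  induction P using Polynomial.induction_on' with
  | add p q hp hq => simp only [map_add, coeff_add, hp, hq]; abel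
  | monomial m c =>
    simp only [lamDel, LinearMap.add_apply, Polynomial.lsum_apply, coeff_add]
    rw [Polynomial.sum_monomial_index _ _ (by simp)]
    simp [Polynomial.coeff_monomial, apply_ite (del (F := F) (ι := ι))]

theorem lamDel_C_mul (c : DiffPoly F ι) (P : (DiffPoly F ι)[X]) :
    lamDel (C c * P) = C (del c) * P + C c * lamDel P := by
  ext1 n
  rcases n with _ | n
  · simp only [coeff_lamDel_zero, coeff_C_mul, coeff_add, Derivation.leibniz, smul_eq_mul]
    ring
  · simp only [coeff_lamDel_succ, coeff_C_mul, coeff_add, Derivation.leibniz, smul_eq_mul]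
    ring

theorem lamDel_C (c : DiffPoly F ι) : lamDel (C c) = C (del c) + X * C c := by
  ext1 n
  rcases n with _ | _ | n <;>
    simp [coeff_lamDel_zero, coeff_lamDel_succ, coeff_C]

theorem lamDel_X_mul (P : (DiffPoly F ι)[X]) : lamDel (X * P) = X * lamDel P := by
  ext1 n
  rcases n with _ | _ | n <;>
    simp [coeff_lamDel_zero, coeff_lamDel_succ, coeff_X_mul]

theorem lamDel_scalar_mul (c : F) (P : (DiffPoly F ι)[X]) :
    lamDel (C (MvPolynomial.C c) * P) = C (MvPolynomial.C c) * lamDel P := by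
  rw [lamDel_C_mul, MvPolynomial.derivation_C, C_0, zero_mul, zero_add]

theorem smul_eq_C_C_mul (c : F) (P : (DiffPoly F ι)[X]) :
    c • P = C (MvPolynomial.C c) * P := by
  rw [← algebraMap_smul (DiffPoly F ι) c, smul_eq_C_mul, MvPolynomial.algebraMap_eq]

theorem lamDel_pow_scalar (c : F) (n : ℕ) :
    (lamDel ^ n) (C (MvPolynomial.C c) : (DiffPoly F ι)[X]) = C (MvPolynomial.C c) * X ^ n := by
  induction n with
  | zero => simp
  | succ n ih =>
    rw [pow_succ', Module.End.mul_apply, ih, lamDel_scalar_mul, pow_succ']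
    congr 1
    clear ih
    induction n with
    | zero =>
      have := lamDel_C (1 : DiffPoly F ι)
      simpa using this
    | succ n ih => rw [pow_succ', lamDel_X_mul, ih]

theorem lamDel_pow_one (n : ℕ) : (lamDel ^ n) (1 : (DiffPoly F ι)[X]) = X ^ n := by
  simpa using lamDel_pow_scalar (ι := ι) (1 : F) n

/-- `P ↦ P(∂ + λ) p` as a linear map over the differential polynomials. -/
def applyOpLin (p : (DiffPoly F ι)[X]) : (DiffPoly F ι)[X] →ₗ[DiffPoly F ι] (DiffPoly F ι)[X] :=
  Polynomial.lsum fun k => LinearMap.toSpanSingleton _ _ ((lamDel ^ k) p)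

theorem applyOp_eq (P p : (DiffPoly F ι)[X]) : applyOp P p = applyOpLin p P := by
  simp only [applyOp, applyOpLin, Polynomial.lsum_apply, LinearMap.toSpanSingleton_apply,
    smul_eq_C_mul]

theorem applyOpLin_monomial (p : (DiffPoly F ι)[X]) (n : ℕ) (c : DiffPoly F ι) :
    applyOpLin p (monomial n c) = C c * (lamDel ^ n) p := by
  rw [← applyOp_eq, applyOp, Polynomial.sum_monomial_index _ _ (by simp)]

theorem applyOpLin_C (p : (DiffPoly F ι)[X]) (c : DiffPoly F ι) :
    applyOpLin p (C c) = C c * p := by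
  rw [← monomial_zero_left, applyOpLin_monomial]
  rfl

theorem applyOpLin_C_mul_X (p : (DiffPoly F ι)[X]) (c : DiffPoly F ι) :
    applyOpLin p (C c * X) = C c * lamDel p := by
  rw [C_mul_X_eq_monomial, applyOpLin_monomial, pow_one]

theorem applyOpLin_C_mul (p P : (DiffPoly F ι)[X]) (c : DiffPoly F ι) :
    applyOpLin p (C c * P) = C c * applyOpLin p P := by
  rw [← smul_eq_C_mul, map_smul, smul_eq_C_mul]

/-- By the Leibniz rule, composing the operator with symbol P with ∂ + λ on the left gives the
operator with symbol (∂ + λ)P. -/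
theorem applyOpLin_lamDel (p P : (DiffPoly F ι)[X]) :
    applyOpLin p (lamDel P) = lamDel (applyOpLin p P) := by
  induction P using Polynomial.induction_on' with
  | add P Q hp hq => simp only [map_add, hp, hq]
  | monomial n c =>
    have : lamDel (monomial n c) = monomial n (del c) + monomial (n + 1) c := by
      ext1 m
      rcases m with _ | m
      · simp [coeff_lamDel_zero, coeff_monomial, apply_ite (del (F := F) (ι := ι))]
      · simp [coeff_lamDel_succ, coeff_monomial, apply_ite (del (F := F) (ι := ι))]
    rw [this, map_add, applyOpLin_monomial, applyOpLin_monomial, applyOpLin_monomial,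
      lamDel_C_mul, pow_succ', Module.End.mul_apply]

theorem applyOpLin_lamDel_pow (p P : (DiffPoly F ι)[X]) (n : ℕ) :
    applyOpLin p ((lamDel ^ n) P) = (lamDel ^ n) (applyOpLin p P) := by
  induction n with
  | zero => rfl
  | succ n ih =>
    rw [pow_succ', Module.End.mul_apply, Module.End.mul_apply, applyOpLin_lamDel, ih]

theorem applyOpLin_one (P : (DiffPoly F ι)[X]) : applyOpLin 1 P = P := by
  induction P using Polynomial.induction_on' with
  | add P Q hp hq => rw [map_add, hp, hq]
  | monomial n c => rw [applyOpLin_monomial, lamDel_pow_one, C_mul_X_pow_eq_monomial]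

/-- Multiplication by λ commutes with ∂ + λ, and P(∂ + λ)1 = P. -/
theorem applyOpLin_X (P : (DiffPoly F ι)[X]) : applyOpLin X P = X * P := by
  have hX : lamDel (1 : (DiffPoly F ι)[X]) = X := by simpa using lamDel_pow_one (F := F) (ι := ι) 1
  induction P using Polynomial.induction_on' with
  | add P Q hp hq => rw [map_add, hp, hq, mul_add]
  | monomial n c =>
    rw [applyOpLin_monomial, ← hX, ← Module.End.mul_apply, ← pow_succ, lamDel_pow_one, hX,
      ← C_mul_X_pow_eq_monomial]
    ring

/-- `P(∂ + λ) p` as a bilinear map. -/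
def applyOpBilin : (DiffPoly F ι)[X] →ₗ[F] (DiffPoly F ι)[X] →ₗ[F] (DiffPoly F ι)[X] :=
  LinearMap.mk₂ F (fun p P => applyOpLin p P)
    (fun p p' P => by
      simp only [← applyOp_eq, applyOp, map_add, mul_add, Polynomial.sum_add])
    (fun c p P => by
      simp only [← applyOp_eq, applyOp, map_smul, Polynomial.sum, mul_smul_comm,
        Finset.smul_sum])
    (fun p P P' => map_add _ _ _)
    (fun c p P => by rw [← algebraMap_smul (DiffPoly F ι) c P, map_smul, algebraMap_smul])

theorem applyOpBilin_apply (p P : (DiffPoly F ι)[X]) : applyOpBilin p P = applyOpLin p P := rfl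

theorem map_lamDel (σ : DiffPoly F ι →ₐ[F] DiffPoly F ι) (hσ : ∀ p, σ (del p) = del (σ p))
    (P : (DiffPoly F ι)[X]) : (lamDel P).map σ.toRingHom = lamDel (P.map σ.toRingHom) := by
  ext1 n
  rcases n with _ | n
  · simp [coeff_lamDel_zero, coeff_map, hσ]
  · simp [coeff_lamDel_succ, coeff_map, hσ]

theorem map_lamDel_pow (σ : DiffPoly F ι →ₐ[F] DiffPoly F ι) (hσ : ∀ p, σ (del p) = del (σ p))
    (P : (DiffPoly F ι)[X]) (n : ℕ) :
    ((lamDel ^ n) P).map σ.toRingHom = (lamDel ^ n) (P.map σ.toRingHom) := by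
  induction n with
  | zero => rfl
  | succ n ih => rw [pow_succ', Module.End.mul_apply, Module.End.mul_apply, map_lamDel σ hσ, ih]

theorem map_neg_lamDel_pow (σ : DiffPoly F ι →ₐ[F] DiffPoly F ι)
    (hσ : ∀ p, σ (del p) = del (σ p)) (P : (DiffPoly F ι)[X]) (n : ℕ) :
    (((-lamDel) ^ n) P).map σ.toRingHom = ((-lamDel) ^ n) (P.map σ.toRingHom) := by
  induction n with
  | zero => rfl
  | succ n ih =>
    rw [pow_succ', Module.End.mul_apply, Module.End.mul_apply, LinearMap.neg_apply,
      LinearMap.neg_apply, Polynomial.map_neg, map_lamDel σ hσ, ih]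

theorem map_applyOpLin (σ : DiffPoly F ι →ₐ[F] DiffPoly F ι) (hσ : ∀ p, σ (del p) = del (σ p))
    (p P : (DiffPoly F ι)[X]) :
    (applyOpLin p P).map σ.toRingHom = applyOpLin (p.map σ.toRingHom) (P.map σ.toRingHom) := by
  induction P using Polynomial.induction_on' with
  | add P Q hp hq => rw [map_add, Polynomial.map_add, Polynomial.map_add, map_add, hp, hq]
  | monomial n c =>
    rw [applyOpLin_monomial, Polynomial.map_mul, map_lamDel_pow σ hσ, Polynomial.map_monomial,
      applyOpLin_monomial, Polynomial.map_C]

theorem derivation_eq_sum_of_vars_subset {M : Type*} [AddCommGroup M] [Module F M] {σ : Type*}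
    [Module (MvPolynomial σ F) M] [IsScalarTower F (MvPolynomial σ F) M]
    (D : Derivation F (MvPolynomial σ F) M) {h : MvPolynomial σ F} {S : Finset σ}
    (hS : h.vars ⊆ S) : D h = ∑ v ∈ S, MvPolynomial.pderiv v h • D (MvPolynomial.X v) := by
  classical
  let D' : Derivation F (MvPolynomial σ F) M :=
    ∑ v ∈ S, (LinearMap.toSpanSingleton _ M (D (MvPolynomial.X v))).compDer (MvPolynomial.pderiv v)
  have hD' : ∀ p, D' p = ∑ v ∈ S, MvPolynomial.pderiv v p • D (MvPolynomial.X v) := by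
    intro p
    have h1 := congrFun (map_sum (Derivation.coeFnAddMonoidHom (R := F)
      (A := MvPolynomial σ F) (M := M)) (fun v => (LinearMap.toSpanSingleton _ M
      (D (MvPolynomial.X v))).compDer (MvPolynomial.pderiv v)) S) p
    rw [Finset.sum_apply] at h1
    exact h1
  rw [← hD']
  refine MvPolynomial.derivation_eq_of_forall_mem_vars fun i hi => ?_
  rw [hD']
  simp [MvPolynomial.pderiv_X, Pi.single_apply, hS hi]

theorem del_X (i : ι) (n : ℕ) :
    del (MvPolynomial.X (i, n) : DiffPoly F ι) = MvPolynomial.X (i, n + 1) := by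
  rw [del, MvPolynomial.mkDerivation_X]

theorem iterate_del_X (i : ι) (m n : ℕ) :
    (del^[n]) (MvPolynomial.X (i, m) : DiffPoly F ι) = MvPolynomial.X (i, m + n) := by
  induction n with
  | zero => rfl
  | succ n ih => rw [Function.iterate_succ_apply', ih, del_X, add_assoc]

/-- Both sides, as functions of P, obey the same product rule, so the generators decide. -/
theorem derivation_del (D : Derivation F (DiffPoly F ι) (DiffPoly F ι)[X]) {s : Set ι}
    (hD : ∀ i ∈ s, ∀ n, D (MvPolynomial.X (i, n + 1)) = lamDel (D (MvPolynomial.X (i, n))))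
    {P : DiffPoly F ι} (hP : P ∈ MvPolynomial.supported F {p : ι × ℕ | p.1 ∈ s}) :
    D (del P) = lamDel (D P) := by
  induction hP using Algebra.adjoin_induction with
  | mem P hP =>
    obtain ⟨⟨i, n⟩, hi, rfl⟩ := hP
    rw [del_X, hD i hi]
  | algebraMap c => simp
  | add P Q _ _ hp hq => simp only [map_add, hp, hq]
  | mul P Q _ _ hp hq =>
    simp only [Derivation.leibniz, smul_eq_mul, map_add, hp, hq, smul_eq_C_mul, lamDel_C_mul]
    ring

end Operators

/-! ### The affine lambda-bracket reduced by `ρ` -/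

section Reduced

variable {F : Type*} [Field F] {g : Type*} [LieRing g] [LieAlgebra F g] {ι : Type*}
  (B : LinearMap.BilinForm F g) (q : Module.Basis ι F g) (deg : ι → ℚ) (f s : g) (z : F)

theorem incl_basis (i : ι) : incl q (q i) = MvPolynomial.X (i, 0) := by
  rw [incl, Module.Basis.constr_basis]

theorem rho_X (i : ι) (n : ℕ) : rho B q deg f (MvPolynomial.X (i, n)) =
    (del^[n]) ((if deg i ≤ 1 / 2 then MvPolynomial.X (i, 0) else 0)
      + MvPolynomial.C (B f (q i))) := by
  rw [rho, MvPolynomial.aeval_X]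

theorem rho_del (P : DiffPoly F ι) : rho B q deg f (del P) = del (rho B q deg f P) := by
  induction P using MvPolynomial.induction_on with
  | C c => simp [del, MvPolynomial.algHom_C]
  | add P Q hp hq => simp only [map_add, hp, hq]
  | mul_X P p hp =>
    obtain ⟨i, n⟩ := p
    have : rho B q deg f (MvPolynomial.X (i, n + 1)) =
        del (rho B q deg f (MvPolynomial.X (i, n))) := by
      rw [rho_X, rho_X, Function.iterate_succ_apply']
    simp only [Derivation.leibniz, map_add, smul_eq_mul, map_mul, hp, del_X, this]

/-- `ρ` restricted to `g`, as a linear map `g → V(g_{≤1/2})`. -/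
def rhoIncl : g →ₗ[F] DiffPoly F ι := (rho B q deg f).toLinearMap ∘ₗ incl q

theorem rhoIncl_apply (y : g) : rhoIncl B q deg f y = rho B q deg f (incl q y) := rfl

/-- The derivation `P ↦ ρ{y_λ P}_z` of `V(g_{≤1/2})` with values in polynomials in `λ`. -/
def adDer (y : g) : Derivation F (DiffPoly F ι) (DiffPoly F ι)[X] :=
  MvPolynomial.mkDerivation F fun p =>
    (lamDel ^ p.2) (C (rhoIncl B q deg f ⁅y, q p.1⁆ + MvPolynomial.C (z * B s ⁅y, q p.1⁆))
      + C (MvPolynomial.C (B y (q p.1))) * X)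

theorem adDer_X (y : g) (i : ι) (n : ℕ) : adDer B q deg f s z y (MvPolynomial.X (i, n)) =
    (lamDel ^ n) (C (rhoIncl B q deg f ⁅y, q i⁆ + MvPolynomial.C (z * B s ⁅y, q i⁆))
      + C (MvPolynomial.C (B y (q i))) * X) := by
  rw [adDer, MvPolynomial.mkDerivation_X]

theorem adDer_del (y : g) (P : DiffPoly F ι) :
    adDer B q deg f s z y (del P) = lamDel (adDer B q deg f s z y P) :=
  derivation_del _ (s := Set.univ)
    (fun i _ n => by rw [adDer_X, adDer_X, pow_succ', Module.End.mul_apply])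
    (by simp)

theorem adDer_incl (y w : g) : adDer B q deg f s z y (incl q w) =
    C (rhoIncl B q deg f ⁅y, w⁆ + MvPolynomial.C (z * B s ⁅y, w⁆))
      + C (MvPolynomial.C (B y w)) * X := by
  let l : g →ₗ[F] (DiffPoly F ι)[X] :=
    { toFun := fun w => C (rhoIncl B q deg f ⁅y, w⁆ + MvPolynomial.C (z * B s ⁅y, w⁆))
        + C (MvPolynomial.C (B y w)) * X
      map_add' := fun w w' => by simp only [lie_add, map_add, mul_add]; ring
      map_smul' := fun c w => by
        simp only [lie_smul, map_smul, smul_eq_mul, RingHom.id_apply,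
          MvPolynomial.smul_eq_C_mul, map_mul, map_add, smul_eq_C_C_mul]
        ring }
  have : (adDer B q deg f s z y).toLinearMap ∘ₗ incl q = l :=
    q.ext fun i => by
      simp only [LinearMap.comp_apply, incl_basis]
      exact adDer_X B q deg f s z y i 0
  exact LinearMap.congr_fun this w

/-- `adDer` as a linear map. -/
def adDerLin : g →ₗ[F] Derivation F (DiffPoly F ι) (DiffPoly F ι)[X] where
  toFun := adDer B q deg f s z
  map_add' y y' := MvPolynomial.derivation_ext fun p => by
    obtain ⟨i, n⟩ := p
    rw [Derivation.add_apply, adDer_X, adDer_X, adDer_X, ← map_add]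
    congr 1
    simp only [add_lie, map_add, LinearMap.add_apply, mul_add, add_mul]
    ring
  map_smul' c y := MvPolynomial.derivation_ext fun p => by
    obtain ⟨i, n⟩ := p
    rw [Derivation.smul_apply, adDer_X, adDer_X, RingHom.id_apply, ← map_smul]
    congr 1
    simp only [smul_lie, map_smul, LinearMap.smul_apply, smul_eq_mul,
      MvPolynomial.smul_eq_C_mul, map_mul, map_add, smul_eq_C_C_mul]
    ring

theorem adDerLin_apply (y : g) : adDerLin B q deg f s z y = adDer B q deg f s z y := rfl

/-- Evaluation of derivations. -/
def evalDer (h : DiffPoly F ι) :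
    Derivation F (DiffPoly F ι) (DiffPoly F ι)[X] →ₗ[F] (DiffPoly F ι)[X] where
  toFun D := D h
  map_add' _ _ := rfl
  map_smul' _ _ := rfl

/-- For `ε y = ρ{y_λ h}_z` this is `ρ{p_λ h}_z`, as given by the Master Formula. -/
def leftOp (ε : g →ₗ[F] (DiffPoly F ι)[X]) (p : DiffPoly F ι) : (DiffPoly F ι)[X] :=
  ∑ w ∈ p.vars, applyOpLin (((-lamDel) ^ w.2) (C (rho B q deg f (MvPolynomial.pderiv w p))))
    (ε (q w.1))

/-- A common index set for several polynomials is what makes additivity in p accessible. -/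
theorem leftOp_eq_sum (ε : g →ₗ[F] (DiffPoly F ι)[X]) {p : DiffPoly F ι} {S : Finset (ι × ℕ)}
    (hS : p.vars ⊆ S) : leftOp B q deg f ε p =
      ∑ w ∈ S, applyOpBilin (((-lamDel) ^ w.2) (C (rho B q deg f (MvPolynomial.pderiv w p))))
        (ε (q w.1)) := by
  refine Finset.sum_subset hS fun w _ hw => ?_
  rw [← applyOpBilin_apply, MvPolynomial.pderiv_eq_zero_of_notMem_vars hw]
  simp

/-- `leftOp` as a linear map. -/
def leftOpLin (ε : g →ₗ[F] (DiffPoly F ι)[X]) : DiffPoly F ι →ₗ[F] (DiffPoly F ι)[X] where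
  toFun := leftOp B q deg f ε
  map_add' p p' := by
    classical
    rw [leftOp_eq_sum B q deg f ε (MvPolynomial.vars_add_subset p p'),
      leftOp_eq_sum B q deg f ε (Finset.subset_union_left (s₂ := p'.vars)),
      leftOp_eq_sum B q deg f ε (Finset.subset_union_right (s₁ := p.vars)),
      ← Finset.sum_add_distrib]
    simp only [map_add, LinearMap.add_apply]
  map_smul' c p := by
    have hS : (c • p).vars ⊆ p.vars := by
      intro v hv
      by_contra h
      rw [MvPolynomial.mem_vars_iff_mem_support] at hv h
      obtain ⟨d, hd, hvd⟩ := hv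
      exact h ⟨d, MvPolynomial.support_smul hd, hvd⟩
    rw [leftOp_eq_sum B q deg f ε hS, leftOp_eq_sum B q deg f ε subset_rfl, RingHom.id_apply,
      Finset.smul_sum]
    refine Finset.sum_congr rfl fun w _ => ?_
    have : (C (c • rho B q deg f (MvPolynomial.pderiv w p)) : (DiffPoly F ι)[X]) =
        c • C (rho B q deg f (MvPolynomial.pderiv w p)) := (smul_C _ _).symm
    rw [Derivation.map_smul, map_smul (rho B q deg f), this, map_smul, map_smul,
      LinearMap.smul_apply]

theorem leftOpLin_apply (ε : g →ₗ[F] (DiffPoly F ι)[X]) (p : DiffPoly F ι) :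
    leftOpLin B q deg f ε p = leftOp B q deg f ε p := rfl

theorem leftOpLin_X (ε : g →ₗ[F] (DiffPoly F ι)[X]) (i : ι) (n : ℕ) :
    leftOpLin B q deg f ε (MvPolynomial.X (i, n)) =
      applyOpLin (((-lamDel) ^ n) 1) (ε (q i)) := by
  classical
  rw [leftOpLin_apply, leftOp, MvPolynomial.vars_X, Finset.sum_singleton]
  simp

theorem leftOpLin_X_mul_X (ε : g →ₗ[F] (DiffPoly F ι)[X]) (i j : ι) (n m : ℕ) :
    leftOpLin B q deg f ε (MvPolynomial.X (i, n) * MvPolynomial.X (j, m)) =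
      applyOpLin (((-lamDel) ^ n) (C (rho B q deg f (MvPolynomial.X (j, m))))) (ε (q i))
      + applyOpLin (((-lamDel) ^ m) (C (rho B q deg f (MvPolynomial.X (i, n))))) (ε (q j)) := by
  classical
  have hS : (MvPolynomial.X (i, n) * MvPolynomial.X (j, m) : DiffPoly F ι).vars ⊆
      {(i, n), (j, m)} := by
    refine (MvPolynomial.vars_mul _ _).trans ?_
    rw [MvPolynomial.vars_X, MvPolynomial.vars_X]
    rfl
  rw [leftOpLin_apply, leftOp_eq_sum B q deg f ε hS]
  simp only [MvPolynomial.pderiv_mul, MvPolynomial.pderiv_X, map_add,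
    LinearMap.add_apply, Finset.sum_add_distrib, Pi.single_apply, apply_ite (rho B q deg f),
    map_zero, apply_ite (C (R := DiffPoly F ι)), ite_mul, mul_ite, one_mul, mul_one,
    zero_mul, mul_zero]
  have key : ∀ (v : ι × ℕ) (S : Finset (ι × ℕ)) (P : (DiffPoly F ι)[X]), v ∈ S →
      ∑ w ∈ S, applyOpBilin (((-lamDel) ^ w.2) (if w = v then P else 0)) (ε (q w.1)) =
        applyOpLin (((-lamDel) ^ v.2) P) (ε (q v.1)) := by
    intro v S P hv
    rw [Finset.sum_eq_single v]
    · simp [applyOpBilin_apply]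
    · intro w _ hw
      simp [hw]
    · exact fun h => absurd hv h
  simp only [eq_comm (a := (i, n)), eq_comm (a := (j, m))]
  rw [key (i, n) _ _ (by simp), key (j, m) _ _ (by simp)]

theorem leftOpLin_incl (ε : g →ₗ[F] (DiffPoly F ι)[X]) (y : g) :
    leftOpLin B q deg f ε (incl q y) = ε y := by
  have : leftOpLin B q deg f ε ∘ₗ incl q = ε := q.ext fun i => by
    rw [LinearMap.comp_apply, incl_basis, leftOpLin_X, pow_zero, Module.End.one_apply,
      applyOpLin_one]
  exact LinearMap.congr_fun this y

theorem leftOpLin_del_incl (ε : g →ₗ[F] (DiffPoly F ι)[X]) (y : g) :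
    leftOpLin B q deg f ε (del (incl q y)) = -(X * ε y) := by
  have : leftOpLin B q deg f ε ∘ₗ del.toLinearMap ∘ₗ incl q =
      -(LinearMap.mulLeft F (X : (DiffPoly F ι)[X]) ∘ₗ ε) := q.ext fun i => by
    have hX : lamDel (1 : (DiffPoly F ι)[X]) = X := by
      simpa using lamDel_pow_one (F := F) (ι := ι) 1
    simp only [LinearMap.comp_apply, incl_basis, LinearMap.neg_apply, LinearMap.mulLeft_apply,
      Derivation.coeFn_coe]
    rw [del_X, leftOpLin_X, zero_add, pow_one, LinearMap.neg_apply, hX, ← applyOpBilin_apply,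
      map_neg, LinearMap.neg_apply, applyOpBilin_apply, applyOpLin_X]
  exact LinearMap.congr_fun this y

/-- Coefficient embedding as a linear map. -/
def constLin : DiffPoly F ι →ₗ[F] (DiffPoly F ι)[X] := (CAlgHom (R := F)).toLinearMap

theorem constLin_apply (p : DiffPoly F ι) : constLin p = C p := rfl

theorem leftOpLin_incl_mul_incl (ε : g →ₗ[F] (DiffPoly F ι)[X]) (y w : g) :
    leftOpLin B q deg f ε (incl q y * incl q w) =
      applyOpLin (C (rhoIncl B q deg f w)) (ε y) + applyOpLin (C (rhoIncl B q deg f y)) (ε w) := by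
  have h1 : ∀ i, leftOpLin B q deg f ε ∘ₗ LinearMap.mulLeft F (MvPolynomial.X (i, 0)) ∘ₗ incl q =
      applyOpBilin.flip (ε (q i)) ∘ₗ constLin ∘ₗ rhoIncl B q deg f
        + applyOpBilin (C (rhoIncl B q deg f (q i))) ∘ₗ ε := fun i => q.ext fun j => by
    simp only [LinearMap.comp_apply, incl_basis, LinearMap.mulLeft_apply, leftOpLin_X_mul_X,
      pow_zero, Module.End.one_apply, LinearMap.add_apply, LinearMap.flip_apply, constLin_apply,
      applyOpBilin_apply, rhoIncl_apply]
  have h2 : leftOpLin B q deg f ε ∘ₗ LinearMap.mulRight F (incl q w) ∘ₗ incl q =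
      applyOpBilin (C (rhoIncl B q deg f w)) ∘ₗ ε
        + applyOpBilin.flip (ε w) ∘ₗ constLin ∘ₗ rhoIncl B q deg f := q.ext fun i => by
    simpa [incl_basis, constLin_apply] using LinearMap.congr_fun (h1 i) w
  exact LinearMap.congr_fun h2 y

/-- Bilinearity reduces to basis vectors, one slot at a time. The minus sign is that of the factor
-λ-∂ which the Master Formula attaches to a derivative in the first argument. -/
theorem leftOpLin_incl_mul_del_incl (ε : g →ₗ[F] (DiffPoly F ι)[X]) (y w : g) :
    leftOpLin B q deg f ε (incl q y * del (incl q w)) =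
      applyOpLin (C (del (rhoIncl B q deg f w))) (ε y)
        - applyOpLin (lamDel (C (rhoIncl B q deg f y))) (ε w) := by
  have h1 : ∀ i, leftOpLin B q deg f ε ∘ₗ LinearMap.mulLeft F (MvPolynomial.X (i, 0)) ∘ₗ
        del.toLinearMap ∘ₗ incl q =
      applyOpBilin.flip (ε (q i)) ∘ₗ constLin ∘ₗ del.toLinearMap ∘ₗ rhoIncl B q deg f
        - applyOpBilin (lamDel (C (rhoIncl B q deg f (q i)))) ∘ₗ ε := fun i => q.ext fun j => by
    simp only [LinearMap.comp_apply, incl_basis, LinearMap.mulLeft_apply,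
      Derivation.coeFn_coe, del_X, leftOpLin_X_mul_X,
      pow_zero, zero_add, pow_one, Module.End.one_apply, LinearMap.sub_apply,
      LinearMap.flip_apply, constLin_apply, applyOpBilin_apply, rhoIncl_apply, LinearMap.neg_apply]
    rw [← rho_del, del_X, ← applyOpBilin_apply (-_), map_neg, LinearMap.neg_apply,
      applyOpBilin_apply, sub_eq_add_neg]
  have h2 : leftOpLin B q deg f ε ∘ₗ LinearMap.mulRight F (del (incl q w)) ∘ₗ incl q =
      applyOpBilin (C (del (rhoIncl B q deg f w))) ∘ₗ ε
        - applyOpBilin.flip (ε w) ∘ₗ lamDel ∘ₗ constLin ∘ₗ rhoIncl B q deg f := q.ext fun i => by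
    simpa [incl_basis, constLin_apply] using LinearMap.congr_fun (h1 i) w
  exact LinearMap.congr_fun h2 y

/-- The partial derivatives of h stay in V(g_{≤1/2}), so ρ fixes them, and ρ commutes with ∂ + λ.
Hence ρ passes through the Master Formula, and what is left depends on h only through the values
ρ{y_λ h} for y ∈ g. -/
theorem rhoBracket_eq_leftOp (hρ : ∀ P ∈ MvPolynomial.supported F {p : ι × ℕ | deg p.1 ≤ 1 / 2},
      rho B q deg f P = P) (p : DiffPoly F ι) {h : DiffPoly F ι}
    (hh : h ∈ MvPolynomial.supported F {p : ι × ℕ | deg p.1 ≤ 1 / 2}) :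
    rhoBracket B q deg f s z p h =
      leftOpLin B q deg f (evalDer h ∘ₗ adDerLin B q deg f s z) p := by
  have hpd : ∀ v, rho B q deg f (MvPolynomial.pderiv v h) = MvPolynomial.pderiv v h := by
    classical
    intro v
    refine hρ _ ?_
    clear hρ
    induction hh using Algebra.adjoin_induction with
    | mem P hP =>
      obtain ⟨w, hw, rfl⟩ := hP
      rw [MvPolynomial.pderiv_X, Pi.single_apply]
      split_ifs
      · exact one_mem _
      · exact zero_mem _
    | algebraMap c => simp
    | add P Q _ _ hp hq => rw [map_add]; exact add_mem hp hq
    | mul P Q hP hQ hp hq =>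
      rw [MvPolynomial.pderiv_mul]
      exact add_mem (mul_mem hp hQ) (mul_mem hP hq)
  have hmapC : ∀ c, Polynomial.map (rho B q deg f).toRingHom (C c) = C (rho B q deg f c) :=
    fun c => Polynomial.map_C _
  rw [rhoBracket, affineBracket, masterBracket, Finset.sum_comm, Polynomial.map_sum,
    leftOpLin_apply, leftOp]
  refine Finset.sum_congr rfl fun w _ => ?_
  have hE : adDer B q deg f s z (q w.1) h = ∑ v ∈ h.vars, C (MvPolynomial.pderiv v h) *
      (lamDel ^ v.2) (C (rhoIncl B q deg f ⁅q w.1, q v.1⁆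
        + MvPolynomial.C (z * B s ⁅q w.1, q v.1⁆))
          + C (MvPolynomial.C (B (q w.1) (q v.1))) * X) := by
    rw [derivation_eq_sum_of_vars_subset _ subset_rfl]
    refine Finset.sum_congr rfl fun v _ => ?_
    rw [smul_eq_C_mul]
    congr 1
    exact adDer_X B q deg f s z (q w.1) v.1 v.2
  rw [LinearMap.comp_apply, adDerLin_apply]
  change _ = applyOpLin _ (adDer B q deg f s z (q w.1) h)
  rw [hE, map_sum, Polynomial.map_sum]
  refine Finset.sum_congr rfl fun v _ => ?_
  rw [applyOpLin_C_mul, applyOpLin_lamDel_pow, Polynomial.map_mul, hmapC, hpd,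
    map_lamDel_pow _ (rho_del B q deg f), applyOp_eq, map_applyOpLin _ (rho_del B q deg f),
    map_neg_lamDel_pow _ (rho_del B q deg f), hmapC]
  congr 4
  simp only [Polynomial.map_add, Polynomial.map_mul, hmapC, Polynomial.map_X, map_add,
    rhoIncl_apply, MvPolynomial.algHom_C, MvPolynomial.algebraMap_eq]

end Reduced

/-! ### The W-algebra as a joint kernel of derivations -/

section Homogeneous

variable {F : Type*} [Field F] {g : Type*} [LieRing g] [LieAlgebra F g] [CharZero F] {ι : Type*}
  {q : Module.Basis ι F g} {deg : ι → ℚ} {x : g}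
  (hq : ∀ i, q i ∈ (gr x (deg i) : Submodule F g))
include hq

/-- The i-th coordinate functional is an eigenvector of the transpose of ad x with eigenvalue deg i.
-/
theorem repr_eq_zero {j : ℚ} {y : g} (hy : y ∈ (gr x j : Submodule F g)) {i : ι}
    (hi : deg i ≠ j) : q.repr y i = 0 := by
  have h1 : q.coord i ∘ₗ (LieAlgebra.ad F g x : g →ₗ[F] g) = (deg i : F) • q.coord i := by
    classical
    refine q.ext fun k => ?_
    rw [LinearMap.comp_apply, LieAlgebra.ad_apply, mem_gr.mp (hq k)]
    simp only [map_smul, LinearMap.smul_apply, Module.Basis.coord_apply, Module.Basis.repr_self,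
      Finsupp.single_apply, smul_eq_mul]
    split_ifs with h
    · rw [h]
    · simp
  have h2 := LinearMap.congr_fun h1 y
  rw [LinearMap.comp_apply, LieAlgebra.ad_apply, mem_gr.mp hy] at h2
  simp only [map_smul, LinearMap.smul_apply, Module.Basis.coord_apply, smul_eq_mul] at h2
  have h3 : ((deg i - j : ℚ) : F) * q.repr y i = 0 := by
    push_cast
    linear_combination -h2
  exact (mul_eq_zero.mp h3).resolve_left (by exact_mod_cast sub_ne_zero.mpr hi)

theorem linearMap_eq_of_mem_gr {M : Type*} [AddCommGroup M] [Module F M] {l l' : g →ₗ[F] M}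
    {j : ℚ} (h : ∀ i, deg i = j → l (q i) = l' (q i)) {y : g}
    (hy : y ∈ (gr x j : Submodule F g)) : l y = l' y := by
  rw [← q.linearCombination_repr y, Finsupp.linearCombination_apply, map_finsuppSum,
    map_finsuppSum]
  refine Finsupp.sum_congr fun i hi => ?_
  rw [map_smul, map_smul, h i]
  by_contra hne
  exact Finsupp.mem_support_iff.mp hi (repr_eq_zero hq hy hne)

theorem incl_mem_of_mem_gr {p : Submodule F (DiffPoly F ι)} {j : ℚ}
    (h : ∀ i, deg i = j → MvPolynomial.X (i, 0) ∈ p) {y : g}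
    (hy : y ∈ (gr x j : Submodule F g)) : incl q y ∈ p := by
  rw [← Submodule.Quotient.mk_eq_zero]
  exact linearMap_eq_of_mem_gr hq (l := p.mkQ ∘ₗ incl q) (l' := 0)
    (fun i hi => by simpa [incl_basis] using h i hi) hy

theorem incl_mem_supported {j : ℚ} (hj : j ≤ 1 / 2) {y : g}
    (hy : y ∈ (gr x j : Submodule F g)) :
    incl q y ∈ MvPolynomial.supported F {p : ι × ℕ | deg p.1 ≤ 1 / 2} := by
  refine incl_mem_of_mem_gr hq (p := Subalgebra.toSubmodule (MvPolynomial.supported F _))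
    (fun i hi => ?_) hy
  exact Algebra.subset_adjoin ⟨(i, 0), by simpa [hi] using hj, rfl⟩

omit hq in
theorem del_mem_supported {s : Set ι} {P : DiffPoly F ι}
    (hP : P ∈ MvPolynomial.supported F {p : ι × ℕ | p.1 ∈ s}) :
    del P ∈ MvPolynomial.supported F {p : ι × ℕ | p.1 ∈ s} := by
  induction hP using Algebra.adjoin_induction with
  | mem P hP =>
    obtain ⟨⟨i, n⟩, hi, rfl⟩ := hP
    rw [del_X]
    exact Algebra.subset_adjoin ⟨(i, n + 1), hi, rfl⟩
  | algebraMap c => simp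
  | add P Q _ _ hp hq => rw [map_add]; exact add_mem hp hq
  | mul P Q hP hQ hp hq =>
    rw [Derivation.leibniz, smul_eq_mul, smul_eq_mul]
    exact add_mem (mul_mem hP hq) (mul_mem hQ hp)

end Homogeneous

namespace MinimalGrading

variable {F : Type*} [Field F] {g : Type*} [LieRing g] [LieAlgebra F g] [CharZero F]
  {B : LinearMap.BilinForm F g} {e x f : g} (G : MinimalGrading B e x f)
  {ι : Type*} {q : Module.Basis ι F g} {deg : ι → ℚ}
  (hq : ∀ i, q i ∈ (gr x (deg i) : Submodule F g))
  {s : g} (hs : s ∈ (gr x 1 : Submodule F g)) (z : F)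
include G hq

theorem deg_eq (i : ι) :
    deg i = -1 ∨ deg i = -1 / 2 ∨ deg i = 0 ∨ deg i = 1 / 2 ∨ deg i = 1 :=
  G.degree _ fun h => q.ne_zero i (by simpa [h] using hq i)

theorem form_f_basis {i : ι} (hi : deg i ≤ 1 / 2) : B f (q i) = 0 :=
  G.form_eq_zero G.f_mem (hq i) (fun h => by linarith)

theorem rho_eq_self {P : DiffPoly F ι}
    (hP : P ∈ MvPolynomial.supported F {p : ι × ℕ | deg p.1 ≤ 1 / 2}) :
    rho B q deg f P = P := by
  induction hP using Algebra.adjoin_induction with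
  | mem P hP =>
    obtain ⟨⟨i, n⟩, hi, rfl⟩ := hP
    have hi' : deg i ≤ 1 / 2 := hi
    rw [rho_X, if_pos hi', G.form_f_basis hq hi', map_zero, add_zero, iterate_del_X, zero_add]
  | algebraMap c => simp [MvPolynomial.algebraMap_eq, MvPolynomial.algHom_C]
  | add P Q _ _ hp hq => rw [map_add, hp, hq]
  | mul P Q _ _ hp hq => rw [map_mul, hp, hq]

theorem rhoIncl_eq_incl {j : ℚ} (hj : j ≤ 1 / 2) {y : g}
    (hy : y ∈ (gr x j : Submodule F g)) : rhoIncl B q deg f y = incl q y :=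
  G.rho_eq_self hq (incl_mem_supported hq hj hy)

theorem rhoIncl_of_mem_one {y : g} (hy : y ∈ (gr x 1 : Submodule F g)) :
    rhoIncl B q deg f y = MvPolynomial.C (B f y) := by
  refine linearMap_eq_of_mem_gr hq
    (l' := Algebra.linearMap F (DiffPoly F ι) ∘ₗ B f) (fun i hi => ?_) hy
  rw [rhoIncl_apply, incl_basis, rho_X, if_neg (by rw [hi]; norm_num), zero_add]
  rfl

theorem rhoBracket_eq (p : DiffPoly F ι) {h : DiffPoly F ι}
    (hh : h ∈ MvPolynomial.supported F {p : ι × ℕ | deg p.1 ≤ 1 / 2}) :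
    rhoBracket B q deg f s z p h =
      leftOpLin B q deg f (evalDer h ∘ₗ adDerLin B q deg f s z) p :=
  rhoBracket_eq_leftOp B q deg f s z (fun _ => G.rho_eq_self hq) p hh

theorem rhoBracket_incl (y : g) {h : DiffPoly F ι}
    (hh : h ∈ MvPolynomial.supported F {p : ι × ℕ | deg p.1 ≤ 1 / 2}) :
    rhoBracket B q deg f s z (incl q y) h = adDer B q deg f s z y h := by
  rw [G.rhoBracket_eq hq z _ hh, leftOpLin_incl]
  rfl

/-- g_{≥1/2} is spanned by g_{1/2} and e, and brackets with elements of g are given by `adDer`. -/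
theorem mem_W_iff {P : DiffPoly F ι} : P ∈ W B q deg f x s z ↔
    P ∈ MvPolynomial.supported F {p : ι × ℕ | deg p.1 ≤ 1 / 2} ∧
      (∀ w ∈ (gr x (1 / 2) : Submodule F g), adDer B q deg f s z w P = 0) ∧
      adDer B q deg f s z e P = 0 := by
  constructor
  · rintro ⟨hP, h⟩
    have key : ∀ j : ℚ, 1 / 2 ≤ j → ∀ w ∈ (gr x j : Submodule F g),
        adDer B q deg f s z w P = 0 := fun j hj w hw => by
      rw [← G.rhoBracket_incl hq z w hP]
      exact h w (Submodule.mem_iSup_of_mem (⟨j, hj⟩ : {j : ℚ // 1 / 2 ≤ j}) hw)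
    exact ⟨hP, key _ le_rfl, key 1 (by norm_num) e G.e_mem⟩
  · rintro ⟨hP, h1, h2⟩
    refine ⟨hP, fun w hw => ?_⟩
    rw [G.rhoBracket_incl hq z w hP, ← adDerLin_apply]
    induction hw using Submodule.iSup_induction' with
    | zero => rw [map_zero]; rfl
    | add w₁ w₂ _ _ h₁ h₂ => rw [map_add, Derivation.add_apply, h₁, h₂, add_zero]
    | mem j w hw =>
      obtain ⟨j, hj⟩ := j
      by_cases h0 : w = 0
      · rw [h0, map_zero]; rfl
      have := G.degree j fun hbot => h0 (by simpa [hbot] using hw)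
      rcases this with rfl | rfl | rfl | rfl | rfl
      · norm_num at hj
      · norm_num at hj
      · norm_num at hj
      · exact h1 w hw
      · obtain ⟨c, rfl⟩ := G.one w hw
        rw [map_smul, Derivation.smul_apply, adDerLin_apply, h2, smul_zero]

include hs

/-- Since s has degree 1, it can pair non-trivially with [y, w] only in total degree -1. Brackets of
g_{≥1/2} with g never land there, which is why z does not affect membership in W. -/
theorem adDer_incl_of_mem {i j : ℚ} {y w : g} (hy : y ∈ (gr x i : Submodule F g))
    (hw : w ∈ (gr x j : Submodule F g)) (hij : i + j ≠ -1) :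
    adDer B q deg f s z y (incl q w) =
      C (rhoIncl B q deg f ⁅y, w⁆) + C (MvPolynomial.C (B y w)) * X := by
  rw [adDer_incl, G.form_eq_zero hs (lie_mem_gr hy hw rfl) (fun h => hij (by linarith)), mul_zero,
    map_zero, add_zero]

variable {v b u : g}

theorem adDer_half_half (hv : v ∈ (gr x (1 / 2) : Submodule F g)) {w : g}
    (hw : w ∈ (gr x (1 / 2) : Submodule F g)) :
    adDer B q deg f s z v (incl q w) = C (MvPolynomial.C (symplectic B f v w)) := by
  rw [G.adDer_incl_of_mem hq hs z hv hw (by norm_num),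
    G.rhoIncl_of_mem_one hq (lie_mem_gr hv hw (by norm_num)),
    G.form_eq_zero hv hw (by norm_num), map_zero, C_0, zero_mul, add_zero, symplectic_apply]

theorem adDer_half_zero (hv : v ∈ (gr x (1 / 2) : Submodule F g))
    (hb : b ∈ (gr x 0 : Submodule F g)) :
    adDer B q deg f s z v (incl q b) = C (incl q ⁅v, b⁆) := by
  rw [G.adDer_incl_of_mem hq hs z hv hb (by norm_num),
    G.rhoIncl_eq_incl hq le_rfl (lie_mem_gr hv hb (by norm_num)),
    G.form_eq_zero hv hb (by norm_num), map_zero, C_0, zero_mul, add_zero]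

theorem adDer_half_neg_half (hv : v ∈ (gr x (1 / 2) : Submodule F g))
    (hu : u ∈ (gr x (-1 / 2) : Submodule F g)) :
    adDer B q deg f s z v (incl q u) =
      C (incl q ⁅v, u⁆) + C (MvPolynomial.C (B v u)) * X := by
  rw [G.adDer_incl_of_mem hq hs z hv hu (by norm_num),
    G.rhoIncl_eq_incl hq (j := 0) (by norm_num) (lie_mem_gr hv hu (by norm_num))]

theorem adDer_half_f (hv : v ∈ (gr x (1 / 2) : Submodule F g)) :
    adDer B q deg f s z v (incl q f) = C (incl q ⁅v, f⁆) := by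
  rw [G.adDer_incl_of_mem hq hs z hv G.f_mem (by norm_num),
    G.rhoIncl_eq_incl hq (j := -1 / 2) (by norm_num) (lie_mem_gr hv G.f_mem (by norm_num)),
    G.form_eq_zero hv G.f_mem (by norm_num), map_zero, C_0, zero_mul, add_zero]

theorem adDer_e_half {w : g} (hw : w ∈ (gr x (1 / 2) : Submodule F g)) :
    adDer B q deg f s z e (incl q w) = 0 := by
  rw [G.adDer_incl_of_mem hq hs z G.e_mem hw (by norm_num),
    G.eq_zero (lie_mem_gr G.e_mem hw rfl) (by norm_num),
    G.form_eq_zero G.e_mem hw (by norm_num), map_zero, map_zero, map_zero, C_0, zero_mul, add_zero]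

theorem adDer_e_zero (hb : b ∈ (gr x 0 : Submodule F g)) :
    adDer B q deg f s z e (incl q b) = C (MvPolynomial.C (-2 * B x b)) := by
  have h : B f ⁅e, b⁆ = -2 * B x b := by
    rw [← G.inv, G.lie_fe, map_neg, map_smul, LinearMap.neg_apply, LinearMap.smul_apply,
      smul_eq_mul, neg_mul]
  rw [G.adDer_incl_of_mem hq hs z G.e_mem hb (by norm_num),
    G.rhoIncl_of_mem_one hq (lie_mem_gr G.e_mem hb (by norm_num)),
    G.form_eq_zero G.e_mem hb (by norm_num), map_zero, C_0, zero_mul, add_zero, h]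

theorem adDer_e_neg_half (hu : u ∈ (gr x (-1 / 2) : Submodule F g)) :
    adDer B q deg f s z e (incl q u) = C (incl q ⁅e, u⁆) := by
  rw [G.adDer_incl_of_mem hq hs z G.e_mem hu (by norm_num),
    G.rhoIncl_eq_incl hq le_rfl (G.lie_e_mem hu),
    G.form_eq_zero G.e_mem hu (by norm_num), map_zero, C_0, zero_mul, add_zero]

theorem adDer_e_f : adDer B q deg f s z e (incl q f) =
    C (incl q ((2 : F) • x)) + C (MvPolynomial.C (B e f)) * X := by
  rw [G.adDer_incl_of_mem hq hs z G.e_mem G.f_mem (by norm_num), G.lie_ef,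
    G.rhoIncl_eq_incl hq (j := 0) (by norm_num) (Submodule.smul_mem _ _ x_mem)]

end MinimalGrading

/-! ### The generators belong to the W-algebra -/

namespace MinimalGrading

variable {F : Type*} [Field F] {g : Type*} [LieRing g] [LieAlgebra F g] [CharZero F]
  {B : LinearMap.BilinForm F g} {e x f : g} (G : MinimalGrading B e x f)
  {ι : Type*} {q : Module.Basis ι F g} {deg : ι → ℚ}
  (hq : ∀ i, q i ∈ (gr x (deg i) : Submodule F g))
  {s : g} (hs : s ∈ (gr x 1 : Submodule F g)) (z : F)
  {J₀ J : Type*} [Fintype J₀] [Fintype J] {a a' : J₀ → g} {v v' : J → g}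
  (ha : IsDualOn (fun y w => B y w) (gr x 0) a a')
  (hv : IsDualOn (fun y w => symplectic B f y w) (gr x (1 / 2)) v v')

/-- The inclusion of `g` into the polynomials in `λ` over `V(g)`. -/
def inclC (q : Module.Basis ι F g) : g →ₗ[F] (DiffPoly F ι)[X] := constLin ∘ₗ incl q

theorem inclC_apply (y : g) : inclC q y = C (incl q y) := rfl

theorem lamDel_inclC (y : g) : lamDel (inclC q y) = C (del (incl q y)) + X * inclC q y :=
  lamDel_C _

/-- The product `l y * l' w` as a bilinear map. -/
def mulBilin (l l' : g →ₗ[F] (DiffPoly F ι)[X]) : g →ₗ[F] g →ₗ[F] (DiffPoly F ι)[X] :=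
  (LinearMap.mul F (DiffPoly F ι)[X]).compl₁₂ l l'

theorem mulBilin_apply (l l' : g →ₗ[F] (DiffPoly F ι)[X]) (y w : g) :
    mulBilin l l' y w = l y * l' w := rfl

theorem two_mul_half : (2 : (DiffPoly F ι)[X]) * C (MvPolynomial.C (1 / 2 : F)) = 1 := by
  have h : ((2 : F) : F) * (1 / 2) = 1 := by norm_num
  have : (2 : (DiffPoly F ι)[X]) = C (MvPolynomial.C (2 : F)) := by rw [map_ofNat, map_ofNat]
  rw [this, ← C_mul, ← map_mul, h, map_one, C_1]

include G hq hs ha hv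

/-- Expanding [w, [f, v_k]] ∈ g_0 in the a_j turns ∑ v^k [w, [f, v_k]] into -∑ a_j [w, a^j], which
cancels the contribution of the g_0 sum. The linear terms [f, w], ∂w and λw cancel between f, ∂x and
the two sums over k. -/
theorem adDer_half_virL {w : g} (hw : w ∈ (gr x (1 / 2) : Submodule F g)) :
    adDer B q deg f s z w (virL q f x a a' v v') = 0 := by
  have hvk := hv.mem
  have hvk' := hv.mem'
  have e1 : ∑ j, inclC q (a' j) * inclC q ⁅w, a j⁆ = ∑ j, inclC q (a j) * inclC q ⁅w, a' j⁆ := by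
    have := ha.sum_swap (ε := 1) (fun y w => by rw [one_mul]; exact G.symm y w)
      (mulBilin (inclC q) (inclC q ∘ₗ (LieAlgebra.ad F g w : g →ₗ[F] g)))
    simpa [mulBilin_apply] using this
  have e2 : ∑ k, inclC q (v' k) * inclC q ⁅w, ⁅f, v k⁆⁆ =
      -∑ j, inclC q (a j) * inclC q ⁅w, a' j⁆ := by
    have h1 : ∀ k, inclC q (v' k) * inclC q ⁅w, ⁅f, v k⁆⁆ =
        ∑ j, inclC q (a j) * (symplectic B f (v k) ⁅a' j, w⁆ • inclC q (v' k)) := by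
      intro k
      rw [← ha.sum_left (inclC q) (lie_mem_gr hw (G.lie_f_mem (hvk k)) (by norm_num)),
        Finset.mul_sum]
      refine Finset.sum_congr rfl fun j _ => ?_
      have : B ⁅w, ⁅f, v k⁆⁆ (a' j) = symplectic B f (v k) ⁅a' j, w⁆ := by
        rw [G.symm, ← G.inv, G.symm, G.inv, symplectic_apply]
      rw [this, mul_smul_comm, mul_smul_comm, mul_comm]
    simp_rw [h1]
    rw [Finset.sum_comm, ← Finset.sum_neg_distrib]
    refine Finset.sum_congr rfl fun j _ => ?_
    rw [← Finset.mul_sum, hv.sum_right (inclC q) (lie_mem_gr (ha.mem' j) hw (by norm_num)),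
      ← lie_skew, map_neg]
    ring
  have e3 : ∑ k, symplectic B f w (v' k) • inclC q ⁅f, v k⁆ = inclC q ⁅f, w⁆ :=
    hv.sum_left (inclC q ∘ₗ (LieAlgebra.ad F g f : g →ₗ[F] g)) hw
  have e4 : ∑ k, symplectic B f (v k) w • inclC q (v' k) = inclC q w := hv.sum_right _ hw
  have e5 : ∑ k, symplectic B f w (v' k) • C (del (incl q (v k))) = C (del (incl q w)) :=
    hv.sum_left (constLin ∘ₗ del.toLinearMap ∘ₗ incl q) hw
  have e6 : ∀ k, B w ⁅f, v k⁆ = symplectic B f (v k) w := fun k => by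
    rw [G.symm, G.inv, symplectic_apply]
  have e7 : ∀ k, symplectic B f w (v k) = -symplectic B f (v k) w := fun k => by
    rw [symplectic_skew, neg_one_mul]
  have d1 : ∑ j, adDer B q deg f s z w (incl q (a j) * incl q (a' j)) =
      2 * ∑ j, inclC q (a j) * inclC q ⁅w, a' j⁆ := by
    rw [two_mul]
    nth_rw 2 [← e1]
    rw [← Finset.sum_add_distrib]
    refine Finset.sum_congr rfl fun j _ => ?_
    rw [Derivation.leibniz, G.adDer_half_zero hq hs z hw (ha.mem j),
      G.adDer_half_zero hq hs z hw (ha.mem' j), smul_eq_C_mul, smul_eq_C_mul]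
    rfl
  have d2 : ∑ k, adDer B q deg f s z w (incl q (v' k) * incl q ⁅f, v k⁆) =
      -∑ j, inclC q (a j) * inclC q ⁅w, a' j⁆ + inclC q w * X + inclC q ⁅f, w⁆ := by
    rw [← e2, ← e3, ← e4, Finset.sum_mul, ← Finset.sum_add_distrib, ← Finset.sum_add_distrib]
    refine Finset.sum_congr rfl fun k _ => ?_
    rw [Derivation.leibniz, G.adDer_half_neg_half hq hs z hw (G.lie_f_mem (hvk k)),
      G.adDer_half_half hq hs z hw (hvk' k), smul_eq_C_mul, smul_eq_C_mul, e6,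
      smul_eq_C_C_mul, smul_eq_C_C_mul, inclC_apply, inclC_apply, inclC_apply]
    ring
  have d3 : ∑ k, adDer B q deg f s z w (incl q (v' k) * del (incl q (v k))) =
      C (del (incl q w)) - inclC q w * X := by
    rw [← e5, ← e4, Finset.sum_mul, ← Finset.sum_sub_distrib]
    refine Finset.sum_congr rfl fun k _ => ?_
    have := lamDel_pow_scalar (F := F) (ι := ι) (symplectic B f w (v k)) 1
    rw [pow_one, pow_one] at this
    rw [Derivation.leibniz, adDer_del, G.adDer_half_half hq hs z hw (hvk k), this,
      G.adDer_half_half hq hs z hw (hvk' k), smul_eq_C_mul, smul_eq_C_mul, e7, map_neg,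
      smul_eq_C_C_mul, smul_eq_C_C_mul, inclC_apply, C_neg]
    ring
  have d4 : adDer B q deg f s z w (incl q x) = -(C (MvPolynomial.C (1 / 2)) * inclC q w) := by
    rw [G.adDer_half_zero hq hs z hw x_mem, ← lie_skew, mem_gr.mp hw, ← inclC_apply, map_neg,
      map_smul, smul_eq_C_C_mul]
    norm_num
  have d5 : adDer B q deg f s z w (incl q f) = -inclC q ⁅f, w⁆ := by
    rw [G.adDer_half_f hq hs z hw, ← lie_skew, map_neg, C_neg, inclC_apply]
  rw [virL, map_add, map_add, map_add, map_add, Derivation.map_smul, Derivation.map_smul, map_sum,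
    map_sum, map_sum, d1, d2, d3, d5, adDer_del, d4, map_neg, lamDel_scalar_mul, lamDel_inclC,
    smul_eq_C_C_mul, smul_eq_C_C_mul]
  linear_combination (∑ j, inclC q (a j) * inclC q ⁅w, a' j⁆ - inclC q w * X) * two_mul_half (F := F) (ι := ι)

/-- The g_0 sum gives -2x, against 2x from [e, f]; ∂x gives -(e|f)λ because (e|f) = 2(x|x). The
remaining term ∑ v^k v_k vanishes, since the form is skew while the factors commute. -/
theorem adDer_e_virL : adDer B q deg f s z e (virL q f x a a' v v') = 0 := by
  have hvk := hv.mem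
  have hvk' := hv.mem'
  have e1 : ∑ j, B x (a' j) • inclC q (a j) = inclC q x := ha.sum_left _ x_mem
  have e1' : ∑ j, B (a j) x • inclC q (a' j) = inclC q x := ha.sum_right _ x_mem
  have e2 : ∑ k, inclC q (v' k) * inclC q (v k) = 0 := by
    have := hv.sum_swap (ε := -1) symplectic_skew (mulBilin (inclC q) (inclC q))
    simp only [mulBilin_apply, mul_comm (inclC q (v _)) (inclC q (v' _)), neg_one_smul] at this
    exact self_eq_neg.mp this
  have d1 : ∑ j, adDer B q deg f s z e (incl q (a j) * incl q (a' j)) =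
      -(4 * inclC q x) := by
    have : (4 : (DiffPoly F ι)[X]) * inclC q x = 2 * inclC q x + 2 * inclC q x := by ring
    rw [this]
    nth_rw 1 [← e1]
    rw [← e1', Finset.mul_sum, Finset.mul_sum, ← Finset.sum_add_distrib, ← Finset.sum_neg_distrib]
    refine Finset.sum_congr rfl fun j _ => ?_
    rw [Derivation.leibniz, G.adDer_e_zero hq hs z (ha.mem j),
      G.adDer_e_zero hq hs z (ha.mem' j), smul_eq_C_mul, smul_eq_C_mul, smul_eq_C_C_mul,
      smul_eq_C_C_mul, G.symm (a j) x, inclC_apply, inclC_apply]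
    simp only [map_mul, map_neg, map_ofNat]
    ring
  have d2 : ∑ k, adDer B q deg f s z e (incl q (v' k) * incl q ⁅f, v k⁆) = 0 := by
    rw [← e2]
    refine Finset.sum_congr rfl fun k _ => ?_
    rw [Derivation.leibniz, G.adDer_e_neg_half hq hs z (G.lie_f_mem (hvk k)),
      G.adDer_e_half hq hs z (hvk' k), smul_eq_C_mul, smul_zero, add_zero,
      G.lie_e_lie_f (hvk k), inclC_apply, inclC_apply]
  have d3 : ∑ k, adDer B q deg f s z e (incl q (v' k) * del (incl q (v k))) = 0 := by
    refine Finset.sum_eq_zero fun k _ => ?_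
    rw [Derivation.leibniz, adDer_del, G.adDer_e_half hq hs z (hvk k),
      G.adDer_e_half hq hs z (hvk' k), map_zero, smul_zero, smul_zero, add_zero]
  have d4 : lamDel (adDer B q deg f s z e (incl q x)) =
      -(C (MvPolynomial.C (B e f)) * X) := by
    have := lamDel_pow_scalar (F := F) (ι := ι) (-2 * B x x) 1
    rw [pow_one, pow_one] at this
    rw [G.adDer_e_zero hq hs z x_mem, this, G.form_ef]
    simp only [map_mul, map_neg, map_ofNat]
    ring
  rw [virL, map_add, map_add, map_add, map_add, Derivation.map_smul, Derivation.map_smul, map_sum,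
    map_sum, map_sum, d1, d2, d3, adDer_del, d4, G.adDer_e_f hq hs z, ← inclC_apply,
    map_smul, smul_eq_C_C_mul, smul_eq_C_C_mul, map_ofNat, map_ofNat, smul_zero]
  linear_combination (-2 * inclC q x) * two_mul_half (F := F) (ι := ι)

omit ha
-- Because [f, b] = 0, ad b is infinitesimally symplectic on g_{1/2}. So the two halves of the
-- Leibniz rule both sum to [b, w], and the factor ½ makes them cancel [w, b].
theorem adDer_half_phi {b : g} (hb : b ∈ (grZeroCentralizer x f : Submodule F g)) {w : g}
    (hw : w ∈ (gr x (1 / 2) : Submodule F g)) :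
    adDer B q deg f s z w (phi q v v' b) = 0 := by
  obtain ⟨hxb, hfb⟩ := mem_grZeroCentralizer.mp hb
  have hb0 : b ∈ (gr x 0 : Submodule F g) := by rw [mem_gr, hxb]; simp
  have hbw : ⁅b, w⁆ ∈ (gr x (1 / 2) : Submodule F g) := lie_mem_gr hb0 hw (by norm_num)
  have e1 : ∑ k, symplectic B f w (v' k) • inclC q ⁅b, v k⁆ = inclC q ⁅b, w⁆ :=
    hv.sum_left (inclC q ∘ₗ (LieAlgebra.ad F g b : g →ₗ[F] g)) hw
  have e2 : ∑ k, symplectic B f (v k) ⁅b, w⁆ • inclC q (v' k) = inclC q ⁅b, w⁆ :=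
    hv.sum_right _ hbw
  have e3 : ∀ k, symplectic B f w ⁅b, v k⁆ = symplectic B f (v k) ⁅b, w⁆ := fun k => by
    have h1 : B f ⁅b, ⁅w, v k⁆⁆ = 0 := by
      rw [← G.inv, hfb, map_zero, LinearMap.zero_apply]
    rw [leibniz_lie, map_add, ← lie_skew ⁅b, w⁆, map_neg] at h1
    rw [symplectic_apply, symplectic_apply]
    linear_combination h1
  have d1 : ∑ k, adDer B q deg f s z w (incl q ⁅b, v k⁆ * incl q (v' k)) =
      2 * inclC q ⁅b, w⁆ := by
    rw [two_mul]
    nth_rw 1 [← e1]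
    rw [← e2, ← Finset.sum_add_distrib]
    refine Finset.sum_congr rfl fun k _ => ?_
    rw [Derivation.leibniz, G.adDer_half_half hq hs z hw (hv.mem' k),
      G.adDer_half_half hq hs z hw (lie_mem_gr hb0 (hv.mem k) (by norm_num)), e3,
      smul_eq_C_mul, smul_eq_C_mul, smul_eq_C_C_mul, smul_eq_C_C_mul, inclC_apply, inclC_apply]
    ring
  rw [phi, map_add, Derivation.map_smul, map_sum, d1, G.adDer_half_zero hq hs z hw hb0,
    ← lie_skew, map_neg, C_neg, smul_eq_C_C_mul, ← inclC_apply]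
  linear_combination inclC q ⁅b, w⁆ * two_mul_half (F := F) (ι := ι)

theorem adDer_e_phi {b : g} (hb : b ∈ (grZeroCentralizer x f : Submodule F g)) :
    adDer B q deg f s z e (phi q v v' b) = 0 := by
  obtain ⟨hxb, hfb⟩ := mem_grZeroCentralizer.mp hb
  have hb0 : b ∈ (gr x 0 : Submodule F g) := by rw [mem_gr, hxb]; simp
  rw [phi, map_add, Derivation.map_smul, map_sum, G.adDer_e_zero hq hs z hb0,
    G.form_x_eq_zero hfb, Finset.sum_eq_zero fun k _ => ?_]
  · simp
  · rw [Derivation.leibniz, G.adDer_e_half hq hs z (hv.mem' k),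
      G.adDer_e_half hq hs z (lie_mem_gr hb0 (hv.mem k) (by norm_num)), smul_zero, smul_zero,
      add_zero]

end MinimalGrading

/-! ### The generators of weight 3/2 -/

namespace MinimalGrading

variable {F : Type*} [Field F] {g : Type*} [LieRing g] [LieAlgebra F g] [CharZero F]
  {B : LinearMap.BilinForm F g} {e x f : g} (G : MinimalGrading B e x f)
  {ι : Type*} {q : Module.Basis ι F g} {deg : ι → ℚ}
  (hq : ∀ i, q i ∈ (gr x (deg i) : Submodule F g))
  {s : g} (hs : s ∈ (gr x 1 : Submodule F g)) (z : F)
  {J : Type*} [Fintype J] {v v' : J → g}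
  (hv : IsDualOn (fun y w => symplectic B f y w) (gr x (1 / 2)) v v')
include G

theorem form_neg_half {u w : g} (hu : u ∈ (gr x (-1 / 2) : Submodule F g)) :
    B u w = -symplectic B f w ⁅e, u⁆ := by
  conv_lhs => rw [← G.lie_f_lie_e hu]
  rw [G.inv, ← lie_skew, map_neg, symplectic_apply]

theorem form_x_lie {u w : g} (hu : u ∈ (gr x (-1 / 2) : Submodule F g)) :
    -2 * B x ⁅u, w⁆ = B u w := by
  rw [← G.inv, mem_gr.mp hu, map_smul, LinearMap.smul_apply, smul_eq_mul]
  push_cast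
  ring

include hq hs hv

/-- Since e acts by zero on g_{1/2}, the cubic and the derivative terms drop out. In the quadratic
term, -2(x|[u, v_k]) = -ω(v_k, [e, u]), so it sums to -[e, u] and cancels the linear term. -/
theorem adDer_e_psi {u : g} (hu : u ∈ (gr x (-1 / 2) : Submodule F g)) :
    adDer B q deg f s z e (psi q e v v' u) = 0 := by
  have hb : ∀ k, ⁅u, v k⁆ ∈ (gr x 0 : Submodule F g) := fun k =>
    lie_mem_gr hu (hv.mem k) (by norm_num)
  have hy : ∀ h k, ⁅⁅u, v h⁆, v k⁆ ∈ (gr x (1 / 2) : Submodule F g) := fun h k =>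
    lie_mem_gr (hb h) (hv.mem k) (by norm_num)
  have e1 : ∑ k, symplectic B f (v k) ⁅e, u⁆ • inclC q (v' k) = inclC q ⁅e, u⁆ :=
    hv.sum_right _ (G.lie_e_mem hu)
  have d1 : ∀ h k, adDer B q deg f s z e
      (incl q ⁅⁅u, v h⁆, v k⁆ * incl q (v' h) * incl q (v' k)) = 0 := fun h k => by
    simp only [Derivation.leibniz, G.adDer_e_half hq hs z (hy h k),
      G.adDer_e_half hq hs z (hv.mem' _), smul_zero, add_zero]
  have d2 : ∑ k, adDer B q deg f s z e (incl q ⁅u, v k⁆ * incl q (v' k)) =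
      -inclC q ⁅e, u⁆ := by
    rw [← e1, ← Finset.sum_neg_distrib]
    refine Finset.sum_congr rfl fun k _ => ?_
    rw [Derivation.leibniz, G.adDer_e_half hq hs z (hv.mem' k), smul_zero, zero_add,
      G.adDer_e_zero hq hs z (hb k), G.form_x_lie hu, G.form_neg_half hu, smul_eq_C_mul,
      smul_eq_C_C_mul, inclC_apply, map_neg, C_neg]
    ring
  rw [psi, map_add, map_add, map_add, Derivation.map_smul, map_sum, map_sum,
    Finset.sum_eq_zero fun h _ => by rw [map_sum, Finset.sum_eq_zero fun k _ => d1 h k],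
    d2, adDer_del, G.adDer_e_half hq hs z (G.lie_e_mem hu), map_zero, smul_zero,
    G.adDer_e_neg_half hq hs z hu, ← inclC_apply]
  ring

/-- Hitting the three factors of the cubic term in turn gives A - p, A + p and A. The corrections
cancel, and ⅓ of the total compensates the -A from the quadratic term; ∂[e, u] is there to absorb
(w|u)λ. -/
theorem adDer_half_psi {u : g} (hu : u ∈ (gr x (-1 / 2) : Submodule F g)) {w : g}
    (hw : w ∈ (gr x (1 / 2) : Submodule F g)) :
    adDer B q deg f s z w (psi q e v v' u) = 0 := by
  have hb : ∀ {y : g}, y ∈ (gr x (1 / 2) : Submodule F g) → ⁅u, y⁆ ∈ (gr x 0 : Submodule F g) :=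
    fun hy => lie_mem_gr hu hy (by norm_num)
  have hlie : ∀ {b y : g}, b ∈ (gr x 0 : Submodule F g) → y ∈ (gr x (1 / 2) : Submodule F g) →
      ⁅b, y⁆ ∈ (gr x (1 / 2) : Submodule F g) := fun hb hy => lie_mem_gr hb hy (by norm_num)
  have heu := G.lie_e_mem hu
  set A := ∑ k, inclC q ⁅⁅u, v k⁆, w⁆ * inclC q (v' k) with hA
  set p := C (MvPolynomial.C (B e f)⁻¹) * (inclC q w * inclC q ⁅e, u⁆) with hp
  have ew : ∑ k, symplectic B f (v k) w • inclC q (v' k) = inclC q w := hv.sum_right _ hw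
  have eeu : ∑ k, symplectic B f (v k) ⁅e, u⁆ • inclC q (v' k) = inclC q ⁅e, u⁆ :=
    hv.sum_right _ heu
  -- the three contributions of the cubic term
  have c1 : ∀ h, ∑ k, symplectic B f w ⁅⁅u, v h⁆, v k⁆ • inclC q (v' k) =
      inclC q ⁅⁅u, v h⁆, w⁆ - ((B e f)⁻¹ * symplectic B f (v h) ⁅e, u⁆) • inclC q w := by
    intro h
    have hfb : ⁅f, ⁅u, v h⁆⁆ = ((B e f)⁻¹ * symplectic B f (v h) ⁅e, u⁆) • f := by
      have h1 := G.eq_smul_f (lie_mem_gr G.f_mem (hb (hv.mem h)) (by norm_num))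
      have h2 : B e ⁅f, ⁅u, v h⁆⁆ = symplectic B f (v h) ⁅e, u⁆ := by
        rw [← G.inv, G.lie_ef, map_smul, LinearMap.smul_apply, smul_eq_mul]
        linear_combination -G.form_x_lie (w := v h) hu - G.form_neg_half (w := v h) hu
      rw [h1, h2, div_eq_inv_mul]
    rw [← hv.sum_right (inclC q) (hlie (hb (hv.mem h)) hw), ← ew, Finset.smul_sum,
      ← Finset.sum_sub_distrib]
    refine Finset.sum_congr rfl fun k _ => ?_
    rw [smul_smul, ← sub_smul]
    congr 1
    have h3 : B f ⁅⁅u, v h⁆, ⁅w, v k⁆⁆ =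
        ((B e f)⁻¹ * symplectic B f (v h) ⁅e, u⁆) * B f ⁅w, v k⁆ := by
      rw [← G.inv, hfb, map_smul, LinearMap.smul_apply, smul_eq_mul]
    rw [leibniz_lie, map_add, ← lie_skew ⁅⁅u, v h⁆, w⁆, map_neg, ← lie_skew w (v k), map_neg] at h3
    rw [symplectic_apply, symplectic_apply (v k), symplectic_apply (v k) w]
    linear_combination h3
  have s1 : ∑ h, ∑ k, symplectic B f w ⁅⁅u, v h⁆, v k⁆ • (inclC q (v' h) * inclC q (v' k)) =
      A - p := by
    have : ∀ h, ∑ k, symplectic B f w ⁅⁅u, v h⁆, v k⁆ • (inclC q (v' h) * inclC q (v' k)) =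
        inclC q ⁅⁅u, v h⁆, w⁆ * inclC q (v' h) - C (MvPolynomial.C (B e f)⁻¹) * inclC q w *
          (symplectic B f (v h) ⁅e, u⁆ • inclC q (v' h)) := fun h => by
      simp only [← mul_smul_comm]
      rw [← Finset.mul_sum, c1, smul_eq_C_C_mul, smul_eq_C_C_mul, map_mul, C_mul]
      ring
    simp_rw [this]
    rw [Finset.sum_sub_distrib, ← Finset.mul_sum, eeu, hp, mul_assoc]
  have s2 : ∑ h, ∑ k, symplectic B f w (v' h) • (inclC q ⁅⁅u, v h⁆, v k⁆ * inclC q (v' k)) =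
      A + p := by
    rw [Finset.sum_comm]
    have h1 : ∀ k, ∑ h, symplectic B f w (v' h) • (inclC q ⁅⁅u, v h⁆, v k⁆ * inclC q (v' k)) =
        inclC q ⁅⁅u, v k⁆, w⁆ * inclC q (v' k) + C (MvPolynomial.C (B e f)⁻¹) * inclC q ⁅e, u⁆ *
          (symplectic B f (v k) w • inclC q (v' k)) := fun k => by
      have h2 := hv.sum_left (inclC q ∘ₗ (-(LieAlgebra.ad F g (v k) : g →ₗ[F] g)) ∘ₗ
        (LieAlgebra.ad F g u : g →ₗ[F] g)) hw
      simp only [LinearMap.comp_apply, LinearMap.neg_apply, LieAlgebra.ad_apply, lie_skew] at h2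
      simp only [← smul_mul_assoc]
      -- Exchanging w and v_k by the Jacobi identity leaves [u, [w, v_k]], a multiple of [e, u]
      -- because [w, v_k] lies in F e.
      have hj : ⁅⁅u, w⁆, v k⁆ = ⁅⁅u, v k⁆, w⁆ + ⁅u, ⁅w, v k⁆⁆ := by
        rw [lie_lie u w, ← lie_skew ⁅u, v k⁆ w]
        abel
      have hwv : ⁅u, ⁅w, v k⁆⁆ = ((B e f)⁻¹ * symplectic B f (v k) w) • ⁅e, u⁆ := by
        rw [G.eq_smul_e (lie_mem_gr hw (hv.mem k) (by norm_num)), lie_smul, ← lie_skew u e,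
          ← symplectic_apply, symplectic_skew, smul_neg, ← neg_smul]
        congr 1
        ring
      rw [← Finset.sum_mul, h2, hj, hwv, map_add, map_smul, smul_eq_C_C_mul, smul_eq_C_C_mul,
        map_mul, C_mul]
      ring
    simp_rw [h1]
    rw [Finset.sum_add_distrib, ← Finset.mul_sum, ew, hp]
    ring
  have s3 : ∑ h, ∑ k, symplectic B f w (v' k) • (inclC q ⁅⁅u, v h⁆, v k⁆ * inclC q (v' h)) =
      A := by
    refine Finset.sum_congr rfl fun h _ => ?_
    have h2 := hv.sum_left (inclC q ∘ₗ (LieAlgebra.ad F g ⁅u, v h⁆ : g →ₗ[F] g)) hw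
    simp only [LinearMap.comp_apply, LieAlgebra.ad_apply] at h2
    simp only [← smul_mul_assoc]
    rw [← Finset.sum_mul, h2]
  have d1 : ∑ h, ∑ k, adDer B q deg f s z w
      (incl q ⁅⁅u, v h⁆, v k⁆ * incl q (v' h) * incl q (v' k)) = 3 * A := by
    have : 3 * A = (A - p) + (A + p) + A := by ring
    rw [this]
    nth_rw 1 [← s1]
    rw [← s2, ← s3, ← Finset.sum_add_distrib, ← Finset.sum_add_distrib]
    refine Finset.sum_congr rfl fun h _ => ?_
    rw [← Finset.sum_add_distrib, ← Finset.sum_add_distrib]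
    refine Finset.sum_congr rfl fun k _ => ?_
    rw [Derivation.leibniz, Derivation.leibniz, G.adDer_half_half hq hs z hw (hv.mem' k),
      G.adDer_half_half hq hs z hw (hv.mem' h),
      G.adDer_half_half hq hs z hw (hlie (hb (hv.mem h)) (hv.mem k))]
    simp only [smul_eq_C_mul, smul_eq_C_C_mul, inclC_apply, C_mul]
    ring
  have d2 : ∑ k, adDer B q deg f s z w (incl q ⁅u, v k⁆ * incl q (v' k)) =
      inclC q ⁅u, w⁆ - A := by
    have h2 := hv.sum_left (inclC q ∘ₗ (LieAlgebra.ad F g u : g →ₗ[F] g)) hw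
    simp only [LinearMap.comp_apply, LieAlgebra.ad_apply] at h2
    rw [← h2, hA, ← Finset.sum_sub_distrib]
    refine Finset.sum_congr rfl fun k _ => ?_
    rw [Derivation.leibniz, G.adDer_half_half hq hs z hw (hv.mem' k),
      G.adDer_half_zero hq hs z hw (hb (hv.mem k)), ← lie_skew w, map_neg, C_neg]
    simp only [smul_eq_C_mul, smul_eq_C_C_mul, inclC_apply]
    ring
  have d3 : lamDel (adDer B q deg f s z w (incl q ⁅e, u⁆)) =
      -(C (MvPolynomial.C (B w u)) * X) := by
    have := lamDel_pow_scalar (F := F) (ι := ι) (symplectic B f w ⁅e, u⁆) 1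
    rw [pow_one, pow_one] at this
    rw [G.adDer_half_half hq hs z hw heu, this, G.symm w u, G.form_neg_half hu, map_neg, C_neg]
    ring
  have h3 : (3 : (DiffPoly F ι)[X]) * C (MvPolynomial.C (1 / 3 : F)) = 1 := by
    have h : (3 : F) * (1 / 3) = 1 := by norm_num
    have h' : (3 : (DiffPoly F ι)[X]) = C (MvPolynomial.C (3 : F)) := by rw [map_ofNat, map_ofNat]
    rw [h', ← C_mul, ← map_mul, h, map_one, C_1]
  rw [psi, map_add, map_add, map_add, Derivation.map_smul, map_sum, map_sum, d2]
  simp only [map_sum]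
  rw [d1, adDer_del, d3, G.adDer_half_neg_half hq hs z hw hu, ← lie_skew, ← inclC_apply, map_neg,
    smul_eq_C_C_mul]
  linear_combination A * h3

end MinimalGrading

/-! ### The Virasoro element -/

section Sugawara

variable {F : Type*} [Field F] {g : Type*} [LieRing g] [LieAlgebra F g] {ι : Type*}
  (B : LinearMap.BilinForm F g) (q : Module.Basis ι F g) (deg : ι → ℚ) (f x s : g) (z : F)
  {I : Type*} [Fintype I] (p p' : I → g)

/-- The derivation `h ↦ ρ{T_λ h}_z`, where `T = ½ ∑ p_i p'_i + ∂x` for dual families `p`, `p'` of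
`g`. -/
def sugawaraDer : Derivation F (DiffPoly F ι) (DiffPoly F ι)[X] :=
  ∑ i, (applyOpLin (C (rhoIncl B q deg f (p' i)))).compDer (adDer B q deg f s z (p i))
    - (LinearMap.mulLeft (DiffPoly F ι) X).compDer (adDer B q deg f s z x)

theorem sugawaraDer_apply (h : DiffPoly F ι) : sugawaraDer B q deg f x s z p p' h =
    ∑ i, applyOpLin (C (rhoIncl B q deg f (p' i))) (adDer B q deg f s z (p i) h)
      - X * adDer B q deg f s z x h := by
  rw [sugawaraDer, Derivation.sub_apply]
  congr 1
  exact map_sum (evalDer h) _ _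

theorem sugawaraDer_del (h : DiffPoly F ι) : sugawaraDer B q deg f x s z p p' (del h) =
    lamDel (sugawaraDer B q deg f x s z p p' h) := by
  rw [sugawaraDer_apply, sugawaraDer_apply, map_sub, map_sum, adDer_del, lamDel_X_mul]
  simp only [adDer_del, applyOpLin_lamDel]

end Sugawara

namespace MinimalGrading

variable {F : Type*} [Field F] {g : Type*} [LieRing g] [LieAlgebra F g] [CharZero F]
  {B : LinearMap.BilinForm F g} {e x f : g} (G : MinimalGrading B e x f)
  {ι : Type*} {q : Module.Basis ι F g} {deg : ι → ℚ}
  (hq : ∀ i, q i ∈ (gr x (deg i) : Submodule F g))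
  {s : g} (hs : s ∈ (gr x 1 : Submodule F g)) (z : F)
  {J₀ J : Type*} [Fintype J₀] [Fintype J] {a a' : J₀ → g} {v v' : J → g}
  (ha : IsDualOn (fun y w => B y w) (gr x 0) a a')
  (hv : IsDualOn (fun y w => symplectic B f y w) (gr x (1 / 2)) v v')
include G

/-- Invariance of the Casimir element: transferring ad y to the other factor changes the sign,
exchanging the dual families does not, so the sum equals its negative. -/
theorem sum_lie_mul_eq_zero {I : Type*} [Fintype I] {p p' : I → g}
    (hp : IsDualOn (fun y w => B y w) ⊤ p p') (R : g →ₗ[F] (DiffPoly F ι)[X]) (y : g) :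
    ∑ i, R ⁅p i, y⁆ * R (p' i) = 0 := by
  have h1 := hp.sum_swap (ε := 1) (fun y w => by rw [one_mul]; exact G.symm y w)
    (mulBilin (R ∘ₗ (-(LieAlgebra.ad F g y : g →ₗ[F] g))) R)
  simp only [mulBilin_apply, LinearMap.comp_apply, LinearMap.neg_apply, LieAlgebra.ad_apply,
    lie_skew, one_smul] at h1
  have h2 : ∑ i, R ⁅p i, y⁆ * R (p' i) = -∑ i, R ⁅p' i, y⁆ * R (p i) := by
    have h3 : ∀ i, R ⁅p i, y⁆ * R (p' i) =
        ∑ j, R (p j) * (B (p i) ⁅y, p' j⁆ • R (p' i)) := fun i => by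
      rw [← hp.sum_left R (Submodule.mem_top (x := ⁅p i, y⁆)), Finset.sum_mul]
      refine Finset.sum_congr rfl fun j _ => ?_
      rw [G.inv, smul_mul_assoc, mul_smul_comm]
    simp_rw [h3]
    rw [Finset.sum_comm, ← Finset.sum_neg_distrib]
    refine Finset.sum_congr rfl fun j _ => ?_
    rw [← Finset.mul_sum, hp.sum_right R Submodule.mem_top, ← lie_skew, map_neg]
    ring
  rw [h1] at h2
  exact self_eq_neg.mp h2

/-- The terms [p_i, y]p^i cancel by invariance, the terms (p_i|y)(∂ + λ)p^i reassemble (∂ + λ)y, and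
the s-terms give z[y, s]. Subtracting λ{x_λ y} shifts the coefficient of λy to 1 - j and produces
the two scalar corrections. -/
theorem sugawaraDer_incl {I : Type*} [Fintype I] {p p' : I → g}
    (hp : IsDualOn (fun y w => B y w) ⊤ p p') {j : ℚ} {y : g}
    (hy : y ∈ (gr x j : Submodule F g)) :
    sugawaraDer B q deg f x s z p p' (incl q y) =
      C (del (rhoIncl B q deg f y)) + C (MvPolynomial.C (1 - j : F)) * (X * C (rhoIncl B q deg f y))
        + C (MvPolynomial.C z) * C (rhoIncl B q deg f ⁅y, s⁆)
        - C (MvPolynomial.C (z * j * B s y)) * X - C (MvPolynomial.C (B x y)) * X ^ 2 := by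
  have h1 := G.sum_lie_mul_eq_zero hp (constLin ∘ₗ rhoIncl B q deg f) y
  simp only [LinearMap.comp_apply, constLin_apply] at h1
  have h2 : ∑ i, B (p i) ⁅y, s⁆ • C (rhoIncl B q deg f (p' i)) = C (rhoIncl B q deg f ⁅y, s⁆) :=
    hp.sum_right (constLin ∘ₗ rhoIncl B q deg f) Submodule.mem_top
  have h3 : ∑ i, B (p i) y • lamDel (C (rhoIncl B q deg f (p' i))) =
      lamDel (C (rhoIncl B q deg f y)) :=
    hp.sum_right (lamDel ∘ₗ constLin ∘ₗ rhoIncl B q deg f) Submodule.mem_top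
  have h4 : ∑ i, applyOpLin (C (rhoIncl B q deg f (p' i)))
      (adDer B q deg f s z (p i) (incl q y)) =
        C (MvPolynomial.C z) * C (rhoIncl B q deg f ⁅y, s⁆)
          + (C (del (rhoIncl B q deg f y)) + X * C (rhoIncl B q deg f y)) := by
    rw [← lamDel_C, ← h3, ← h2, ← zero_add (C (MvPolynomial.C z) * _), ← h1, Finset.mul_sum,
      ← Finset.sum_add_distrib, ← Finset.sum_add_distrib]
    refine Finset.sum_congr rfl fun i _ => ?_
    have hb : B s ⁅p i, y⁆ = B (p i) ⁅y, s⁆ := by rw [G.symm, G.inv]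
    rw [adDer_incl, map_add, applyOpLin_C, applyOpLin_C_mul_X, hb,
      smul_eq_C_C_mul, smul_eq_C_C_mul, C_add, map_mul, C_mul]
    ring
  rw [sugawaraDer_apply, h4, adDer_incl, mem_gr.mp hy, map_smul, map_smul, smul_eq_mul,
    MvPolynomial.smul_eq_C_mul]
  simp only [map_add, map_sub, map_mul, map_one]
  ring

include hq ha

/-- On h ∈ W both e and g_{1/2} act by zero, which removes ½ ∑ v^k ∂v_k and half of every mixed
product. The rest matches the full Casimir element, since ρ(e) = (e|f) makes the partner of f reduce
to 1. -/
theorem rhoBracket_virL {h : DiffPoly F ι} (hv : IsDualOn (fun y w => symplectic B f y w)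
    (gr x (1 / 2)) v v') (hh : h ∈ W B q deg f x s z) :
    rhoBracket B q deg f s z (virL q f x a a' v v') h = sugawaraDer B q deg f x s z
      (casimirLeft e f a v v') (casimirRight B e f a' v v') h := by
  obtain ⟨hS, h1, h2⟩ := (G.mem_W_iff hq z).mp hh
  rw [G.rhoBracket_eq hq z _ hS, sugawaraDer_apply]
  set ε := evalDer h ∘ₗ adDerLin B q deg f s z with hε
  have hεy : ∀ y, adDer B q deg f s z y h = ε y := fun y => rfl
  have ε1 : ∀ y ∈ (gr x (1 / 2) : Submodule F g), ε y = 0 := h1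
  have ε2 : ε e = 0 := h2
  have e1 : ∑ j, applyOpLin (C (rhoIncl B q deg f (a j))) (ε (a' j)) =
      ∑ j, applyOpLin (C (rhoIncl B q deg f (a' j))) (ε (a j)) := by
    have := ha.sum_swap (ε := 1) (fun y w => by rw [one_mul]; exact G.symm y w)
      ((applyOpBilin.flip).compl₁₂ ε (constLin ∘ₗ rhoIncl B q deg f))
    rw [one_smul] at this
    exact this
  have hr : rhoIncl B q deg f ((B e f)⁻¹ • e) = 1 := by
    rw [map_smul, G.rhoIncl_of_mem_one hq G.e_mem, MvPolynomial.smul_eq_C_mul, ← map_mul,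
      G.symm f e, inv_mul_cancel₀ G.form_ef_ne, map_one]
  simp only [hεy, casimirLeft, casimirRight, Fintype.sum_sum_type, Sum.elim_inl, Sum.elim_inr,
    Finset.univ_unique, Finset.sum_singleton, hr, ε2, ε1 _ (hv.mem' _), map_zero, C_1,
    applyOpLin_one, Finset.sum_const_zero, add_zero, zero_add]
  rw [virL, map_add, map_add, map_add, map_add, map_smul, map_smul, map_sum, map_sum, map_sum,
    leftOpLin_incl, leftOpLin_del_incl]
  simp only [leftOpLin_incl_mul_incl, leftOpLin_incl_mul_del_incl, ε1 _ (hv.mem' _),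
    ε1 _ (hv.mem _), map_zero, add_zero, sub_zero, Finset.sum_const_zero, smul_zero, zero_add,
    Finset.sum_add_distrib]
  rw [e1, smul_eq_C_C_mul]
  linear_combination (∑ j, applyOpLin (C (rhoIncl B q deg f (a' j))) (ε (a j))) *
    two_mul_half (F := F) (ι := ι)

include hs hv

/-- The defects λ²x (from ∂x) and z[f, s] (from f) are both cancelled by the g_0 sum, and the
g_{1/2} sums produce only multiples of ∑ v^k v_k = 0. What survives is z(f|s)λ twice, from f and
from ∂x, and -(x|x)λ³ from ∂x. -/
theorem sugawaraDer_virL : sugawaraDer B q deg f x s z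
      (casimirLeft e f a v v') (casimirRight B e f a' v v') (virL q f x a a' v v') =
    C (del (virL q f x a a' v v')) + 2 * X * C (virL q f x a a' v v')
      + C (MvPolynomial.C (-B x x)) * X ^ 3 + C (MvPolynomial.C (2 * z * B f s)) * X := by
  have hp := G.isDualOn_top ha hv
  set D := sugawaraDer B q deg f x s z (casimirLeft e f a v v') (casimirRight B e f a' v v')
    with hD
  have hfs : ⁅f, s⁆ ∈ (gr x 0 : Submodule F g) := lie_mem_gr G.f_mem hs (by norm_num)
  -- values on the graded pieces
  have Df : D (incl q f) = C (del (incl q f)) + 2 * X * C (incl q f)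
      + C (MvPolynomial.C z) * inclC q ⁅f, s⁆ + C (MvPolynomial.C (z * B f s)) * X := by
    rw [hD, G.sugawaraDer_incl z hp G.f_mem, G.rhoIncl_eq_incl hq (by norm_num) G.f_mem,
      G.rhoIncl_eq_incl hq (by norm_num) hfs, G.form_eq_zero x_mem G.f_mem (by norm_num),
      G.symm s f, inclC_apply]
    simp only [Rat.cast_neg, Rat.cast_one, sub_neg_eq_add, one_add_one_eq_two, map_ofNat, mul_neg,
      mul_one, neg_mul, map_neg, map_zero]
    ring
  have D0 : ∀ b ∈ (gr x 0 : Submodule F g), D (incl q b) = C (del (incl q b)) + X * inclC q b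
      - C (MvPolynomial.C z) * C (MvPolynomial.C (B ⁅f, s⁆ b))
      - C (MvPolynomial.C (B x b)) * X ^ 2 := by
    intro b hb
    have h1 : B f ⁅b, s⁆ = -B ⁅f, s⁆ b := by rw [← lie_skew, map_neg, G.inv]
    rw [hD, G.sugawaraDer_incl z hp hb, G.rhoIncl_eq_incl hq (by norm_num) hb,
      G.rhoIncl_of_mem_one hq (lie_mem_gr hb hs (by norm_num)), h1, inclC_apply]
    simp only [Rat.cast_zero, sub_zero, map_one, mul_zero, zero_mul, map_zero, map_neg]
    ring
  have Dv : ∀ w ∈ (gr x (1 / 2) : Submodule F g), D (incl q w) = C (del (incl q w))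
      + C (MvPolynomial.C (1 / 2)) * (X * inclC q w) := by
    intro w hw
    rw [hD, G.sugawaraDer_incl z hp hw, G.rhoIncl_eq_incl hq le_rfl hw,
      G.eq_zero (lie_mem_gr hw hs rfl) (by norm_num), G.form_eq_zero hs hw (by norm_num),
      G.form_eq_zero x_mem hw (by norm_num), inclC_apply]
    simp only [map_zero, mul_zero, zero_mul, sub_zero, add_zero]
    norm_num
  have Du : ∀ u ∈ (gr x (-1 / 2) : Submodule F g), D (incl q u) = C (del (incl q u))
      + C (MvPolynomial.C (3 / 2)) * (X * inclC q u) + C (MvPolynomial.C z) * inclC q ⁅u, s⁆ := by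
    intro u hu
    rw [hD, G.sugawaraDer_incl z hp hu, G.rhoIncl_eq_incl hq (by norm_num) hu,
      G.rhoIncl_eq_incl hq le_rfl (lie_mem_gr hu hs (by norm_num)),
      G.form_eq_zero hs hu (by norm_num), G.form_eq_zero x_mem hu (by norm_num), inclC_apply,
      inclC_apply]
    simp only [map_zero, mul_zero, zero_mul, sub_zero]
    norm_num
  have hhalf := two_mul_half (F := F) (ι := ι)
  have hthree : C (MvPolynomial.C (3 / 2 : F)) = 1 + (C (MvPolynomial.C (1 / 2)) :
      (DiffPoly F ι)[X]) := by
    rw [← C_1, ← MvPolynomial.C_1, ← C_add, ← map_add]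
    norm_num
  have hDdel : ∀ P, D (del P) = lamDel (D P) := fun P => sugawaraDer_del ..
  have dx : D (del (incl q x)) = C (del (del (incl q x))) + 2 * X * C (del (incl q x))
      + X ^ 2 * inclC q x + C (MvPolynomial.C (z * B f s)) * X
      + C (MvPolynomial.C (-B x x)) * X ^ 3 := by
    have h1 : B ⁅f, s⁆ x = -B f s := by
      rw [G.inv, ← lie_skew, mem_gr.mp hs, map_neg]
      simp
    have h2 := lamDel_pow_scalar (F := F) (ι := ι) (-B f s) 1
    have h3 : lamDel (X ^ 2 : (DiffPoly F ι)[X]) = X ^ 3 := by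
      rw [← lamDel_pow_one, ← Module.End.mul_apply, ← pow_succ', lamDel_pow_one]
    rw [pow_one, pow_one] at h2
    rw [hDdel, D0 x x_mem, map_sub, map_sub, map_add, lamDel_C, lamDel_X_mul, lamDel_inclC,
      lamDel_scalar_mul, lamDel_scalar_mul, h1, h2, h3]
    simp only [map_neg, map_mul]
    ring
  have ea1 : ∑ j, B x (a' j) • inclC q (a j) = inclC q x := ha.sum_left _ x_mem
  have ea2 : ∑ j, B (a j) x • inclC q (a' j) = inclC q x := ha.sum_right _ x_mem
  have ea3 : ∑ j, B ⁅f, s⁆ (a' j) • inclC q (a j) = inclC q ⁅f, s⁆ := ha.sum_left _ hfs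
  have ea4 : ∑ j, B (a j) ⁅f, s⁆ • inclC q (a' j) = inclC q ⁅f, s⁆ := ha.sum_right _ hfs
  have da : ∑ j, D (incl q (a j) * incl q (a' j)) =
      ∑ j, C (del (incl q (a j) * incl q (a' j))) + 2 * X * ∑ j, C (incl q (a j) * incl q (a' j))
        - 2 * C (MvPolynomial.C z) * inclC q ⁅f, s⁆ - 2 * X ^ 2 * inclC q x := by
    have h1 : 2 * C (MvPolynomial.C z) * inclC q ⁅f, s⁆ =
        C (MvPolynomial.C z) * inclC q ⁅f, s⁆ + C (MvPolynomial.C z) * inclC q ⁅f, s⁆ := by ring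
    have h2 : 2 * X ^ 2 * inclC q x = X ^ 2 * inclC q x + X ^ 2 * inclC q x := by ring
    rw [h1, h2]
    nth_rw 1 [← ea3]
    rw [← ea4]
    nth_rw 1 [← ea1]
    rw [← ea2]
    simp only [Finset.mul_sum]
    simp only [← Finset.sum_add_distrib, ← Finset.sum_sub_distrib]
    refine Finset.sum_congr rfl fun j _ => ?_
    rw [Derivation.leibniz, Derivation.leibniz, D0 _ (ha.mem j), D0 _ (ha.mem' j), G.symm (a j) x,
      G.symm (a j) ⁅f, s⁆]
    simp only [smul_eq_C_mul, smul_eq_mul, smul_eq_C_C_mul, C_mul, C_add, inclC_apply]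
    ring
  have ev : ∑ k, inclC q (v' k) * inclC q (v k) = 0 := by
    have := hv.sum_swap (ε := -1) symplectic_skew (mulBilin (inclC q) (inclC q))
    simp only [mulBilin_apply, mul_comm (inclC q (v _)) (inclC q (v' _)), neg_one_smul] at this
    exact self_eq_neg.mp this
  have dv : ∑ k, D (incl q (v' k) * incl q ⁅f, v k⁆) =
      ∑ k, C (del (incl q (v' k) * incl q ⁅f, v k⁆))
        + 2 * X * ∑ k, C (incl q (v' k) * incl q ⁅f, v k⁆) := by
    -- For s = σe the bracket [[f, v_k], s] is -σ v_k, so the z-terms add up to a multiple of ∑ v^k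
    -- v_k.
    obtain ⟨σ, rfl⟩ := G.one s hs
    rw [← add_zero (∑ k, C (del _) + _), ← neg_zero, ← mul_zero (C (MvPolynomial.C (z * σ))), ← ev]
    simp only [Finset.mul_sum, ← Finset.sum_add_distrib, ← Finset.sum_neg_distrib]
    refine Finset.sum_congr rfl fun k _ => ?_
    rw [Derivation.leibniz, Derivation.leibniz, Dv _ (hv.mem' k), Du _ (G.lie_f_mem (hv.mem k)),
      lie_smul, ← lie_skew _ e, G.lie_e_lie_f (hv.mem k), map_smul, map_neg, hthree]
    simp only [smul_eq_C_mul, smul_eq_mul, smul_eq_C_C_mul, C_add, inclC_apply, map_mul]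
    linear_combination X * C (incl q (v' k)) * C (incl q ⁅f, v k⁆) * hhalf
  have dd : ∑ k, D (incl q (v' k) * del (incl q (v k))) =
      ∑ k, C (del (incl q (v' k) * del (incl q (v k))))
        + 2 * X * ∑ k, C (incl q (v' k) * del (incl q (v k))) := by
    -- The λ² terms add up to ½ ∑ v^k v_k, which is again zero.
    rw [← add_zero (∑ k, C (del _) + _), 
      ← mul_zero (C (MvPolynomial.C (1 / 2 : F)) * X ^ 2 : (DiffPoly F ι)[X]), ← ev]
    simp only [Finset.mul_sum, ← Finset.sum_add_distrib]
    refine Finset.sum_congr rfl fun k _ => ?_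
    rw [Derivation.leibniz, Derivation.leibniz, hDdel, Dv _ (hv.mem' k), Dv _ (hv.mem k), map_add,
      lamDel_C, lamDel_scalar_mul, lamDel_X_mul, lamDel_inclC]
    simp only [smul_eq_C_mul, smul_eq_mul, C_mul, C_add, inclC_apply]
    linear_combination X * C (incl q (v' k)) * C (del (incl q (v k))) * hhalf
  rw [virL]
  simp only [map_add, map_sum, Derivation.map_smul, da, dv, dd, Df, dx, ← smul_C]
  simp only [smul_eq_C_C_mul]
  simp only [map_mul, map_ofNat]
  linear_combination (-X ^ 2 * inclC q x - C (MvPolynomial.C z) * inclC q ⁅f, s⁆) * hhalf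

theorem virL_mem_W : virL q f x a a' v v' ∈ W B q deg f x s z := by
  have hsup : ∀ {j : ℚ} {y : g}, j ≤ 1 / 2 → y ∈ (gr x j : Submodule F g) →
      incl q y ∈ MvPolynomial.supported F {p : ι × ℕ | deg p.1 ≤ 1 / 2} :=
    fun hj hy => incl_mem_supported hq hj hy
  have hdel : ∀ {P : DiffPoly F ι}, P ∈ MvPolynomial.supported F {p : ι × ℕ | deg p.1 ≤ 1 / 2} →
      del P ∈ MvPolynomial.supported F {p : ι × ℕ | deg p.1 ≤ 1 / 2} :=
    fun hP => del_mem_supported (s := {i | deg i ≤ 1 / 2}) hP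
  refine (G.mem_W_iff hq z).mpr ⟨?_, fun w hw => G.adDer_half_virL hq hs z ha hv hw,
    G.adDer_e_virL hq hs z ha hv⟩
  refine add_mem (add_mem (add_mem (add_mem (hsup (by norm_num) G.f_mem)
    (hdel (hsup (by norm_num) x_mem))) (Subalgebra.smul_mem _ (sum_mem fun j _ =>
      mul_mem (hsup (by norm_num) (ha.mem j)) (hsup (by norm_num) (ha.mem' j))) _))
    (sum_mem fun k _ => mul_mem (hsup le_rfl (hv.mem' k))
      (hsup (by norm_num) (G.lie_f_mem (hv.mem k)))))
    (Subalgebra.smul_mem _ (sum_mem fun k _ =>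
      mul_mem (hsup le_rfl (hv.mem' k)) (hdel (hsup le_rfl (hv.mem k)))) _)

theorem isVirasoro_virL : IsVirasoro (rhoBracket B q deg f s z) (virL q f x a a' v v') :=
  ⟨-B x x, 2 * z * B f s, by
    rw [G.rhoBracket_virL hq z ha hv (G.virL_mem_W hq hs z ha hv),
      G.sugawaraDer_virL hq hs z ha hv]⟩

omit ha in
theorem phi_mem_W {b : g} (hb : b ∈ (grZeroCentralizer x f : Submodule F g)) :
    phi q v v' b ∈ W B q deg f x s z := by
  have hb0 : b ∈ (gr x 0 : Submodule F g) := hb.1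
  refine (G.mem_W_iff hq z).mpr ⟨?_, fun w hw => G.adDer_half_phi hq hs z hv hb hw,
    G.adDer_e_phi hq hs z hv hb⟩
  exact add_mem (incl_mem_supported hq (by norm_num) hb0) (Subalgebra.smul_mem _
    (sum_mem fun k _ => mul_mem
      (incl_mem_supported hq le_rfl (lie_mem_gr hb0 (hv.mem k) (by norm_num)))
      (incl_mem_supported hq le_rfl (hv.mem' k))) _)

omit ha in
theorem psi_mem_W {u : g} (hu : u ∈ (gr x (-1 / 2) : Submodule F g)) :
    psi q e v v' u ∈ W B q deg f x s z := by
  have hb : ∀ k, ⁅u, v k⁆ ∈ (gr x 0 : Submodule F g) := fun k =>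
    lie_mem_gr hu (hv.mem k) (by norm_num)
  refine (G.mem_W_iff hq z).mpr ⟨?_, fun w hw => G.adDer_half_psi hq hs z hv hu hw,
    G.adDer_e_psi hq hs z hv hu⟩
  refine add_mem (add_mem (add_mem (incl_mem_supported hq (by norm_num) hu)
    (Subalgebra.smul_mem _ (sum_mem fun h _ => sum_mem fun k _ => mul_mem (mul_mem
      (incl_mem_supported hq le_rfl (lie_mem_gr (hb h) (hv.mem k) (by norm_num)))
      (incl_mem_supported hq le_rfl (hv.mem' h))) (incl_mem_supported hq le_rfl (hv.mem' k))) _))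
    (sum_mem fun k _ => mul_mem (incl_mem_supported hq (by norm_num) (hb k))
      (incl_mem_supported hq le_rfl (hv.mem' k))))
    (del_mem_supported (s := {i | deg i ≤ 1 / 2}) (incl_mem_supported hq le_rfl (G.lie_e_mem hu)))

end MinimalGrading

/-! ### Triangular changes of variables -/

section Triangular

variable {F : Type*} [Field F] {σ τ : Type*} {y N : σ → MvPolynomial τ F}

theorem adjoin_image_eq_map_supported (y : σ → MvPolynomial τ F) (s : Set σ) :
    Algebra.adjoin F (y '' s) = (MvPolynomial.supported F s).map (MvPolynomial.aeval y) := by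
  rw [MvPolynomial.supported_eq_adjoin_X, AlgHom.map_adjoin, Set.image_image]
  simp

theorem aeval_eq_of_mem_supported {s : Set σ} {y y' : σ → MvPolynomial τ F} (h : ∀ i ∈ s, y i = y' i)
    {p : MvPolynomial σ F} (hp : p ∈ MvPolynomial.supported F s) :
    MvPolynomial.aeval y p = MvPolynomial.aeval y' p := by
  refine AlgHom.eqOn_adjoin_iff.mpr ?_ hp
  rintro _ ⟨i, hi, rfl⟩
  simpa using h i hi

/-- Well-founded recursion along the level. The default 0 at indices of level not below that of i is
never read when Φ i depends on lower levels only. -/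
theorem exists_eq_of_lt {α β : Type*} [Zero β] (lev : α → ℕ) (Φ : α → (α → β) → β) :
    ∃ Θ : α → β, ∀ i, Θ i = Φ i fun j => if lev j < lev i then Θ j else 0 :=
  ⟨(measure lev).wf.fix fun i rec => Φ i fun j => if h : lev j < lev i then rec j h else 0,
    fun i => by
      rw [WellFounded.fix_eq]
      congr 1⟩

/-- A left inverse is found by solving the triangular system Θ_i = X_i - M_i(Θ) level by level. -/
theorem aeval_X_add_injective (lev : σ → ℕ) {M : σ → MvPolynomial σ F}
    (hM : ∀ i, M i ∈ MvPolynomial.supported F {j | lev j < lev i}) :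
    Function.Injective (MvPolynomial.aeval (R := F) fun i => MvPolynomial.X i + M i) := by
  obtain ⟨Θ, hΘ⟩ := exists_eq_of_lt lev fun i (Θ : σ → MvPolynomial σ F) =>
    MvPolynomial.X i - MvPolynomial.aeval Θ (M i)
  refine Function.LeftInverse.injective (g := MvPolynomial.aeval Θ) fun p => ?_
  induction p using MvPolynomial.induction_on with
  | C c => simp
  | add p r hp hr => rw [map_add, map_add, hp, hr]
  | mul_X p i hp =>
    rw [map_mul, map_mul, hp, MvPolynomial.aeval_X, map_add, MvPolynomial.aeval_X]
    have h : MvPolynomial.aeval Θ (M i) =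
        MvPolynomial.aeval (fun j => if lev j < lev i then Θ j else 0) (M i) := by
      refine aeval_eq_of_mem_supported (fun j hj => ?_) (hM i)
      have hj' : lev j < lev i := hj
      rw [if_pos hj']
    rw [h, hΘ i, sub_add_cancel]

/-- Evaluation at the new family is a triangular, hence injective, substitution followed by
evaluation at y. -/
theorem algebraicIndependent_add (lev : σ → ℕ) (hy : AlgebraicIndependent F y)
    (hN : ∀ i, N i ∈ Algebra.adjoin F (y '' {j | lev j < lev i})) :
    AlgebraicIndependent F fun i => y i + N i := by
  have h1 : ∀ i, ∃ p ∈ MvPolynomial.supported F {j | lev j < lev i},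
      MvPolynomial.aeval y p = N i := fun i => by
    have := hN i
    rw [adjoin_image_eq_map_supported] at this
    exact this
  choose M hM hMN using h1
  have h2 : (MvPolynomial.aeval (R := F) fun i => y i + N i) = (MvPolynomial.aeval y).comp
      (MvPolynomial.aeval (R := F) fun i => MvPolynomial.X i + M i) := by
    refine MvPolynomial.algHom_ext fun i => ?_
    rw [AlgHom.comp_apply, MvPolynomial.aeval_X, MvPolynomial.aeval_X, map_add,
      MvPolynomial.aeval_X, hMN]
  rw [AlgebraicIndependent, h2, AlgHom.coe_comp]
  exact Function.Injective.comp hy (aeval_X_add_injective lev hM)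

theorem adjoin_range_add (lev : σ → ℕ)
    (hN : ∀ i, N i ∈ Algebra.adjoin F (y '' {j | lev j < lev i})) :
    Algebra.adjoin F (Set.range fun i => y i + N i) = Algebra.adjoin F (Set.range y) := by
  refine le_antisymm (Algebra.adjoin_le ?_) (Algebra.adjoin_le ?_)
  · rintro _ ⟨i, rfl⟩
    exact add_mem (Algebra.subset_adjoin ⟨i, rfl⟩)
      (Algebra.adjoin_mono (Set.image_subset_range _ _) (hN i))
  · have key : ∀ n, ∀ i, lev i < n → y i ∈ Algebra.adjoin F (Set.range fun i => y i + N i) := by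
      intro n
      induction n with
      | zero => intro i hi; omega
      | succ n ih =>
        intro i hi
        have h1 : N i ∈ Algebra.adjoin F (Set.range fun i => y i + N i) := by
          refine (Algebra.adjoin_le ?_ : _ ≤ Algebra.adjoin F _) (hN i)
          rintro _ ⟨j, hj, rfl⟩
          have hj' : lev j < lev i := hj
          exact ih j (by omega)
        have h2 : y i + N i ∈ Algebra.adjoin F (Set.range fun i => y i + N i) :=
          Algebra.subset_adjoin ⟨i, rfl⟩
        simpa using sub_mem h2 h1
    rintro _ ⟨i, rfl⟩
    exact key _ i (Nat.lt_succ_self _)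

theorem algebraicIndependent_of_sub_mem {t : σ → MvPolynomial τ F} (lev : σ → ℕ) (hy : AlgebraicIndependent F y)
    (ht : ∀ i, t i - y i ∈ Algebra.adjoin F (y '' {j | lev j < lev i})) :
    AlgebraicIndependent F t := by
  simpa only [add_sub_cancel] using algebraicIndependent_add lev hy ht

theorem adjoin_range_of_sub_mem {t : σ → MvPolynomial τ F} (lev : σ → ℕ)
    (ht : ∀ i, t i - y i ∈ Algebra.adjoin F (y '' {j | lev j < lev i})) :
    Algebra.adjoin F (Set.range t) = Algebra.adjoin F (Set.range y) := by
  simpa only [add_sub_cancel] using adjoin_range_add lev ht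

end Triangular

/-! ### Derivations and algebraically independent families -/

section Derivations

variable {F : Type*} [Field F] {σ A M : Type*} [CommRing A] [Algebra F A] [AddCommGroup M]
  [Module F M] [Module A M] [IsScalarTower F A M]

/-- Differentiating a monomial that contains X_i multiplies its coefficient by a positive exponent,
which is non-zero in characteristic zero. -/
theorem notMem_vars_of_pderiv_eq_zero [CharZero F] {p : MvPolynomial σ F} {i : σ}
    (h : MvPolynomial.pderiv i p = 0) : i ∉ p.vars := by
  intro hi
  rw [MvPolynomial.mem_vars_iff_mem_support] at hi
  obtain ⟨d, hd, hid⟩ := hi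
  have h1 : d - Finsupp.single i 1 + Finsupp.single i 1 = d := by
    refine tsub_add_cancel_of_le ?_
    rw [Finsupp.single_le_iff]
    exact Nat.one_le_iff_ne_zero.mpr (Finsupp.mem_support_iff.mp hid)
  have h2 := MvPolynomial.coeff_pderiv (i := i) p (d - Finsupp.single i 1)
  rw [h, h1, MvPolynomial.coeff_zero] at h2
  rcases mul_eq_zero.mp h2.symm with h3 | h3
  · exact MvPolynomial.mem_support_iff.mp hd h3
  · exact absurd h3 (Nat.cast_add_one_ne_zero _)

theorem derivation_aeval (D : Derivation F A M) (t : σ → A) {S : Finset σ}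
    {p : MvPolynomial σ F} (hp : p.vars ⊆ S) : D (MvPolynomial.aeval t p) =
      ∑ i ∈ S, MvPolynomial.aeval t (MvPolynomial.pderiv i p) • D (t i) := by
  classical
  have hp' : p ∈ MvPolynomial.supported F (S : Set σ) :=
    MvPolynomial.mem_supported.mpr (by exact_mod_cast hp)
  clear hp
  induction hp' using Algebra.adjoin_induction with
  | mem p hp =>
    obtain ⟨i, hi, rfl⟩ := hp
    have hi' : i ∈ S := hi
    simp [MvPolynomial.pderiv_X, Pi.single_apply, apply_ite (MvPolynomial.aeval (R := F) t), hi']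
  | algebraMap c => simp [MvPolynomial.algebraMap_eq]
  | add p r _ _ h₁ h₂ => simp only [map_add, h₁, h₂, add_smul, Finset.sum_add_distrib]
  | mul p r _ _ h₁ h₂ =>
    simp only [map_mul, Derivation.leibniz, h₁, h₂, smul_eq_mul, map_add, add_smul,
      Finset.sum_add_distrib, Finset.smul_sum, mul_smul]

/-- If a derivation acts on the variables `t (γ₀, n)` by a multiple of `λ^n` and kills all the other
variables occurring in `p`, then `p` in its kernel does not involve the former. -/
theorem pderiv_eq_zero_of_derivation {Γ ι : Type*} {t : Γ × ℕ → DiffPoly F ι}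
    (ht : AlgebraicIndependent F t) (D : Derivation F (DiffPoly F ι) (DiffPoly F ι)[X]) {γ₀ : Γ}
    {κ : F} (hκ : κ ≠ 0) (hD : ∀ n, D (t (γ₀, n)) = C (MvPolynomial.C κ) * X ^ n)
    {p : DiffPoly F Γ} (hD' : ∀ γ n, γ ≠ γ₀ → D (t (γ, n)) = 0 ∨ MvPolynomial.pderiv (γ, n) p = 0)
    (hp : D (MvPolynomial.aeval t p) = 0) (n : ℕ) : MvPolynomial.pderiv (γ₀, n) p = 0 := by
  by_contra hne
  have hmem : (γ₀, n) ∈ p.vars := by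
    by_contra h
    exact hne (MvPolynomial.pderiv_eq_zero_of_notMem_vars h)
  rw [derivation_aeval D t subset_rfl] at hp
  -- The coefficient of λ^n isolates t (γ₀, n): every other t (γ₀, m) contributes in degree m, and
  -- the remaining summands are zero.
  have h1 := congrArg (fun P => P.coeff n) hp
  simp only [finsetSum_coeff, smul_eq_C_mul, coeff_C_mul, coeff_zero] at h1
  rw [Finset.sum_eq_single_of_mem _ hmem] at h1
  · rw [hD, coeff_C_mul, coeff_X_pow, if_pos rfl, mul_one] at h1
    rcases mul_eq_zero.mp h1 with h | h
    · exact hne (ht (by rw [h, map_zero]))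
    · exact hκ (by simpa using h)
  · rintro ⟨γ, m⟩ _ hm
    by_cases hγ : γ = γ₀
    · subst hγ
      have : n ≠ m := fun h => hm (by rw [h])
      rw [hD, coeff_C_mul, coeff_X_pow, if_neg this, mul_zero, mul_zero]
    · rcases hD' γ m hγ with h | h
      · rw [h, coeff_zero, mul_zero]
      · rw [h, map_zero, zero_mul]

end Derivations

/-! ### Weights -/

section Weights

variable {F : Type*} [Field F] {σ τ : Type*}

open MvPolynomial in
-- A non-zero monomial has a single weight, so the weight supplied by `h` must be that of p. Leaving
-- it existential allows `h` to be proved by induction on monomials.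
theorem isWeightedHomogeneous_map_of_monomial {w : σ → ℚ} {w' : τ → ℚ} {δ : ℚ}
    (θ : MvPolynomial σ F →ₗ[F] MvPolynomial τ F)
    (h : ∀ s c, ∃ Δ, IsWeightedHomogeneous w (monomial s c) Δ ∧
      IsWeightedHomogeneous w' (θ (monomial s c)) (Δ + δ)) {p : MvPolynomial σ F} {Δ : ℚ}
    (hp : IsWeightedHomogeneous w p Δ) : IsWeightedHomogeneous w' (θ p) (Δ + δ) := by
  rw [p.as_sum, map_sum]
  refine IsWeightedHomogeneous.sum _ _ _ fun s hs => ?_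
  obtain ⟨Δ', h1, h2⟩ := h s (coeff s p)
  have hs' : coeff s p ≠ 0 := mem_support_iff.mp hs
  have h3 : Finsupp.weight w s = Δ := hp hs'
  have h4 : IsWeightedHomogeneous w (monomial s (coeff s p)) Δ :=
    isWeightedHomogeneous_monomial w s _ h3
  have h5 : monomial s (coeff s p) ≠ 0 := by simpa using hs'
  rwa [← IsWeightedHomogeneous.inj_right h5 h1 h4]

open MvPolynomial in
theorem isWeightedHomogeneous_del {ι : Type*} {w : ι × ℕ → ℚ} (hw : ∀ i n, w (i, n + 1) = w (i, n) + 1)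
    {P : DiffPoly F ι} {Δ : ℚ} (hP : IsWeightedHomogeneous w P Δ) :
    IsWeightedHomogeneous w (del P) (Δ + 1) := by
  refine isWeightedHomogeneous_map_of_monomial (del (F := F) (ι := ι)).toLinearMap
    (fun s c => ?_) hP
  refine induction_on_monomial (motive := fun p => ∃ Δ, IsWeightedHomogeneous w p Δ ∧
    IsWeightedHomogeneous w ((del (F := F) (ι := ι)).toLinearMap p) (Δ + 1)) ?_ ?_ s c
  · exact fun c => ⟨0, isWeightedHomogeneous_C w c, by
      simpa using isWeightedHomogeneous_zero F w (0 + 1)⟩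
  · intro p n h
    obtain ⟨Δ', h1, h2⟩ := h
    have hX := isWeightedHomogeneous_X F w n
    refine ⟨Δ' + w n, h1.mul hX, ?_⟩
    have hX' : IsWeightedHomogeneous w (X (n.1, n.2 + 1) : DiffPoly F ι) (w n + 1) := by
      rw [← hw]
      exact isWeightedHomogeneous_X F w (n.1, n.2 + 1)
    have e1 : (del (F := F) (ι := ι)).toLinearMap (p * X n) =
        p * X (n.1, n.2 + 1) + X n * (del (F := F) (ι := ι)).toLinearMap p := by
      change del (p * X n) = _
      rw [Derivation.leibniz, smul_eq_mul, smul_eq_mul, ← del_X]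
      rfl
    rw [e1]
    refine IsWeightedHomogeneous.add ?_ ?_
    · convert h1.mul hX' using 1
      ring
    · convert hX.mul h2 using 1
      ring

open MvPolynomial in
theorem weightedHomogeneousComponent_aeval {w : σ → ℚ} {w' : τ → ℚ} {t : σ → MvPolynomial τ F}
    (ht : ∀ i, IsWeightedHomogeneous w' (t i) (w i)) (Δ : ℚ) (p : MvPolynomial σ F) :
    weightedHomogeneousComponent w' Δ (aeval t p) =
      aeval t (weightedHomogeneousComponent w Δ p) := by
  induction p using MvPolynomial.induction_on' with
  | add p q hp hq => simp only [map_add, hp, hq]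
  | monomial s c =>
    have h : ∃ Δ', IsWeightedHomogeneous w (monomial s c) Δ' ∧
        IsWeightedHomogeneous w' (aeval t (monomial s c)) Δ' := by
      refine induction_on_monomial (motive := fun p => ∃ Δ', IsWeightedHomogeneous w p Δ' ∧
        IsWeightedHomogeneous w' (aeval t p) Δ') ?_ ?_ s c
      · exact fun c => ⟨0, isWeightedHomogeneous_C w c, by
          rw [algHom_C]; exact isWeightedHomogeneous_C w' c⟩
      · intro p n h
        obtain ⟨Δ', h1, h2⟩ := h
        refine ⟨Δ' + w n, h1.mul (isWeightedHomogeneous_X F w n), ?_⟩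
        rw [map_mul, MvPolynomial.aeval_X]
        exact h2.mul (ht n)
    obtain ⟨Δ', h1, h2⟩ := h
    by_cases hΔ : Δ' = Δ
    · subst hΔ
      rw [h1.weightedHomogeneousComponent_same, h2.weightedHomogeneousComponent_same]
    · rw [h1.weightedHomogeneousComponent_ne _ (Ne.symm hΔ),
        h2.weightedHomogeneousComponent_ne _ (Ne.symm hΔ),
        map_zero]

/-- Two factors would already have weight at least 2. -/
theorem eq_single_of_weight_lt_two {w : σ → ℚ} {s : σ →₀ ℕ} (hw : ∀ i ∈ s.support, 1 ≤ w i)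
    (h0 : Finsupp.weight w s ≠ 0) (h2 : Finsupp.weight w s < 2) :
    ∃ i ∈ s.support, s = Finsupp.single i 1 ∧ w i = Finsupp.weight w s := by
  have hs : s ≠ 0 := by rintro rfl; simp at h0
  obtain ⟨i, hi⟩ := Finsupp.support_nonempty_iff.mpr hs
  have hsplit : ∀ {r : σ →₀ ℕ} {j : σ}, j ∈ r.support →
      r = (r - Finsupp.single j 1) + Finsupp.single j 1 := fun {r j} hj => by
    refine (tsub_add_cancel_of_le ?_).symm
    rw [Finsupp.single_le_iff]
    exact Nat.one_le_iff_ne_zero.mpr (Finsupp.mem_support_iff.mp hj)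
  have hsub : ∀ {r : σ →₀ ℕ} {j k : σ}, k ∈ (r - Finsupp.single j 1).support → k ∈ r.support :=
    fun {r j k} hk => Finsupp.support_tsub hk
  have hnn : ∀ r : σ →₀ ℕ, (∀ k ∈ r.support, k ∈ s.support) → 0 ≤ Finsupp.weight w r := by
    intro r hr
    rw [Finsupp.weight_apply]
    exact Finset.sum_nonneg fun k hk =>
      nsmul_nonneg (zero_le_one.trans (hw k (hr k hk))) _
  have hwt : Finsupp.weight w s = Finsupp.weight w (s - Finsupp.single i 1) + w i := by
    conv_lhs => rw [hsplit hi]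
    rw [map_add, Finsupp.weight_single, one_smul]
  have hrest : s - Finsupp.single i 1 = 0 := by
    by_contra hne
    obtain ⟨k, hk⟩ := Finsupp.support_nonempty_iff.mpr hne
    have h3 : Finsupp.weight w (s - Finsupp.single i 1) =
        Finsupp.weight w (s - Finsupp.single i 1 - Finsupp.single k 1) + w k := by
      conv_lhs => rw [hsplit hk]
      rw [map_add, Finsupp.weight_single, one_smul]
    have h4 := hnn (s - Finsupp.single i 1 - Finsupp.single k 1) fun m hm => hsub (hsub hm)
    have h5 := hw i hi
    have h6 := hw k (hsub hk)
    linarith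
  refine ⟨i, hi, ?_, ?_⟩
  · conv_lhs => rw [hsplit hi, hrest, zero_add]
  · rw [hwt, hrest, map_zero, zero_add]

end Weights

/-! ### Linear changes of variables -/

section LinearChange

variable {F : Type*} [Field F] {g : Type*} [LieRing g] [LieAlgebra F g] {ι : Type*}
  (q : Module.Basis ι F g)

/-- The map `y ↦ y^{(n)}`. -/
def inclIter (n : ℕ) : g →ₗ[F] DiffPoly F ι := q.constr F fun i => MvPolynomial.X (i, n)

theorem iterate_del_incl (y : g) (n : ℕ) : (del^[n]) (incl q y) = inclIter q n y := by
  induction n with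
  | zero => rfl
  | succ n ih =>
    rw [Function.iterate_succ_apply', ih]
    have : del.toLinearMap ∘ₗ inclIter q n = inclIter q (n + 1) := q.ext fun i => by
      simp [inclIter, Module.Basis.constr_basis, del_X]
    exact LinearMap.congr_fun this y

/-- A linear left inverse of the map attached to b, applied at every order of derivative, extends to
an algebra map that retracts the evaluation. -/
theorem algebraicIndependent_iterate_del_incl {Γ : Type*} {b : Γ → g}
    (hb : LinearIndependent F b) :
    AlgebraicIndependent F fun p : Γ × ℕ => (del^[p.2]) (incl q (b p.1)) := by
  obtain ⟨l, hl⟩ := LinearMap.exists_leftInverse_of_injective (Finsupp.linearCombination F b)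
    (LinearMap.ker_eq_bot.mpr hb)
  have hlb : ∀ γ, l (b γ) = Finsupp.single γ 1 := fun γ => by
    have := LinearMap.congr_fun hl (Finsupp.single γ 1)
    simpa using this
  let m : ℕ → (Γ →₀ F) →ₗ[F] DiffPoly F Γ := fun n =>
    Finsupp.linearCombination F fun γ => MvPolynomial.X (γ, n)
  let Φ : DiffPoly F ι →ₐ[F] DiffPoly F Γ :=
    MvPolynomial.aeval fun p : ι × ℕ => m p.2 (l (q p.1))
  have hΦ : ∀ n y, Φ (inclIter q n y) = m n (l y) := by
    intro n y
    have : Φ.toLinearMap ∘ₗ inclIter q n = m n ∘ₗ l := q.ext fun i => by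
      simp [inclIter, Module.Basis.constr_basis, Φ]
    exact LinearMap.congr_fun this y
  have hinv : Φ.comp (MvPolynomial.aeval fun p : Γ × ℕ => (del^[p.2]) (incl q (b p.1))) =
      AlgHom.id F _ := by
    refine MvPolynomial.algHom_ext fun p => ?_
    rw [AlgHom.comp_apply, MvPolynomial.aeval_X, iterate_del_incl, hΦ, hlb]
    simp [m]
  exact Function.LeftInverse.injective (g := Φ) fun p => AlgHom.congr_fun hinv p

theorem adjoin_iterate_del_incl {Γ : Type*} {b : Γ → g} {s : Set ι}
    (h₁ : ∀ γ, b γ ∈ Submodule.span F (q '' s)) (h₂ : ∀ i ∈ s, q i ∈ Submodule.span F (Set.range b)) :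
    Algebra.adjoin F (Set.range fun p : Γ × ℕ => (del^[p.2]) (incl q (b p.1))) =
      MvPolynomial.supported F {p : ι × ℕ | p.1 ∈ s} := by
  refine le_antisymm (Algebra.adjoin_le ?_) (Algebra.adjoin_le ?_)
  · rintro _ ⟨⟨γ, n⟩, rfl⟩
    have h : Submodule.span F (q '' s) ≤ (Subalgebra.toSubmodule
        (MvPolynomial.supported F {p : ι × ℕ | p.1 ∈ s})).comap (inclIter q n) := by
      rw [Submodule.span_le]
      rintro _ ⟨i, hi, rfl⟩
      rw [SetLike.mem_coe, Submodule.mem_comap, Subalgebra.mem_toSubmodule, inclIter, Module.Basis.constr_basis]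
      exact Algebra.subset_adjoin ⟨(i, n), hi, rfl⟩
    change (del^[n]) (incl q (b γ)) ∈ _
    rw [iterate_del_incl]
    exact h (h₁ γ)
  · rintro _ ⟨⟨i, n⟩, hi, rfl⟩
    have h : Submodule.span F (Set.range b) ≤ (Subalgebra.toSubmodule (Algebra.adjoin F
        (Set.range fun p : Γ × ℕ => (del^[p.2]) (incl q (b p.1))))).comap (inclIter q n) := by
      rw [Submodule.span_le]
      rintro _ ⟨γ, rfl⟩
      rw [SetLike.mem_coe, Submodule.mem_comap, Subalgebra.mem_toSubmodule, ← iterate_del_incl]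
      exact Algebra.subset_adjoin ⟨(γ, n), rfl⟩
    have := h (h₂ i hi)
    rw [Submodule.mem_comap, inclIter, Module.Basis.constr_basis] at this
    exact this

end LinearChange

/-! ### Generators of `V(g_{≤1/2})` adapted to the W-algebra -/

section Generators

variable {F : Type*} [Field F] {g : Type*} [LieRing g] [LieAlgebra F g] {ι : Type*}

theorem mem_span_coe_basis {U : Submodule F g} {I : Type*} (b : Module.Basis I F U) {y : g}
    (hy : y ∈ U) : y ∈ Submodule.span F (Set.range fun i => (b i : g)) := by
  have h := Submodule.mem_map_of_mem (f := U.subtype) (b.mem_span ⟨y, hy⟩)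
  rw [Submodule.map_span, ← Set.range_comp] at h
  exact h

theorem span_range_le_of_mem {I : Type*} {w : I → g} {U : Submodule F g} (h : ∀ i, w i ∈ U) :
    Submodule.span F (Set.range w) ≤ U := by
  rw [Submodule.span_le]
  rintro _ ⟨i, rfl⟩
  exact h i

theorem linearIndependent_coe_basis {U : Submodule F g} {I : Type*} (b : Module.Basis I F U) :
    LinearIndependent F fun i => (b i : g) :=
  b.linearIndependent.map' U.subtype U.ker_subtype

theorem disjoint_gr [CharZero F] (x : g) {i j : ℚ} (hij : i ≠ j) :
    Disjoint (gr x i : Submodule F g) (gr x j) := by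
  rw [Submodule.disjoint_def]
  intro y hi hj
  rw [mem_gr] at hi hj
  have h : ((i - j : ℚ) : F) • y = 0 := by
    rw [Rat.cast_sub, sub_smul, ← hi, ← hj, sub_self]
  exact (smul_eq_zero.mp h).resolve_left (by exact_mod_cast sub_ne_zero.mpr hij)

theorem del_mem_adjoin_iterate {Γ : Type*} (w : Γ → DiffPoly F ι) (t : Set Γ) {P : DiffPoly F ι}
    (hP : P ∈ Algebra.adjoin F ((fun p : Γ × ℕ => (del^[p.2]) (w p.1)) '' {p | p.1 ∈ t})) :
    del P ∈ Algebra.adjoin F ((fun p : Γ × ℕ => (del^[p.2]) (w p.1)) '' {p | p.1 ∈ t}) := by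
  induction hP using Algebra.adjoin_induction with
  | mem P hP =>
    obtain ⟨⟨γ, n⟩, hγ, rfl⟩ := hP
    exact Algebra.subset_adjoin ⟨(γ, n + 1), hγ, Function.iterate_succ_apply' _ _ _⟩
  | algebraMap c => simp
  | add P Q _ _ hp hq => rw [map_add]; exact add_mem hp hq
  | mul P Q hP hQ hp hq =>
    rw [Derivation.leibniz]
    exact add_mem (mul_mem hP hq) (mul_mem hQ hp)

theorem incl_mem_adjoin_iterate (q : Module.Basis ι F g) {Γ : Type*} (b : Γ → g) (t : Set Γ)
    {y : g} (hy : y ∈ Submodule.span F (b '' t)) : incl q y ∈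
      Algebra.adjoin F ((fun p : Γ × ℕ => (del^[p.2]) (incl q (b p.1))) '' {p | p.1 ∈ t}) := by
  have h : Submodule.span F (b '' t) ≤ (Subalgebra.toSubmodule (Algebra.adjoin F
      ((fun p : Γ × ℕ => (del^[p.2]) (incl q (b p.1))) '' {p | p.1 ∈ t}))).comap (incl q) := by
    rw [Submodule.span_le]
    rintro _ ⟨γ, hγ, rfl⟩
    exact Algebra.subset_adjoin ⟨(γ, 0), hγ, rfl⟩
  exact h hy

/-- The level disregards the order of derivatives, so the subalgebra of lower level is stable under
∂ and the triangular relation can be differentiated. -/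
theorem iterate_del_sub_mem_adjoin {Γ : Type*} (lev : Γ → ℕ) {w w' : Γ → DiffPoly F ι}
    (h : ∀ γ, w γ - w' γ ∈ Algebra.adjoin F
      ((fun p : Γ × ℕ => (del^[p.2]) (w' p.1)) '' {p | p.1 ∈ {γ' | lev γ' < lev γ}}))
    (p : Γ × ℕ) : (del^[p.2]) (w p.1) - (del^[p.2]) (w' p.1) ∈ Algebra.adjoin F
      ((fun p : Γ × ℕ => (del^[p.2]) (w' p.1)) '' {p' | lev p'.1 < lev p.1}) := by
  obtain ⟨γ, n⟩ := p
  induction n with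
  | zero => exact h γ
  | succ n ih =>
    have := del_mem_adjoin_iterate w' {γ' | lev γ' < lev γ} ih
    rw [map_sub] at this
    rw [Function.iterate_succ_apply', Function.iterate_succ_apply']
    exact this

theorem algebraicIndependent_iterate_del_of_sub_mem (q : Module.Basis ι F g) {Γ : Type*}
    (lev : Γ → ℕ) {b : Γ → g} (hb : LinearIndependent F b) {w : Γ → DiffPoly F ι}
    (h : ∀ γ, w γ - incl q (b γ) ∈ Algebra.adjoin F
      ((fun p : Γ × ℕ => (del^[p.2]) (incl q (b p.1))) '' {p | p.1 ∈ {γ' | lev γ' < lev γ}})) :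
    AlgebraicIndependent F fun p : Γ × ℕ => (del^[p.2]) (w p.1) :=
  algebraicIndependent_of_sub_mem (fun p => lev p.1)
    (algebraicIndependent_iterate_del_incl q hb) (iterate_del_sub_mem_adjoin lev (w' := fun γ => incl q (b γ)) h)

theorem adjoin_iterate_del_of_sub_mem (q : Module.Basis ι F g) {Γ : Type*}
    (lev : Γ → ℕ) {b : Γ → g} {w : Γ → DiffPoly F ι}
    (h : ∀ γ, w γ - incl q (b γ) ∈ Algebra.adjoin F
      ((fun p : Γ × ℕ => (del^[p.2]) (incl q (b p.1))) '' {p | p.1 ∈ {γ' | lev γ' < lev γ}})) :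
    Algebra.adjoin F (Set.range fun p : Γ × ℕ => (del^[p.2]) (w p.1)) =
      Algebra.adjoin F (Set.range fun p : Γ × ℕ => (del^[p.2]) (incl q (b p.1))) :=
  adjoin_range_of_sub_mem (fun p : Γ × ℕ => lev p.1) (iterate_del_sub_mem_adjoin lev (w' := fun γ => incl q (b γ)) h)

variable {K₀ K J : Type*}

/-- The index set of the generators: `L`, `φ(c_i)`, `ψ(u_j)` on the left, and `x`, `v_k` on the
right. -/
abbrev GenIndex (K₀ K J : Type*) : Type _ := (Unit ⊕ K₀ ⊕ K) ⊕ (Unit ⊕ J)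

/-- The linear parts of the generators. -/
def genVec (x f : g) (c : K₀ → g) (u : K → g) (v : J → g) : GenIndex K₀ K J → g :=
  Sum.elim (Sum.elim (fun _ => f) (Sum.elim c u)) (Sum.elim (fun _ => x) v)

/-- The generators of the W-algebra together with `x` and the `v_k`. -/
def generator (q : Module.Basis ι F g) (x : g) (v : J → g) (L : DiffPoly F ι)
    (C₀ : K₀ → DiffPoly F ι) (U : K → DiffPoly F ι) : GenIndex K₀ K J → DiffPoly F ι :=
  Sum.elim (Sum.elim (fun _ => L) (Sum.elim C₀ U)) (Sum.elim (fun _ => incl q x) fun k => incl q (v k))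

/-- The level of a generator: its non-linear part involves only generators of lower level. -/
def genLevel : GenIndex K₀ K J → ℕ :=
  Sum.elim (Sum.elim (fun _ => 3) (Sum.elim (fun _ => 1) fun _ => 2)) fun _ => 0

theorem incl_mem_adjoin_genVec (q : Module.Basis ι F g) (b : GenIndex K₀ K J → g) {m n : ℕ}
    (hmn : m ≤ n) (y : g) (hy : y ∈ Submodule.span F (b '' {γ | genLevel γ < m})) : incl q y ∈
      Algebra.adjoin F ((fun p : GenIndex K₀ K J × ℕ => (del^[p.2]) (incl q (b p.1))) ''
        {p | p.1 ∈ {γ' | genLevel γ' < n}}) := by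
  refine incl_mem_adjoin_iterate q _ _ (Submodule.span_mono (Set.image_mono ?_) hy)
  intro γ hγ
  rw [Set.mem_ofPred_eq] at hγ ⊢
  exact hγ.trans_le hmn

theorem del_mem_adjoin_genVec (q : Module.Basis ι F g) (b : GenIndex K₀ K J → g) (n : ℕ)
    (P : DiffPoly F ι) (hP : P ∈ Algebra.adjoin F
      ((fun p : GenIndex K₀ K J × ℕ => (del^[p.2]) (incl q (b p.1))) ''
        {p | p.1 ∈ {γ' | genLevel γ' < n}})) : del P ∈ Algebra.adjoin F
      ((fun p : GenIndex K₀ K J × ℕ => (del^[p.2]) (incl q (b p.1))) ''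
        {p | p.1 ∈ {γ' | genLevel γ' < n}}) :=
  del_mem_adjoin_iterate (fun γ => incl q (b γ)) _ hP

end Generators

namespace MinimalGrading

variable {F : Type*} [Field F] {g : Type*} [LieRing g] [LieAlgebra F g] [CharZero F]
  {B : LinearMap.BilinForm F g} {e x f : g} (G : MinimalGrading B e x f)
  {K₀ K J : Type*} (c : Module.Basis K₀ F (grZeroCentralizer x f : Submodule F g))
  (u : Module.Basis K F (gr x (-1 / 2) : Submodule F g))
  (v : Module.Basis J F (gr x (1 / 2) : Submodule F g))
include G

/-- The vectors f, c_i, u_j lie in the kernel of ad f, while ad f is injective on F x ⊕ g_{1/2}.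
Within each of the two groups the degrees separate. -/
theorem linearIndependent_genVec :
    LinearIndependent F (genVec x f (fun i => (c i : g)) (fun i => (u i : g)) fun i => (v i : g)) := by
  have hx : x ≠ 0 := fun h => G.form_ef_ne (by rw [G.form_ef, h]; simp)
  have hc0 : ∀ i, (c i : g) ∈ (gr x 0 : Submodule F g) := fun i => (c i).2.1
  have hcu : ∀ i, Sum.elim (fun i => (c i : g)) (fun i => (u i : g)) i ∈
      (gr x 0 ⊔ gr x (-1 / 2) : Submodule F g) := by
    rintro (i | i)
    · exact Submodule.mem_sup_left (hc0 i)
    · exact Submodule.mem_sup_right (u i).2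
  refine LinearIndependent.sum_type (LinearIndependent.sum_type
    (LinearIndependent.of_subsingleton (v := fun _ : Unit => f) () G.f_ne)
    (LinearIndependent.sum_type (linearIndependent_coe_basis c) (linearIndependent_coe_basis u) ?_)
    ?_) (LinearIndependent.sum_type
      (LinearIndependent.of_subsingleton (v := fun _ : Unit => x) () hx)
      (linearIndependent_coe_basis v) ?_) ?_
  · exact (disjoint_gr x (i := 0) (j := -1 / 2) (by norm_num)).mono (span_range_le_of_mem hc0)
      (span_range_le_of_mem fun i => (u i).2)
  · refine Disjoint.mono (span_range_le_of_mem fun _ => G.f_mem)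
      (span_range_le_of_mem hcu)
      (Submodule.disjoint_def.mpr fun y hy hy' => ?_)
    obtain ⟨y₁, h₁, y₂, h₂, rfl⟩ := Submodule.mem_sup.mp hy'
    rw [G.eq_smul_f hy, map_add, G.form_eq_zero G.e_mem h₁ (by norm_num),
      G.form_eq_zero G.e_mem h₂ (by norm_num), add_zero, zero_div, zero_smul]
  · exact (disjoint_gr x (i := 0) (j := 1 / 2) (by norm_num)).mono
      (span_range_le_of_mem fun _ => x_mem) (span_range_le_of_mem fun i => (v i).2)
  · have hl : ∀ i, Sum.elim (fun _ : Unit => f) (Sum.elim (fun i => (c i : g)) fun i => (u i : g)) i ∈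
        LinearMap.ker (LieAlgebra.ad F g f : g →ₗ[F] g) := by
      rintro (i | i | i)
      · simp
      · exact (c i).2.2
      · exact G.eq_zero (lie_mem_gr G.f_mem (u i).2 rfl) (by norm_num)
    have hr : ∀ i, Sum.elim (fun _ : Unit => x) (fun i => (v i : g)) i ∈
        (Submodule.span F {x} ⊔ gr x (1 / 2) : Submodule F g) := by
      rintro (i | i)
      · exact Submodule.mem_sup_left (Submodule.mem_span_singleton_self x)
      · exact Submodule.mem_sup_right (v i).2
    refine Disjoint.mono (span_range_le_of_mem hl)
      (span_range_le_of_mem hr)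
      (Submodule.disjoint_def.mpr fun y hy hy' => ?_)
    obtain ⟨y₁, h₁, w, hw, rfl⟩ := Submodule.mem_sup.mp hy'
    obtain ⟨β, rfl⟩ := Submodule.mem_span_singleton.mp h₁
    rw [LinearMap.mem_ker, LieAlgebra.ad_apply, lie_add, lie_smul, G.lie_fx] at hy
    have h2 := congrArg (B e) hy
    rw [map_add, map_smul, G.form_eq_zero G.e_mem (G.lie_f_mem hw) (by norm_num), add_zero,
      map_zero, smul_eq_mul] at h2
    have hβ : β = 0 := (mul_eq_zero.mp h2).resolve_right G.form_ef_ne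
    rw [hβ, zero_smul, zero_add] at hy
    rw [hβ, zero_smul, zero_add, ← G.lie_e_lie_f hw, hy, lie_zero]

omit G in
theorem mem_span_genVec_half {y : g} (hy : y ∈ (gr x (1 / 2) : Submodule F g)) :
    y ∈ Submodule.span F (genVec x f (fun i => (c i : g)) (fun i => (u i : g)) (fun i => (v i : g)) ''
      {γ | genLevel γ < 1}) := by
  refine Submodule.span_mono ?_ (mem_span_coe_basis v hy)
  rintro _ ⟨i, rfl⟩
  exact ⟨.inr (.inr i), Nat.zero_lt_one, rfl⟩

theorem mem_span_genVec_zero {y : g} (hy : y ∈ (gr x 0 : Submodule F g)) :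
    y ∈ Submodule.span F (genVec x f (fun i => (c i : g)) (fun i => (u i : g)) (fun i => (v i : g)) ''
      {γ | genLevel γ < 2}) := by
  obtain ⟨β, hβ⟩ := G.exists_sub_smul_x_mem hy
  rw [← sub_add_cancel y (β • x)]
  refine add_mem (Submodule.span_mono ?_ (mem_span_coe_basis c hβ))
    (Submodule.smul_mem _ _ (Submodule.subset_span ⟨.inr (.inl ()), Nat.zero_lt_two, rfl⟩))
  rintro _ ⟨i, rfl⟩
  exact ⟨.inl (.inr (.inl i)), Nat.one_lt_two, rfl⟩

omit G in
theorem mem_span_genVec_neg_half {y : g} (hy : y ∈ (gr x (-1 / 2) : Submodule F g)) :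
    y ∈ Submodule.span F (genVec x f (fun i => (c i : g)) (fun i => (u i : g)) (fun i => (v i : g)) ''
      {γ | genLevel γ < 3}) := by
  refine Submodule.span_mono ?_ (mem_span_coe_basis u hy)
  rintro _ ⟨i, rfl⟩
  exact ⟨.inl (.inr (.inr i)), Nat.lt_succ_self 2, rfl⟩

section

variable {ι : Type*} {q : Module.Basis ι F g} {deg : ι → ℚ}
  (hq : ∀ i, q i ∈ (gr x (deg i) : Submodule F g))
include hq

omit G in
theorem mem_span_basis_of_le {j : ℚ} (hj : j ≤ 1 / 2) {y : g}
    (hy : y ∈ (gr x j : Submodule F g)) : y ∈ Submodule.span F (q '' {i | deg i ≤ 1 / 2}) := by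
  rw [← Submodule.Quotient.mk_eq_zero]
  refine linearMap_eq_of_mem_gr hq (l := Submodule.mkQ _) (l' := 0) (fun i hi => ?_) hy
  rw [LinearMap.zero_apply, Submodule.mkQ_apply, Submodule.Quotient.mk_eq_zero]
  exact Submodule.subset_span ⟨i, by simpa [hi] using hj, rfl⟩

theorem adjoin_incl_genVec : Algebra.adjoin F (Set.range fun p : GenIndex K₀ K J × ℕ => (del^[p.2])
      (incl q (genVec x f (fun i => (c i : g)) (fun i => (u i : g)) (fun i => (v i : g)) p.1))) =
    MvPolynomial.supported F {p : ι × ℕ | deg p.1 ≤ 1 / 2} := by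
  refine adjoin_iterate_del_incl q (s := {i | deg i ≤ 1 / 2}) ?_ fun i hi => ?_
  · rintro ((_ | i | i) | _ | i)
    · exact mem_span_basis_of_le hq (by norm_num) G.f_mem
    · exact mem_span_basis_of_le hq (by norm_num) (c i).2.1
    · exact mem_span_basis_of_le hq (by norm_num) (u i).2
    · exact mem_span_basis_of_le hq (by norm_num) x_mem
    · exact mem_span_basis_of_le hq le_rfl (v i).2
  · have hi' : deg i ≤ 1 / 2 := hi
    have hqi := hq i
    rcases G.deg_eq hq i with h | h | h | h | h
    · rw [h] at hqi
      rw [G.eq_smul_f hqi]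
      exact Submodule.smul_mem _ _ (Submodule.subset_span ⟨.inl (.inl ()), rfl⟩)
    · rw [h] at hqi
      exact Submodule.span_mono (Set.image_subset_range _ _) (mem_span_genVec_neg_half c u v hqi)
    · rw [h] at hqi
      exact Submodule.span_mono (Set.image_subset_range _ _) (G.mem_span_genVec_zero c u v hqi)
    · rw [h] at hqi
      exact Submodule.span_mono (Set.image_subset_range _ _) (mem_span_genVec_half c u v hqi)
    · norm_num [h] at hi'

end

variable {ι : Type*} {q : Module.Basis ι F g} {deg : ι → ℚ}
  (hq : ∀ i, q i ∈ (gr x (deg i) : Submodule F g))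
  {J₀ : Type*} [Fintype J₀] [Fintype J] {a a' : J₀ → g} {v' : J → g}
  (ha : IsDualOn (fun y w => B y w) (gr x 0) a a')
  (hv : IsDualOn (fun y w => symplectic B f y w) (gr x (1 / 2)) (fun k => (v k : g)) v')
include hv

omit G in
theorem phi_sub_incl_mem {S : Subalgebra F (DiffPoly F ι)}
    (h1 : ∀ y ∈ (gr x (1 / 2) : Submodule F g), incl q y ∈ S) {b : g}
    (hb : b ∈ (gr x 0 : Submodule F g)) : phi q (fun k => (v k : g)) v' b - incl q b ∈ S := by
  rw [phi, add_sub_cancel_left]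
  exact Subalgebra.smul_mem _ (sum_mem fun k _ => mul_mem
    (h1 _ (lie_mem_gr hb (v k).2 (by norm_num))) (h1 _ (hv.mem' k))) _

theorem psi_sub_incl_mem {S : Subalgebra F (DiffPoly F ι)} (hS : ∀ P ∈ S, del P ∈ S)
    (h0 : ∀ y ∈ (gr x 0 : Submodule F g), incl q y ∈ S)
    (h1 : ∀ y ∈ (gr x (1 / 2) : Submodule F g), incl q y ∈ S) {y : g}
    (hy : y ∈ (gr x (-1 / 2) : Submodule F g)) :
    psi q e (fun k => (v k : g)) v' y - incl q y ∈ S := by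
  have hb : ∀ k, ⁅y, (v k : g)⁆ ∈ (gr x 0 : Submodule F g) := fun k =>
    lie_mem_gr hy (v k).2 (by norm_num)
  rw [psi, add_assoc, add_assoc, add_sub_cancel_left]
  exact add_mem (Subalgebra.smul_mem _ (sum_mem fun i _ => sum_mem fun k _ => mul_mem (mul_mem
    (h1 _ (lie_mem_gr (hb i) (v k).2 (by norm_num))) (h1 _ (hv.mem' i))) (h1 _ (hv.mem' k))) _)
    (add_mem (sum_mem fun k _ => mul_mem (h0 _ (hb k)) (h1 _ (hv.mem' k)))
      (hS _ (h1 _ (G.lie_e_mem hy))))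

include ha

theorem virL_sub_incl_mem {S : Subalgebra F (DiffPoly F ι)} (hS : ∀ P ∈ S, del P ∈ S)
    (h0 : ∀ y ∈ (gr x 0 : Submodule F g), incl q y ∈ S)
    (h1 : ∀ y ∈ (gr x (1 / 2) : Submodule F g), incl q y ∈ S)
    (h2 : ∀ y ∈ (gr x (-1 / 2) : Submodule F g), incl q y ∈ S) :
    virL q f x a a' (fun k => (v k : g)) v' - incl q f ∈ S := by
  rw [virL, add_assoc, add_assoc, add_assoc, add_sub_cancel_left]
  exact add_mem (hS _ (h0 _ x_mem)) (add_mem (Subalgebra.smul_mem _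
    (sum_mem fun j _ => mul_mem (h0 _ (ha.mem j)) (h0 _ (ha.mem' j))) _) (add_mem
    (sum_mem fun k _ => mul_mem (h1 _ (hv.mem' k)) (h2 _ (G.lie_f_mem (v k).2)))
    (Subalgebra.smul_mem _ (sum_mem fun k _ => mul_mem (h1 _ (hv.mem' k))
      (hS _ (h1 _ (v k).2))) _)))

/-- The correction in φ uses only g_{1/2}, that in ψ uses g_0 and g_{1/2}, and that in L uses
g_{-1/2} as well; the levels 1, 2, 3 record this. Putting x at level 0 is what makes all of g_0
available below level 2. -/
theorem generator_sub_incl_mem (γ : GenIndex K₀ K J) :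
    generator q x (fun k => (v k : g)) (virL q f x a a' (fun k => (v k : g)) v')
        (fun i => phi q (fun k => (v k : g)) v' (c i))
        (fun i => psi q e (fun k => (v k : g)) v' (u i)) γ -
      incl q (genVec x f (fun i => (c i : g)) (fun i => (u i : g)) (fun i => (v i : g)) γ) ∈
    Algebra.adjoin F ((fun p : GenIndex K₀ K J × ℕ => (del^[p.2]) (incl q (genVec x f
      (fun i => (c i : g)) (fun i => (u i : g)) (fun i => (v i : g)) p.1))) ''
        {p | p.1 ∈ {γ' | genLevel γ' < genLevel γ}}) := by
  have hm := fun {m n} => incl_mem_adjoin_genVec q (m := m) (n := n)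
    (genVec x f (fun i => (c i : g)) (fun i => (u i : g)) (fun i => (v i : g)))
  have hd := fun n => del_mem_adjoin_genVec q
    (genVec x f (fun i => (c i : g)) (fun i => (u i : g)) (fun i => (v i : g))) n
  rcases γ with (_ | i | i) | _ | i
  · exact G.virL_sub_incl_mem v ha hv (hd 3)
      (fun y hy => hm (show 2 ≤ 3 by norm_num) y (G.mem_span_genVec_zero c u v hy))
      (fun y hy => hm (show 1 ≤ 3 by norm_num) y (mem_span_genVec_half c u v hy))
      (fun y hy => hm (show 3 ≤ 3 by norm_num) y (mem_span_genVec_neg_half c u v hy))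
  · exact phi_sub_incl_mem v hv
      (fun y hy => hm (show 1 ≤ 1 by norm_num) y (mem_span_genVec_half c u v hy)) (c i).2.1
  · exact G.psi_sub_incl_mem v hv (hd 2)
      (fun y hy => hm (show 2 ≤ 2 by norm_num) y (G.mem_span_genVec_zero c u v hy))
      (fun y hy => hm (show 1 ≤ 2 by norm_num) y (mem_span_genVec_half c u v hy)) (u i).2
  · simp [generator, genVec]
  · simp [generator, genVec]

theorem algebraicIndependent_generator :
    AlgebraicIndependent F fun p : GenIndex K₀ K J × ℕ => (del^[p.2])
      (generator q x (fun k => (v k : g)) (virL q f x a a' (fun k => (v k : g)) v')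
        (fun i => phi q (fun k => (v k : g)) v' (c i))
        (fun i => psi q e (fun k => (v k : g)) v' (u i)) p.1) :=
  algebraicIndependent_iterate_del_of_sub_mem q genLevel (G.linearIndependent_genVec c u v)
    (G.generator_sub_incl_mem c u v ha hv)

include hq

theorem adjoin_generator :
    Algebra.adjoin F (Set.range fun p : GenIndex K₀ K J × ℕ => (del^[p.2])
      (generator q x (fun k => (v k : g)) (virL q f x a a' (fun k => (v k : g)) v')
        (fun i => phi q (fun k => (v k : g)) v' (c i))
        (fun i => psi q e (fun k => (v k : g)) v' (u i)) p.1)) =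
      MvPolynomial.supported F {p : ι × ℕ | deg p.1 ≤ 1 / 2} :=
  (adjoin_iterate_del_of_sub_mem q genLevel (G.generator_sub_incl_mem c u v ha hv)).trans
    (G.adjoin_incl_genVec c u v hq)

end MinimalGrading

/-! ### Conformal weights of the generators -/

section Weights

variable {F : Type*} [Field F] {g : Type*} [LieRing g] [LieAlgebra F g] {ι : Type*}
  {K₀ K J : Type*}

/-- The conformal weights of the generators. -/
def genWeight : GenIndex K₀ K J → ℚ :=
  Sum.elim (Sum.elim (fun _ => 2) (Sum.elim (fun _ => 1) fun _ => 3 / 2))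
    (Sum.elim (fun _ => 1) fun _ => 1 / 2)

/-- `φ` as a linear map. -/
def phiLin [Fintype J] (q : Module.Basis ι F g) (v v' : J → g) : g →ₗ[F] DiffPoly F ι :=
  IsLinearMap.mk' (phi q v v') ⟨fun y w => by
    simp only [phi, map_add, add_lie, add_mul, Finset.sum_add_distrib, smul_add]
    abel, fun r y => by
    simp only [phi, map_smul, smul_lie, smul_mul_assoc, ← Finset.smul_sum, smul_add]
    rw [smul_comm]⟩

/-- `ψ` as a linear map. -/
def psiLin [Fintype J] (q : Module.Basis ι F g) (e : g) (v v' : J → g) : g →ₗ[F] DiffPoly F ι :=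
  IsLinearMap.mk' (psi q e v v') ⟨fun y w => by
    simp only [psi, map_add, add_lie, lie_add, add_mul, Finset.sum_add_distrib, smul_add]
    abel, fun r y => by
    simp only [psi, map_smul, smul_lie, lie_smul, smul_mul_assoc, ← Finset.smul_sum, smul_add]
    rw [smul_comm, (del (F := F) (ι := ι)).map_smul]⟩

theorem injOn_of_linearIndependent {M : Type*} [AddCommGroup M] [Module F M] {U : Submodule F g}
    {I : Type*} (b : Module.Basis I F U) (l : g →ₗ[F] M)
    (h : LinearIndependent F fun i => l (b i)) : Set.InjOn l U := by
  have hker : ∀ y : U, l y = 0 → y = 0 := fun y hy => by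
    have h1 : Finsupp.linearCombination F (fun i => l (b i)) (b.repr y) = l y := by
      conv_rhs => rw [← b.linearCombination_repr y]
      rw [Finsupp.linearCombination_apply, Finsupp.linearCombination_apply, Finsupp.sum,
        Finsupp.sum, Submodule.coe_sum, map_sum]
      exact Finset.sum_congr rfl fun i _ => by rw [Submodule.coe_smul, map_smul]
    rw [hy] at h1
    exact b.repr.map_eq_zero_iff.mp (linearIndependent_iff.mp h _ h1)
  intro y hy w hw hyw
  have := hker (⟨y, hy⟩ - ⟨w, hw⟩) (by simp [hyw])
  simpa [sub_eq_zero] using this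

/-- The elements of `W` of weight `Δ`, when the only generators of this weight are the `l (b i)`. -/
theorem mem_image_of_isWeightedHomogeneous {τ Γ : Type*} {w : τ × ℕ → ℚ} {t : Γ → MvPolynomial (τ × ℕ) F}
    (ht : AlgebraicIndependent F t) {wt : Γ → ℚ}
    (hwt : ∀ γ, MvPolynomial.IsWeightedHomogeneous w (t γ) (wt γ)) {S : Set Γ}
    (hS : ∀ γ ∈ S, 1 ≤ wt γ) {Δ : ℚ} (hΔ : Δ ≠ 0) (hΔ' : Δ < 2)
    {M : Submodule F (MvPolynomial (τ × ℕ) F)} (hM : ∀ γ ∈ S, wt γ = Δ → t γ ∈ M)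
    {P : MvPolynomial (τ × ℕ) F} (hP : P ∈ Algebra.adjoin F (t '' S))
    (hP' : MvPolynomial.IsWeightedHomogeneous w P Δ) : P ∈ M := by
  rw [adjoin_image_eq_map_supported] at hP
  obtain ⟨p, hp, rfl⟩ := hP
  have hp' : p ∈ MvPolynomial.supported F S := hp
  -- Injectivity of evaluation at t pulls the homogeneity of the value back to p, so each monomial
  -- of p has weight Δ < 2 and is a single variable.
  have hhom : MvPolynomial.weightedHomogeneousComponent wt Δ p = p := by
    refine ht ?_
    rw [← weightedHomogeneousComponent_aeval hwt]
    exact hP'.weightedHomogeneousComponent_same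
  have hhom' : MvPolynomial.IsWeightedHomogeneous wt p Δ := by
    rw [← hhom]
    exact MvPolynomial.weightedHomogeneousComponent_isWeightedHomogeneous (w := wt) Δ p
  have hgoal : MvPolynomial.aeval t p ∈ M := by
    rw [p.as_sum, map_sum (MvPolynomial.aeval t)]
    refine sum_mem fun s hs => ?_
    have hws : Finsupp.weight wt s = Δ := hhom' (MvPolynomial.mem_support_iff.mp hs)
    have hsS : ∀ i ∈ s.support, i ∈ S := fun i hi =>
      MvPolynomial.mem_supported.mp hp'
        ((MvPolynomial.mem_vars_iff_mem_support i).mpr ⟨s, hs, hi⟩)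
    obtain ⟨i, hi, hsi, hwi⟩ := eq_single_of_weight_lt_two (fun i hi => hS i (hsS i hi))
      (by rw [hws]; exact hΔ) (by rw [hws]; exact hΔ')
    have h1 : MvPolynomial.aeval t (MvPolynomial.monomial s (MvPolynomial.coeff s p)) =
        MvPolynomial.coeff s p • t i := by
      rw [MvPolynomial.aeval_monomial, Algebra.smul_def]
      congr 1
      rw [hsi, Finsupp.prod_single_index (h := fun i k => t i ^ k) (pow_zero _), pow_one]
    rw [h1]
    exact Submodule.smul_mem _ _ (hM i (hsS i hi) (hwi.trans hws))
  exact hgoal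

end Weights

namespace MinimalGrading

variable {F : Type*} [Field F] {g : Type*} [LieRing g] [LieAlgebra F g] [CharZero F]
  {B : LinearMap.BilinForm F g} {e x f : g} (G : MinimalGrading B e x f)
  {ι : Type*} {q : Module.Basis ι F g} {deg : ι → ℚ}
  (hq : ∀ i, q i ∈ (gr x (deg i) : Submodule F g))
  {s : g} (hs : s ∈ (gr x 1 : Submodule F g)) (z : F)

section Homogeneity

include hq

omit G in
theorem isWeightedHomogeneous_incl {j : ℚ} {y : g} (hy : y ∈ (gr x j : Submodule F g)) {Δ : ℚ}
    (hΔ : Δ = 1 - j) : MvPolynomial.IsWeightedHomogeneous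
      (fun p : ι × ℕ => 1 - deg p.1 + (p.2 : ℚ)) (incl q y) Δ := by
  refine incl_mem_of_mem_gr hq (p := MvPolynomial.weightedHomogeneousSubmodule F _ Δ)
    (fun i hi => ?_) hy
  have := MvPolynomial.isWeightedHomogeneous_X F (fun p : ι × ℕ => 1 - deg p.1 + (p.2 : ℚ)) (i, 0)
  rw [hΔ, ← hi]
  simpa using this

omit G hq in
theorem isWeightedHomogeneous_conformal_del {P : DiffPoly F ι} {Δ : ℚ}
    (hP : MvPolynomial.IsWeightedHomogeneous (fun p : ι × ℕ => 1 - deg p.1 + (p.2 : ℚ)) P Δ) :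
    MvPolynomial.IsWeightedHomogeneous
      (fun p : ι × ℕ => 1 - deg p.1 + (p.2 : ℚ)) (del P) (Δ + 1) :=
  isWeightedHomogeneous_del (fun i n => by push_cast; ring) hP

omit G hq in
theorem isWeightedHomogeneous_iterate_del {P : DiffPoly F ι} {Δ : ℚ}
    (hP : MvPolynomial.IsWeightedHomogeneous (fun p : ι × ℕ => 1 - deg p.1 + (p.2 : ℚ)) P Δ)
    (n : ℕ) : MvPolynomial.IsWeightedHomogeneous
      (fun p : ι × ℕ => 1 - deg p.1 + (p.2 : ℚ)) ((del^[n]) P) (Δ + n) := by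
  induction n with
  | zero => simpa using hP
  | succ n ih =>
    rw [Function.iterate_succ_apply', Nat.cast_succ, ← add_assoc]
    exact isWeightedHomogeneous_conformal_del ih

omit G hq in
theorem isWeightedHomogeneous_smul {P : DiffPoly F ι} {w : ι × ℕ → ℚ} {Δ : ℚ}
    (hP : MvPolynomial.IsWeightedHomogeneous w P Δ) (r : F) :
    MvPolynomial.IsWeightedHomogeneous w (r • P) Δ :=
  Submodule.smul_mem (MvPolynomial.weightedHomogeneousSubmodule F w Δ) r hP

variable {J₀ J : Type*} [Fintype J₀] [Fintype J] {a a' : J₀ → g} {v v' : J → g}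
  (ha : IsDualOn (fun y w => B y w) (gr x 0) a a')
  (hv : IsDualOn (fun y w => symplectic B f y w) (gr x (1 / 2)) v v')
include hv

omit G in
theorem isWeightedHomogeneous_phi {b : g} (hb : b ∈ (gr x 0 : Submodule F g)) :
    MvPolynomial.IsWeightedHomogeneous (fun p : ι × ℕ => 1 - deg p.1 + (p.2 : ℚ))
      (phi q v v' b) 1 := by
  have hI : ∀ {j : ℚ} {y : g}, y ∈ (gr x j : Submodule F g) → _ := fun {j y} hy =>
    isWeightedHomogeneous_incl hq hy (Δ := 1 - j) rfl
  refine (isWeightedHomogeneous_incl hq hb (by norm_num)).add (isWeightedHomogeneous_smul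
    (MvPolynomial.IsWeightedHomogeneous.sum _ _ _ fun k _ => ?_) _)
  convert (hI (lie_mem_gr hb (hv.mem k) rfl)).mul (hI (hv.mem' k)) using 1
  norm_num

include G

theorem isWeightedHomogeneous_psi {u : g} (hu : u ∈ (gr x (-1 / 2) : Submodule F g)) :
    MvPolynomial.IsWeightedHomogeneous (fun p : ι × ℕ => 1 - deg p.1 + (p.2 : ℚ))
      (psi q e v v' u) (3 / 2) := by
  have hI : ∀ {j : ℚ} {y : g}, y ∈ (gr x j : Submodule F g) → _ := fun {j y} hy =>
    isWeightedHomogeneous_incl hq hy (Δ := 1 - j) rfl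
  refine MvPolynomial.IsWeightedHomogeneous.add (MvPolynomial.IsWeightedHomogeneous.add
    ((isWeightedHomogeneous_incl hq hu (by norm_num)).add (isWeightedHomogeneous_smul
    (MvPolynomial.IsWeightedHomogeneous.sum _ _ _ fun h _ =>
      MvPolynomial.IsWeightedHomogeneous.sum _ _ _ fun k _ => ?_) _))
    (MvPolynomial.IsWeightedHomogeneous.sum _ _ _ fun k _ => ?_)) ?_
  · convert ((hI (lie_mem_gr (lie_mem_gr hu (hv.mem h) rfl) (hv.mem k) rfl)).mul
      (hI (hv.mem' h))).mul (hI (hv.mem' k)) using 1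
    norm_num
  · convert (hI (lie_mem_gr hu (hv.mem k) rfl)).mul (hI (hv.mem' k)) using 1
    norm_num
  · convert isWeightedHomogeneous_conformal_del (hI (G.lie_e_mem hu)) using 1
    norm_num

include ha

theorem isWeightedHomogeneous_virL :
    MvPolynomial.IsWeightedHomogeneous (fun p : ι × ℕ => 1 - deg p.1 + (p.2 : ℚ))
      (virL q f x a a' v v') 2 := by
  have hI : ∀ {j : ℚ} {y : g}, y ∈ (gr x j : Submodule F g) → _ := fun {j y} hy =>
    isWeightedHomogeneous_incl hq hy (Δ := 1 - j) rfl
  refine MvPolynomial.IsWeightedHomogeneous.add (MvPolynomial.IsWeightedHomogeneous.add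
    (MvPolynomial.IsWeightedHomogeneous.add
    ((isWeightedHomogeneous_incl hq G.f_mem (by norm_num)).add ?_) (isWeightedHomogeneous_smul
    (MvPolynomial.IsWeightedHomogeneous.sum _ _ _ fun j _ => ?_) _))
    (MvPolynomial.IsWeightedHomogeneous.sum _ _ _ fun k _ => ?_)) (isWeightedHomogeneous_smul
    (MvPolynomial.IsWeightedHomogeneous.sum _ _ _ fun k _ => ?_) _)
  · convert isWeightedHomogeneous_conformal_del (hI (x_mem (F := F) (x := x))) using 1
    norm_num
  · convert (hI (ha.mem j)).mul (hI (ha.mem' j)) using 1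
    norm_num
  · convert (hI (hv.mem' k)).mul (hI (G.lie_f_mem (hv.mem k))) using 1
    norm_num
  · convert (hI (hv.mem' k)).mul (isWeightedHomogeneous_conformal_del (hI (hv.mem k))) using 1
    norm_num

end Homogeneity

/-! ### Closure properties and generation of the W-algebra -/

section Structure

include G hq

theorem del_mem_W {P : DiffPoly F ι} (hP : P ∈ W B q deg f x s z) :
    del P ∈ W B q deg f x s z := by
  rw [G.mem_W_iff hq] at hP ⊢
  exact ⟨del_mem_supported (s := {i | deg i ≤ 1 / 2}) hP.1,
    fun w hw => by rw [adDer_del, hP.2.1 w hw, map_zero], by rw [adDer_del, hP.2.2, map_zero]⟩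

theorem iterate_del_mem_W {P : DiffPoly F ι} (hP : P ∈ W B q deg f x s z) (n : ℕ) :
    (del^[n]) P ∈ W B q deg f x s z := by
  induction n with
  | zero => exact hP
  | succ n ih =>
    rw [Function.iterate_succ_apply']
    exact G.del_mem_W hq z ih

theorem adjoin_subset_W {S : Set (DiffPoly F ι)} (hS : S ⊆ W B q deg f x s z) :
    (Algebra.adjoin F S : Set (DiffPoly F ι)) ⊆ W B q deg f x s z := by
  intro P hP
  have hP' : P ∈ Algebra.adjoin F S := hP
  clear hP
  induction hP' using Algebra.adjoin_induction with
  | mem P hP => exact hS hP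
  | algebraMap c =>
    exact (G.mem_W_iff hq z).mpr ⟨algebraMap_mem _ c, fun w _ => Derivation.map_algebraMap _ c,
      Derivation.map_algebraMap _ c⟩
  | add P Q _ _ hP hQ =>
    rw [G.mem_W_iff hq] at hP hQ ⊢
    exact ⟨add_mem hP.1 hQ.1, fun w hw => by rw [map_add, hP.2.1 w hw, hQ.2.1 w hw, add_zero],
      by rw [map_add, hP.2.2, hQ.2.2, add_zero]⟩
  | mul P Q _ _ hP hQ =>
    rw [G.mem_W_iff hq] at hP hQ ⊢
    exact ⟨mul_mem hP.1 hQ.1, fun w hw => by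
      rw [Derivation.leibniz, hP.2.1 w hw, hQ.2.1 w hw, smul_zero, smul_zero, add_zero],
      by rw [Derivation.leibniz, hP.2.2, hQ.2.2, smul_zero, smul_zero, add_zero]⟩

include hs

variable {K₀ K J : Type*} {v v' : J → g} {w : GenIndex K₀ K J → DiffPoly F ι}

omit G hq hs in
theorem adDer_iterate_del_of_eq_scalar {y : g} {P : DiffPoly F ι} {κ : F}
    (h : adDer B q deg f s z y P = C (MvPolynomial.C κ)) (n : ℕ) :
    adDer B q deg f s z y ((del^[n]) P) = C (MvPolynomial.C κ) * X ^ n := by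
  rw [← lamDel_pow_scalar, ← h]
  clear h
  induction n with
  | zero => rfl
  | succ n ih => rw [Function.iterate_succ_apply', adDer_del, ih, pow_succ', Module.End.mul_apply]

/-- The W-algebra is generated by those of the generators of `V(g_{≤1/2})` that lie in it. -/
theorem adjoin_eq_W [DecidableEq J]
    (ht : AlgebraicIndependent F fun p : GenIndex K₀ K J × ℕ => (del^[p.2]) (w p.1))
    (hadj : Algebra.adjoin F (Set.range fun p : GenIndex K₀ K J × ℕ => (del^[p.2]) (w p.1)) =
      MvPolynomial.supported F {p : ι × ℕ | deg p.1 ≤ 1 / 2})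
    (hW : ∀ γ, w (.inl γ) ∈ W B q deg f x s z) (hx : w (.inr (.inl ())) = incl q x)
    (hwv : ∀ k, w (.inr (.inr k)) = incl q (v k))
    (hv : ∀ k, v k ∈ (gr x (1 / 2) : Submodule F g))
    (hv' : ∀ k, v' k ∈ (gr x (1 / 2) : Submodule F g))
    (hvv : ∀ h k, B f ⁅v h, v' k⁆ = if h = k then 1 else 0) :
    (Algebra.adjoin F ((fun p : GenIndex K₀ K J × ℕ => (del^[p.2]) (w p.1)) ''
      {p | p.1 ∈ Set.range Sum.inl}) : Set (DiffPoly F ι)) = W B q deg f x s z := by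
  refine subset_antisymm (G.adjoin_subset_W hq z ?_) fun P hP => ?_
  · rintro _ ⟨⟨_, n⟩, ⟨γ, rfl⟩, rfl⟩
    exact G.iterate_del_mem_W hq z (hW γ) n
  obtain ⟨hsup, h1, h2⟩ := (G.mem_W_iff hq z).mp hP
  rw [← hadj, Algebra.adjoin_range_eq_range_aeval] at hsup
  obtain ⟨p, rfl⟩ := hsup
  have hinl : ∀ γ n, (∀ y ∈ (gr x (1 / 2) : Submodule F g),
      adDer B q deg f s z y ((del^[n]) (w (.inl γ))) = 0) ∧
      adDer B q deg f s z e ((del^[n]) (w (.inl γ))) = 0 := fun γ n =>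
    ((G.mem_W_iff hq z).mp (G.iterate_del_mem_W hq z (hW γ) n)).2
  -- The action of e sees only the x^{(n)}: it kills L, φ(c_i), ψ(u_j), which lie in W, and all of
  -- g_{1/2}.
  have hpx : ∀ n, MvPolynomial.pderiv (.inr (.inl ()), n) p = 0 := by
    refine pderiv_eq_zero_of_derivation ht (adDer B q deg f s z e) (κ := -2 * B x x) ?_ ?_ ?_ h2
    · rw [neg_mul, neg_ne_zero, ← G.form_ef]
      exact G.form_ef_ne
    · intro n
      refine adDer_iterate_del_of_eq_scalar z ?_ n
      rw [hx, G.adDer_e_zero hq hs z x_mem]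
    · rintro (γ | _ | k) n hne
      · exact .inl (hinl γ n).2
      · exact absurd rfl hne
      · refine .inl ?_
        have := adDer_iterate_del_of_eq_scalar (B := B) (deg := deg) (f := f) (s := s) z (κ := 0)
          (P := incl q (v k)) (y := e) (by rw [G.adDer_e_half hq hs z (hv k)]; simp) n
        simpa [hwv] using this
  -- Among the v_h^{(n)} the action of v^k sees only those with h = k. It does not kill x, so the
  -- x^{(n)} had to be eliminated beforehand.
  have hpv : ∀ k n, MvPolynomial.pderiv (.inr (.inr k), n) p = 0 := by
    intro k
    have hD : ∀ h n, adDer B q deg f s z (v' k) ((del^[n]) (w (.inr (.inr h)))) =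
        C (MvPolynomial.C (-if h = k then 1 else 0)) * X ^ n := fun h n => by
      refine adDer_iterate_del_of_eq_scalar z ?_ n
      rw [hwv, G.adDer_half_half hq hs z (hv' k) (hv h), symplectic_skew, symplectic_apply, hvv,
        neg_one_mul]
    refine pderiv_eq_zero_of_derivation ht (adDer B q deg f s z (v' k)) (κ := -1) (by simp) ?_ ?_
      (h1 _ (hv' k))
    · intro n
      rw [hD k n, if_pos rfl]
    · rintro (γ | _ | h) n hne
      · exact .inl ((hinl γ n).1 _ (hv' k))
      · exact .inr (hpx n)
      · have hhk : h ≠ k := fun hhk => hne (by rw [hhk])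
        refine .inl ?_
        rw [hD h n, if_neg hhk]
        simp
  rw [SetLike.mem_coe, adjoin_image_eq_map_supported]
  refine ⟨p, MvPolynomial.mem_supported.mpr ?_, rfl⟩
  rintro ⟨γ | _ | k, n⟩ hγ
  · exact ⟨γ, rfl⟩
  · exact absurd hγ (notMem_vars_of_pderiv_eq_zero (hpx n))
  · exact absurd hγ (notMem_vars_of_pderiv_eq_zero (hpv k n))

end Structure

end MinimalGrading

/-! ### Eigenvectors of the Virasoro element -/

section Eigen

variable {F : Type*} [Field F] {ι : Type*}

/-- The elements `P` with `D P = (∂ + Δ λ) P + O(λ²)`. -/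
def eigSpace (D : Derivation F (DiffPoly F ι) (DiffPoly F ι)[X]) (Δ : F) :
    Submodule F (DiffPoly F ι) where
  carrier := {P | (D P).coeff 0 = del P ∧ (D P).coeff 1 = Δ • P}
  add_mem' := fun {P Q} hP hQ => by
    refine ⟨?_, ?_⟩
    · rw [map_add, coeff_add, hP.1, hQ.1, map_add]
    · rw [map_add, coeff_add, hP.2, hQ.2, smul_add]
  zero_mem' := by simp
  smul_mem' := fun r P hP => by
    refine ⟨?_, ?_⟩
    · rw [Derivation.map_smul, coeff_smul, hP.1, Derivation.map_smul]
    · rw [Derivation.map_smul, coeff_smul, hP.2, smul_comm]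

variable {D : Derivation F (DiffPoly F ι) (DiffPoly F ι)[X]} {Δ Δ' : F} {P Q : DiffPoly F ι}

theorem mem_eigSpace : P ∈ eigSpace D Δ ↔ (D P).coeff 0 = del P ∧ (D P).coeff 1 = Δ • P := Iff.rfl

theorem C_mem_eigSpace (r : F) : MvPolynomial.C r ∈ eigSpace D 0 := by
  rw [mem_eigSpace, ← MvPolynomial.algebraMap_eq, Derivation.map_algebraMap,
    Derivation.map_algebraMap]
  simp

theorem mul_mem_eigSpace (hP : P ∈ eigSpace D Δ) (hQ : Q ∈ eigSpace D Δ') :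
    P * Q ∈ eigSpace D (Δ + Δ') := by
  rw [mem_eigSpace] at *
  rw [Derivation.leibniz, Derivation.leibniz, coeff_add, coeff_add, coeff_smul, coeff_smul,
    coeff_smul, coeff_smul, hP.1, hP.2, hQ.1, hQ.2]
  refine ⟨rfl, ?_⟩
  simp only [smul_eq_mul, MvPolynomial.smul_eq_C_mul, map_add]
  ring

theorem del_mem_eigSpace (hD : ∀ h, D (del h) = lamDel (D h)) (hP : P ∈ eigSpace D Δ) :
    del P ∈ eigSpace D (Δ + 1) := by
  rw [mem_eigSpace] at *
  rw [hD, coeff_lamDel_zero, coeff_lamDel_succ, hP.1, hP.2, Derivation.map_smul, add_smul, one_smul]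
  exact ⟨rfl, rfl⟩

theorem iterate_del_mem_eigSpace (hD : ∀ h, D (del h) = lamDel (D h)) (hP : P ∈ eigSpace D Δ)
    (n : ℕ) : (del^[n]) P ∈ eigSpace D (Δ + n) := by
  induction n with
  | zero => simpa using hP
  | succ n ih =>
    rw [Function.iterate_succ_apply', Nat.cast_succ, ← add_assoc]
    exact del_mem_eigSpace hD ih

/-- An algebra of polynomials in eigenvectors has a basis of eigenvectors. -/
theorem exists_eigenbasis {Γ : Type*} {t : Γ → DiffPoly F ι} (ht : AlgebraicIndependent F t)
    (hD : ∀ γ, ∃ Δ, t γ ∈ eigSpace D Δ) : ∃ S : Set (DiffPoly F ι), LinearIndepOn F id S ∧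
      Submodule.span F S = Subalgebra.toSubmodule (Algebra.adjoin F (Set.range t)) ∧
      ∀ P ∈ S, ∃ Δ, P ∈ eigSpace D Δ := by
  refine ⟨Set.range fun s : Γ →₀ ℕ => MvPolynomial.aeval t (MvPolynomial.monomial s (1 : F)),
    ?_, ?_, ?_⟩
  · have h := (MvPolynomial.basisMonomials Γ F).linearIndependent.map'
      (MvPolynomial.aeval t).toLinearMap (LinearMap.ker_eq_bot.mpr ht)
    have h2 : (fun s : Γ →₀ ℕ => MvPolynomial.aeval t (MvPolynomial.monomial s (1 : F))) =
        (MvPolynomial.aeval t).toLinearMap ∘ MvPolynomial.basisMonomials Γ F := by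
      funext s
      simp
    rw [h2]
    exact h.linearIndepOn_id
  · have h2 : (Set.range fun s : Γ →₀ ℕ => MvPolynomial.aeval t (MvPolynomial.monomial s (1 : F))) =
        (MvPolynomial.aeval t).toLinearMap '' Set.range (MvPolynomial.basisMonomials Γ F) := by
      rw [← Set.range_comp]
      congr 1
    rw [h2, ← Submodule.map_span, Module.Basis.span_eq, Submodule.map_top,
      Algebra.adjoin_range_eq_range_aeval]
    rfl
  · rintro _ ⟨s, rfl⟩
    refine MvPolynomial.induction_on_monomial
      (motive := fun p => ∃ Δ, MvPolynomial.aeval t p ∈ eigSpace D Δ) ?_ ?_ s 1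
    · exact fun r => ⟨0, by rw [MvPolynomial.algHom_C]; exact C_mem_eigSpace r⟩
    · rintro p γ ⟨Δ, hp⟩
      obtain ⟨Δ', hγ⟩ := hD γ
      exact ⟨Δ + Δ', by rw [map_mul, MvPolynomial.aeval_X]; exact mul_mem_eigSpace hp hγ⟩

end Eigen

namespace MinimalGrading

variable {F : Type*} [Field F] {g : Type*} [LieRing g] [LieAlgebra F g] [CharZero F]
  {B : LinearMap.BilinForm F g} {e x f : g} (G : MinimalGrading B e x f)
  {ι : Type*} {q : Module.Basis ι F g} {deg : ι → ℚ}
  (hq : ∀ i, q i ∈ (gr x (deg i) : Submodule F g))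
  {s : g} (hs : s ∈ (gr x 1 : Submodule F g)) (z : F)
include G hq

/-- At z = 0 the only defect is the λ² term, which the eigenvector condition ignores. -/
theorem incl_mem_eigSpace {I : Type*} [Fintype I] {p p' : I → g}
    (hp : IsDualOn (fun y w => B y w) ⊤ p p') {j : ℚ} {y : g}
    (hy : y ∈ (gr x j : Submodule F g)) (hj : j ≤ 1 / 2) {Δ : F} (hΔ : Δ = 1 - (j : F)) :
    incl q y ∈ eigSpace (sugawaraDer B q deg f x s 0 p p') Δ := by
  rw [mem_eigSpace, G.sugawaraDer_incl 0 hp hy, G.rhoIncl_eq_incl hq hj hy, ← hΔ]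
  simp [coeff_X, MvPolynomial.smul_eq_C_mul]

variable {J₀ J : Type*} [Fintype J₀] [Fintype J] {a a' : J₀ → g} {v v' : J → g}
  (ha : IsDualOn (fun y w => B y w) (gr x 0) a a')
  (hv : IsDualOn (fun y w => symplectic B f y w) (gr x (1 / 2)) v v')
include hv

theorem phi_mem_eigSpace {I : Type*} [Fintype I] {p p' : I → g}
    (hp : IsDualOn (fun y w => B y w) ⊤ p p') {b : g} (hb : b ∈ (gr x 0 : Submodule F g)) :
    phi q v v' b ∈ eigSpace (sugawaraDer B q deg f x s 0 p p') 1 := by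
  have h1 : ∀ {y}, y ∈ (gr x (1 / 2) : Submodule F g) →
      incl q y ∈ eigSpace (sugawaraDer B q deg f x s 0 p p') (1 / 2) := fun hy =>
    G.incl_mem_eigSpace hq hp hy le_rfl (by push_cast; norm_num)
  refine add_mem (G.incl_mem_eigSpace hq hp hb (by norm_num) (by simp)) (Submodule.smul_mem _ _
    (sum_mem fun k _ => ?_))
  convert mul_mem_eigSpace (h1 (lie_mem_gr hb (hv.mem k) (by norm_num))) (h1 (hv.mem' k)) using 2
  norm_num

theorem psi_mem_eigSpace {I : Type*} [Fintype I] {p p' : I → g}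
    (hp : IsDualOn (fun y w => B y w) ⊤ p p') {u : g}
    (hu : u ∈ (gr x (-1 / 2) : Submodule F g)) :
    psi q e v v' u ∈ eigSpace (sugawaraDer B q deg f x s 0 p p') (3 / 2) := by
  have h0 : ∀ {y}, y ∈ (gr x 0 : Submodule F g) →
      incl q y ∈ eigSpace (sugawaraDer B q deg f x s 0 p p') 1 := fun hy =>
    G.incl_mem_eigSpace hq hp hy (by norm_num) (by simp)
  have h1 : ∀ {y}, y ∈ (gr x (1 / 2) : Submodule F g) →
      incl q y ∈ eigSpace (sugawaraDer B q deg f x s 0 p p') (1 / 2) := fun hy =>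
    G.incl_mem_eigSpace hq hp hy le_rfl (by push_cast; norm_num)
  have hb : ∀ k, ⁅u, v k⁆ ∈ (gr x 0 : Submodule F g) := fun k =>
    lie_mem_gr hu (hv.mem k) (by norm_num)
  refine add_mem (add_mem (add_mem (G.incl_mem_eigSpace hq hp hu (by norm_num)
    (by push_cast; norm_num)) (Submodule.smul_mem _ _ (sum_mem fun h _ => sum_mem fun k _ => ?_)))
    (sum_mem fun k _ => ?_)) ?_
  · convert mul_mem_eigSpace (mul_mem_eigSpace (h1 (lie_mem_gr (hb h) (hv.mem k) (by norm_num)))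
      (h1 (hv.mem' h))) (h1 (hv.mem' k)) using 2
    norm_num
  · convert mul_mem_eigSpace (h0 (hb k)) (h1 (hv.mem' k)) using 2
    norm_num
  · convert del_mem_eigSpace (sugawaraDer_del B q deg f x s 0 p p') (h1 (G.lie_e_mem hu)) using 2
    norm_num

include hs ha

theorem virL_mem_eigSpace : virL q f x a a' v v' ∈ eigSpace (sugawaraDer B q deg f x s 0
    (casimirLeft e f a v v') (casimirRight B e f a' v v')) 2 := by
  have h2 : MvPolynomial.C 2 = (2 : DiffPoly F ι) := map_ofNat _ 2
  rw [mem_eigSpace, G.sugawaraDer_virL hq hs 0 ha hv, mul_assoc, ← C_ofNat,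
    ← MvPolynomial.C_mul', h2]
  simp [coeff_X, coeff_X_pow, -map_neg, coeff_C_mul]

end MinimalGrading

/-! ### The structure of the W-algebra -/

namespace MinimalGrading

variable {F : Type*} [Field F] {g : Type*} [LieRing g] [LieAlgebra F g] [CharZero F]
  {B : LinearMap.BilinForm F g} {e x f : g} (G : MinimalGrading B e x f)
  {ι : Type*} {q : Module.Basis ι F g} {deg : ι → ℚ}
  (hq : ∀ i, q i ∈ (gr x (deg i) : Submodule F g))
  {s : g} (hs : s ∈ (gr x 1 : Submodule F g)) (z : F)
  {K₀ K J : Type*} (c : Module.Basis K₀ F (grZeroCentralizer x f : Submodule F g))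
  (u : Module.Basis K F (gr x (-1 / 2) : Submodule F g))
  (v : Module.Basis J F (gr x (1 / 2) : Submodule F g))
  {J₀ : Type*} [Fintype J₀] [Fintype J] [DecidableEq J] {a a' : J₀ → g} {v' : J → g}
  (ha : IsDualOn (fun y w => B y w) (gr x 0) a a')
  (hv : IsDualOn (fun y w => symplectic B f y w) (gr x (1 / 2)) (fun k => (v k : g)) v')
  (hvv : ∀ h k, B f ⁅(v h : g), v' k⁆ = if h = k then 1 else 0)
include G hq ha hv

theorem isWeightedHomogeneous_generator (p : GenIndex K₀ K J × ℕ) :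
    MvPolynomial.IsWeightedHomogeneous (fun p : ι × ℕ => 1 - deg p.1 + (p.2 : ℚ))
      ((del^[p.2]) (generator q x (fun k => (v k : g)) (virL q f x a a' (fun k => (v k : g)) v')
        (fun i => phi q (fun k => (v k : g)) v' (c i))
        (fun i => psi q e (fun k => (v k : g)) v' (u i)) p.1)) (genWeight p.1 + p.2) := by
  refine isWeightedHomogeneous_iterate_del ?_ _
  rcases p with ⟨(_ | i | i) | _ | i, n⟩
  · exact G.isWeightedHomogeneous_virL hq ha hv
  · exact isWeightedHomogeneous_phi hq hv (c i).2.1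
  · exact G.isWeightedHomogeneous_psi hq hv (u i).2
  · exact isWeightedHomogeneous_incl hq x_mem (by norm_num [genWeight])
  · exact isWeightedHomogeneous_incl hq (v i).2 (by norm_num [genWeight])

include hs hvv

theorem adjoin_generator_eq_W :
    (Algebra.adjoin F ((fun p : GenIndex K₀ K J × ℕ => (del^[p.2])
      (generator q x (fun k => (v k : g)) (virL q f x a a' (fun k => (v k : g)) v')
        (fun i => phi q (fun k => (v k : g)) v' (c i))
        (fun i => psi q e (fun k => (v k : g)) v' (u i)) p.1)) ''
      {p | p.1 ∈ Set.range Sum.inl}) : Set (DiffPoly F ι)) = W B q deg f x s z := by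
  refine G.adjoin_eq_W hq hs z (v := fun k => (v k : g)) (v' := v')
    (G.algebraicIndependent_generator c u v ha hv) (G.adjoin_generator c u v hq ha hv) ?_ rfl
    (fun _ => rfl) (fun k => (v k).2) hv.mem' hvv
  rintro (_ | i | i)
  · exact G.virL_mem_W hq hs z ha hv
  · exact G.phi_mem_W hq hs z hv (c i).2
  · exact G.psi_mem_W hq hs z hv (u i).2

include c u

/-- All generators have weight at least 1, so in weights below 2, constants being excluded by Δ ≠ 0,
only linear combinations of single derivatives of generators occur. -/
theorem mem_of_mem_Wgr {Δ : ℚ} (hΔ : Δ ≠ 0) (hΔ' : Δ < 2) {M : Submodule F (DiffPoly F ι)}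
    (hM : ∀ (γ : Unit ⊕ K₀ ⊕ K) (n : ℕ), genWeight (J := J) (.inl γ) + n = Δ →
      (del^[n]) (generator q x (fun k => (v k : g)) (virL q f x a a' (fun k => (v k : g)) v')
        (fun i => phi q (fun k => (v k : g)) v' (c i))
        (fun i => psi q e (fun k => (v k : g)) v' (u i)) (.inl γ)) ∈ M)
    {P : DiffPoly F ι} (hP : P ∈ Wgr B q deg f x s z Δ) : P ∈ M := by
  refine mem_image_of_isWeightedHomogeneous (G.algebraicIndependent_generator c u v ha hv)
    (G.isWeightedHomogeneous_generator hq c u v ha hv) (S := {p | p.1 ∈ Set.range Sum.inl})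
    ?_ hΔ hΔ' ?_ ?_ hP.2
  · rintro ⟨_, n⟩ ⟨γ, rfl⟩
    have hn : (0 : ℚ) ≤ n := n.cast_nonneg
    have : (1 : ℚ) ≤ genWeight (J := J) (.inl γ) := by
      rcases γ with _ | i | i <;> norm_num [genWeight]
    exact le_add_of_le_of_nonneg this hn
  · rintro ⟨_, n⟩ ⟨γ, rfl⟩ h
    exact hM γ n h
  · have := hP.1
    rwa [← G.adjoin_generator_eq_W hq hs z c u v ha hv hvv] at this

theorem bijOn_phi : Set.BijOn (phi q (fun k => (v k : g)) v')
    (grZeroCentralizer x f : Submodule F g) (Wgr B q deg f x s z 1) := by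
  refine ⟨fun b hb => ⟨G.phi_mem_W hq hs z hv hb, isWeightedHomogeneous_phi hq hv hb.1⟩, ?_, ?_⟩
  · refine injOn_of_linearIndependent c (phiLin q (fun k => (v k : g)) v') ?_
    exact (G.algebraicIndependent_generator (q := q) c u v ha hv).linearIndependent.comp
      (fun k => (.inl (.inr (.inl k)), 0)) fun k k' h => by simpa using h
  · intro P hP
    refine G.mem_of_mem_Wgr hq hs z c u v ha hv hvv (M := Submodule.map
      (phiLin q (fun k => (v k : g)) v') (grZeroCentralizer x f)) (by norm_num) (by norm_num) ?_ hP
    -- The available weights are 2 + n, 1 + n and 3/2 + n; only the undifferentiated φ(c_i) has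
    -- weight 1.
    rintro (_ | i | i) n hn
    · have hn' : (0 : ℚ) ≤ n := n.cast_nonneg
      simp only [genWeight, Sum.elim_inl] at hn
      linarith
    · simp only [genWeight, Sum.elim_inl, Sum.elim_inr] at hn
      obtain rfl : n = 0 := by exact_mod_cast (by linarith : (n : ℚ) = 0)
      exact ⟨c i, (c i).2, rfl⟩
    · have hn' : (0 : ℚ) ≤ n := n.cast_nonneg
      simp only [genWeight, Sum.elim_inl, Sum.elim_inr] at hn
      linarith

theorem bijOn_psi : Set.BijOn (psi q e (fun k => (v k : g)) v')
    (gr x (-1 / 2) : Submodule F g) (Wgr B q deg f x s z (3 / 2)) := by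
  refine ⟨fun b hb => ⟨G.psi_mem_W hq hs z hv hb, G.isWeightedHomogeneous_psi hq hv hb⟩, ?_, ?_⟩
  · refine injOn_of_linearIndependent u (psiLin q e (fun k => (v k : g)) v') ?_
    exact (G.algebraicIndependent_generator (q := q) c u v ha hv).linearIndependent.comp
      (fun k => (.inl (.inr (.inr k)), 0)) fun k k' h => by simpa using h
  · intro P hP
    refine G.mem_of_mem_Wgr hq hs z c u v ha hv hvv (M := Submodule.map
      (psiLin q e (fun k => (v k : g)) v') (gr x (-1 / 2))) (by norm_num) (by norm_num) ?_ hP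
    -- A derivative of φ(c_i) has integral weight, so weight 3/2 leaves only the undifferentiated
    -- ψ(u_i).
    rintro (_ | i | i) n hn
    · have hn' : (0 : ℚ) ≤ n := n.cast_nonneg
      simp only [genWeight, Sum.elim_inl] at hn
      linarith
    · simp only [genWeight, Sum.elim_inl, Sum.elim_inr] at hn
      have : ((2 * n : ℕ) : ℚ) = (1 : ℕ) := by push_cast; linarith
      have : 2 * n = 1 := by exact_mod_cast this
      omega
    · simp only [genWeight, Sum.elim_inl, Sum.elim_inr] at hn
      obtain rfl : n = 0 := by exact_mod_cast (by linarith : (n : ℚ) = 0)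
      exact ⟨u i, (u i).2, rfl⟩

theorem isDiffPolyAlgebraOn : IsDiffPolyAlgebraOn (W B q deg f x s z)
    (Sum.elim (fun _ : Unit => virL q f x a a' (fun k => (v k : g)) v')
      (Sum.elim (fun i => phi q (fun k => (v k : g)) v' (c i))
        (fun i => psi q e (fun k => (v k : g)) v' (u i)))) := by
  refine ⟨?_, ?_⟩
  · exact (G.algebraicIndependent_generator (q := q) c u v ha hv).comp
      (fun p : (Unit ⊕ K₀ ⊕ K) × ℕ => (.inl p.1, p.2)) fun p p' h => by
        simpa [Prod.ext_iff] using h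
  · rw [← G.adjoin_generator_eq_W hq hs z c u v ha hv hvv]
    congr 2
    ext P
    constructor
    · rintro ⟨⟨γ, n⟩, rfl⟩
      exact ⟨(.inl γ, n), ⟨γ, rfl⟩, rfl⟩
    · rintro ⟨⟨_, n⟩, ⟨γ, rfl⟩, rfl⟩
      exact ⟨(γ, n), rfl⟩

theorem isEnergyMomentum : IsEnergyMomentum (W B q deg f x s 0) (rhoBracket B q deg f s 0)
    (virL q f x a a' (fun k => (v k : g)) v') := by
  have hp := G.isDualOn_top ha hv
  obtain ⟨ht, hadj⟩ := G.isDiffPolyAlgebraOn hq hs 0 c u v ha hv hvv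
  refine ⟨G.virL_mem_W hq hs 0 ha hv, G.isVirasoro_virL hq hs 0 ha hv, ?_⟩
  obtain ⟨S, hS, hspan, heig⟩ := exists_eigenbasis (D := sugawaraDer B q deg f x s 0
    (casimirLeft e f a (fun k => (v k : g)) v') (casimirRight B e f a' (fun k => (v k : g)) v'))
    ht (by
      rintro ⟨_ | i | i, n⟩
      · exact ⟨_, iterate_del_mem_eigSpace (sugawaraDer_del B q deg f x s 0 _ _)
          (G.virL_mem_eigSpace hq hs ha hv) n⟩
      · exact ⟨_, iterate_del_mem_eigSpace (sugawaraDer_del B q deg f x s 0 _ _)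
          (G.phi_mem_eigSpace hq hv hp (c i).2.1) n⟩
      · exact ⟨_, iterate_del_mem_eigSpace (sugawaraDer_del B q deg f x s 0 _ _)
          (G.psi_mem_eigSpace hq hv hp (u i).2) n⟩)
  have hSW : (Submodule.span F S : Set (DiffPoly F ι)) = W B q deg f x s 0 := by
    rw [hspan, ← hadj]
    rfl
  refine ⟨S, hS, hSW, fun P hPS => ?_⟩
  have hPW : P ∈ W B q deg f x s 0 := hSW ▸ Submodule.subset_span hPS
  obtain ⟨Δ, h⟩ := heig P hPS
  refine ⟨Δ, ?_⟩
  -- On W the bracket with L is the Casimir derivation, so the two notions of eigenvector agree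
  -- there.
  rw [IsEigenvector, G.rhoBracket_virL hq 0 ha hv hPW]
  exact h

end MinimalGrading

end ClassicalW

end

/-! ### Assembly of the theorem -/

theorem theorem4p1
    {F : Type*} [Field F] [CharZero F] [IsAlgClosed F]
    {g : Type*} [LieRing g] [LieAlgebra F g] [FiniteDimensional F g] [LieAlgebra.IsSimple F g]
    (B : LinearMap.BilinForm F g) (hBnd : B.Nondegenerate) (hBsymm : B.IsSymm)
    (hBinv : B.lieInvariant g)
    (e x f : g) (htriple : IsSl2Triple ((2 : F) • x) e f)
    (hf : ClassicalW.IsMinimalNilpotent (F := F) f)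
    (d : ℚ) (hd : IsGreatest {j : ℚ | (ClassicalW.gr x j : Submodule F g) ≠ ⊥} d)
    (s : g) (hs : s ∈ (ClassicalW.gr x d : Submodule F g))
    -- a basis of `g` consisting of eigenvectors of `ad x`
    {ι : Type*} (q : Module.Basis ι F g) (deg : ι → ℚ)
    (hq : ∀ i, q i ∈ (ClassicalW.gr x (deg i) : Submodule F g))
    -- dual bases of `g_0` with respect to the bilinear form
    {J₀ : Type*} [Fintype J₀] [DecidableEq J₀]
    (a : Module.Basis J₀ F (ClassicalW.gr x 0 : Submodule F g))
    (a' : J₀ → (ClassicalW.gr x 0 : Submodule F g))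
    (ha : ∀ i j, B (a i : g) (a' j : g) = if i = j then 1 else 0)
    -- bases of `g_{1/2}` that are dual with respect to `ω_+(v, v₁) = (f|[v, v₁])`
    {J : Type*} [Fintype J] [DecidableEq J]
    (v : Module.Basis J F (ClassicalW.gr x (1 / 2) : Submodule F g))
    (v' : J → (ClassicalW.gr x (1 / 2) : Submodule F g))
    (hv : ∀ h k, B f ⁅(v h : g), (v' k : g)⁆ = if h = k then 1 else 0)
    -- bases of `g_0^f` and of `g_{-1/2}`
    {K₀ : Type*} (c : Module.Basis K₀ F (ClassicalW.grZeroCentralizer x f : Submodule F g))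
    {K : Type*} (u : Module.Basis K F (ClassicalW.gr x (-1 / 2) : Submodule F g))
    (z : F) :
    let L : ClassicalW.DiffPoly F ι :=
      ClassicalW.virL q f x (fun j => (a j : g)) (fun j => (a' j : g))
        (fun k => (v k : g)) (fun k => (v' k : g))
    let φ : g → ClassicalW.DiffPoly F ι :=
      ClassicalW.phi q (fun k => (v k : g)) (fun k => (v' k : g))
    let ψ : g → ClassicalW.DiffPoly F ι :=
      ClassicalW.psi q e (fun k => (v k : g)) (fun k => (v' k : g))
    Set.BijOn φ (ClassicalW.grZeroCentralizer x f : Submodule F g)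
        (ClassicalW.Wgr B q deg f x s z 1) ∧
      Set.BijOn ψ (ClassicalW.gr x (-1 / 2) : Submodule F g)
        (ClassicalW.Wgr B q deg f x s z (3 / 2)) ∧
      L ∈ ClassicalW.Wgr B q deg f x s z 2 ∧
      ClassicalW.IsVirasoro (ClassicalW.rhoBracket B q deg f s z) L ∧
      (z = 0 → ClassicalW.IsEnergyMomentum (ClassicalW.W B q deg f x s z)
        (ClassicalW.rhoBracket B q deg f s z) L) ∧
      ClassicalW.IsDiffPolyAlgebraOn (ClassicalW.W B q deg f x s z)
        (Sum.elim (fun _ : Unit => L)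
          (Sum.elim (fun k : K₀ => φ (c k : g)) (fun k : K => ψ (u k : g)))) := by
  have G := ClassicalW.minimalGrading_of_isSl2Triple hBnd hBsymm hBinv htriple
    hf.exists_lie_lie_eq_smul q deg hq
  -- The five-term grading bounds d by 1, and e shows that degree 1 occurs.
  have hd1 : d = 1 := by
    refine le_antisymm ?_ (hd.2 ?_)
    · rcases G.degree d hd.1 with rfl | rfl | rfl | rfl | rfl <;> norm_num
    · intro h
      exact htriple.e_ne_zero (by simpa [h] using G.e_mem)
  subst hd1
  have ha' := ClassicalW.isDualOn_of_basis B
    (fun w hw h => G.eq_zero_of_form hw fun y hy => h y (by simpa using hy)) a a' ha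
  have hv' := ClassicalW.isDualOn_of_basis (ClassicalW.MinimalGrading.symplectic B f)
    (fun w hw h => G.symplectic_eq_zero hw h) v v' hv
  refine ⟨G.bijOn_phi hq hs z c u v ha' hv' hv, G.bijOn_psi hq hs z c u v ha' hv' hv,
    ⟨G.virL_mem_W hq hs z ha' hv', G.isWeightedHomogeneous_virL hq ha' hv'⟩,
    G.isVirasoro_virL hq hs z ha' hv', ?_, G.isDiffPolyAlgebraOn hq hs z c u v ha' hv' hv⟩
  rintro rfl
  exact G.isEnergyMomentum hq hs c u v ha' hv' hv
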